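/- **Setting.** Let $(\mathcal A,\Delta,\epsilon)$ be a Hopf algebra over $\mathbb C$ with unit $I$, let $\mathcal I$ be a finite index set, and sum over repeated indices. For functionals $\rho,\rho'\in\mathcal A'$ and $a\in\mathcal A$ put $a*\rho=(\rho\otimes\mathrm{id})\Delta a$, $\rho*a=(\mathrm{id}\otimes\rho)\Delta a$, $\rho*\rho'=(\rho\otimes\rho')\Delta$. For matrices, $(v\otimes w)_{ij,kl}=v_{ik}w_{jl}$, and $\mathrm{Mor}(v,w)$ is the set of complex matrices $M$ with $Mv=wM$. The trivial representation is denoted by $I$ and the unit matrix by $\mathbf 1$. Let $\Lambda=(\Lambda_{ij})_{i,j\in\mathcal I}$ be a representation: $\Delta\Lambda_{ij}=\Lambda_{ik}\otimes\Lambda_{kj}$, $\epsilon(\Lambda_{ij})=\delta_{ij}$. Let $f_{ij},\eta_i\in\mathcal A'$ and $T_{ij}\in\mathbb C$ ($i,j\in\mathcal I$) be the parameters of an inhomogeneous quantum group, i.e. suppose that * $f_{st}(ab)=f_{sm}(a)f_{mt}(b)$, $f_{st}(I)=\delta_{st}$; $\eta_s(ab)=\eta_s(a)\epsilon(b)+f_{st}(a)\eta_t(b)$,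 $\eta_s(I)=0$; $\Lambda_{st}(f_{tr}*a)=(a*f_{st})\Lambda_{tr}$; * $R^2=\mathbf 1\otimes\mathbf 1$, where $R_{ij,sm}=f_{im}(\Lambda_{js})$; * $(\Lambda\otimes\Lambda)_{kl,ij}(\tau^{ij}*b)=b*\tau^{kl}$ for $b\in\mathcal A$, where $\tau^{kl}=(R-\mathbf 1\otimes\mathbf 1)_{kl,ij}\tau_{ij}$ and $\tau_{ij}=\eta_j*\eta_i-\eta_i(\Lambda_{js})\eta_s+T_{ij}\epsilon-(f_{jn}*f_{im})T_{mn}$; * $A_3F=0$ and $A_3(Z\otimes\mathbf 1-\mathbf 1\otimes Z)T\in\mathrm{Mor}(I,\Lambda\otimes\Lambda\otimes\Lambda)$, where $Z_{ij,m}=\eta_i(\Lambda_{jm})$, $F_{ijk,m}=\tau_{ij}(\Lambda_{km})$, $R_{12}=R\otimes\mathbf 1$, $R_{23}=\mathbf 1\otimes R$ and $A_3=\mathbf 1-R_{12}-R_{23}+R_{12}R_{23}+R_{23}R_{12}-R_{12}R_{23}R_{12}$. Let $\mathcal B$ be the universal unital algebra generated by the algebra $\mathcal A$ (with the same unit) and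 elements $p_s$ ($s\in\mathcal I$) with the relations $$p_sa=(a*f_{st})p_t+a*\eta_s-\Lambda_{st}(\eta_t*a)\quad(a\in\mathcal A),$$ $$(R-\mathbf 1\otimes\mathbf 1)_{kl,ij}\bigl(p_ip_j-\eta_i(\Lambda_{js})p_s+T_{ij}-\Lambda_{im}\Lambda_{jn}T_{mn}\bigr)=0 .$$ It is a bialgebra, with $\Delta,\epsilon$ extending those of $\mathcal A$ and $\Delta p_s=\Lambda_{st}\otimes p_t+p_s\otimes I$, $\epsilon(p_s)=0$. For $\pi$ in the symmetric group $\Pi_n$ put $R_\pi=R_{i_1}\cdots R_{i_s}$, where $\pi=t_{i_1}\cdots t_{i_s}$ is a chosen minimal decomposition into adjacent transpositions and $R_k=\mathbf 1^{\otimes(k-1)}\otimes R\otimes\mathbf 1^{\otimes(n-k-1)}$, and let $S_n=\frac1{n!}\sum_{\pi\in\Pi_n}R_\pi$, acting on $(\mathbb C^{\mathcal I})^{\otimes n}$ (with $S_0=\mathrm{id}_{\mathbb C}$). Write $\dim S_n$ for the rank of $S_n$. For a functional $\alpha$ on $(\mathbb C^{\mathcal I})^{\otimes n}$ and elements $x_i$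 of an algebra put $\alpha(x^{\otimes n})=\alpha_{i_1\cdots i_n}x_{i_1}\cdots x_{i_n}$. **Proposition.** Assume $\mathrm{Mor}(I,\Lambda\otimes\Lambda\otimes\Lambda)=\{0\}$. Let $\mathcal C$ be the universal unital algebra generated by $x_i$ ($i\in\mathcal I$) with the relations $$(R-\mathbf 1\otimes\mathbf 1)_{ij,kl}\bigl(x_kx_l-\eta_k(\Lambda_{lm})x_m+T_{kl}\bigr)=0 .$$ 1. There is a unique unital homomorphism $\Psi:\mathcal C\to\mathcal B\otimes\mathcal C$ with $\Psi x_i=\Lambda_{ij}\otimes x_j+p_i\otimes I$. It is a coaction: $(\epsilon\otimes\mathrm{id})\Psi=\mathrm{id}$ and $(\mathrm{id}\otimes\Psi)\Psi=(\Delta\otimes\mathrm{id})\Psi$. 2. If a linear subspace $W\subset\mathcal C$ satisfies $\Psi(W)\subset\mathcal A\otimes W$ (the image of $\mathcal A\otimes W$ in $\mathcal B\otimes\mathcal C$), then $W\subset\mathbb C I$. 3. For every $n\ge 0$, the space $(\mathbb C^{\mathcal I})^{\otimes n}$ has a basis that is the disjoint union of a basis of $\mathrm{im}\,S_n$ and a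 basis of $\mathrm{im}(\mathbf 1^{\otimes n}-S_n)$. For any choice of such bases, let $\alpha^{in}$, $i=1,\dots,\dim S_n$, be the elements of the dual basis that correspond to the basis of $\mathrm{im}\,S_n$. Then, for every $N\ge0$, the elements $\alpha^{in}(x^{\otimes n})$, $i=1,\dots,\dim S_n$, $n=0,1,\dots,N$, form a basis of $$\mathcal C^N=\mathrm{span}\{x_{i_1}\cdots x_{i_n}:\ i_1,\dots,i_n\in\mathcal I,\ n=0,1,\dots,N\}.$$ In particular $\dim\mathcal C^N=\sum_{n=0}^N\dim S_n$. -/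

import Mathlib

open scoped TensorProduct Kronecker

noncomputable section

namespace QuantumGroup

section Coalgebra

variable {A : Type*} [Ring A] [Bialgebra ℂ A]

/-- `a * ρ = (ρ ⊗ id) Δ a`, for a functional `ρ` on `A`. -/
def actL (ρ : Module.Dual ℂ A) : A →ₗ[ℂ] A :=
  (TensorProduct.lid ℂ A).toLinearMap ∘ₗ ρ.rTensor A ∘ₗ Coalgebra.comul

/-- `ρ * a = (id ⊗ ρ) Δ a`, for a functional `ρ` on `A`. -/
def actR (ρ : Module.Dual ℂ A) : A →ₗ[ℂ] A :=
  (TensorProduct.rid ℂ A).toLinearMap ∘ₗ ρ.lTensor A ∘ₗ Coalgebra.comul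

/-- The convolution `ρ * ρ' = (ρ ⊗ ρ') Δ` of functionals on `A`. -/
def convol (ρ ρ' : Module.Dual ℂ A) : Module.Dual ℂ A :=
  (TensorProduct.lid ℂ ℂ).toLinearMap ∘ₗ TensorProduct.map ρ ρ' ∘ₗ Coalgebra.comul

/-- `Mor(v, w)`: the complex matrices `M` with `M v = w M`. -/
def Mor {m n : Type*} [Fintype m] [Fintype n] (v : Matrix m m A) (w : Matrix n n A) :
    Submodule ℂ (Matrix n m ℂ) where
  carrier := {M | M.map (algebraMap ℂ A) * v = w * M.map (algebraMap ℂ A)}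
  zero_mem' := by simp
  add_mem' := by
    intro M N hM hN
    simp only [Set.mem_ofPred_eq] at *
    rw [Matrix.map_add _ (by simp), Matrix.add_mul, Matrix.mul_add, hM, hN]
  smul_mem' := by
    intro c M hM
    simp only [Set.mem_ofPred_eq] at *
    have h : (c • M).map (algebraMap ℂ A) = c • M.map (algebraMap ℂ A) := by
      ext i j
      simp [Algebra.smul_def]
    rw [h, Matrix.smul_mul, Matrix.mul_smul, hM]

end Coalgebra

section Tensor

variable {I J : Type*} [DecidableEq I]

/-- `M ⊗ 1`, from `V ⊗ V` to `V ⊗ V ⊗ V` etc. (triple products are indexed by `I × I × I`). -/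
def tensorOne {J' : Type*} (M : Matrix (I × I) J' ℂ) : Matrix (I × I × I) (J' × I) ℂ :=
  (M ⊗ₖ (1 : Matrix I I ℂ)).submatrix (Equiv.prodAssoc I I I).symm id

/-- `1 ⊗ M`. -/
def oneTensor {J' : Type*} (M : Matrix (I × I) J' ℂ) : Matrix (I × I × I) (I × J') ℂ :=
  (1 : Matrix I I ℂ) ⊗ₖ M

/-- `R ⊗ 1` as an operator of `V ⊗ V ⊗ V`. -/
def R₁₂ (R : Matrix (I × I) (I × I) ℂ) : Matrix (I × I × I) (I × I × I) ℂ :=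
  (tensorOne R).submatrix id (Equiv.prodAssoc I I I).symm

/-- `1 ⊗ R` as an operator of `V ⊗ V ⊗ V`. -/
def R₂₃ (R : Matrix (I × I) (I × I) ℂ) : Matrix (I × I × I) (I × I × I) ℂ :=
  oneTensor R

/-- `A₃ = 1 - R ⊗ 1 - 1 ⊗ R + (R ⊗ 1)(1 ⊗ R) + (1 ⊗ R)(R ⊗ 1) - (R ⊗ 1)(1 ⊗ R)(R ⊗ 1)`. -/
def antisymm₃ [Fintype I] (R : Matrix (I × I) (I × I) ℂ) : Matrix (I × I × I) (I × I × I) ℂ :=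
  1 - R₁₂ R - R₂₃ R + R₁₂ R * R₂₃ R + R₂₃ R * R₁₂ R - R₁₂ R * R₂₃ R * R₁₂ R

end Tensor

section Symmetrizer

variable {I : Type*} [Fintype I] [DecidableEq I]

/-- The positions `k`, `k + 1` acted upon by the `k`-th adjacent transposition of `n` letters. -/
def posL {n : ℕ} (k : Fin (n - 1)) : Fin n := ⟨k, by omega⟩

/-- See `posL`. -/
def posR {n : ℕ} (k : Fin (n - 1)) : Fin n := ⟨k + 1, by omega⟩

/-- The adjacent transposition `t_k`. -/
def adjSwap {n : ℕ} (k : Fin (n - 1)) : Equiv.Perm (Fin n) := Equiv.swap (posL k) (posR k)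

/-- `R_k = 1 ⊗ … ⊗ 1 ⊗ R ⊗ 1 ⊗ … ⊗ 1` on the `n`-th tensor power of `ℂ^I` (whose
coordinates are indexed by `Fin n → I`), with `R` acting on the factors `k`, `k + 1`. -/
def braidAt (R : Matrix (I × I) (I × I) ℂ) {n : ℕ} (k : Fin (n - 1)) :
    Matrix (Fin n → I) (Fin n → I) ℂ :=
  Matrix.of fun a b =>
    if ∀ l, l ≠ posL k → l ≠ posR k → a l = b l then
      R (a (posL k), a (posR k)) (b (posL k), b (posR k)) else 0

/-- `w` is a minimal decomposition of `π` into adjacent transpositions. -/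
def IsMinimalWord {n : ℕ} (π : Equiv.Perm (Fin n)) (w : List (Fin (n - 1))) : Prop :=
  (w.map adjSwap).prod = π ∧
    ∀ w' : List (Fin (n - 1)), (w'.map adjSwap).prod = π → w.length ≤ w'.length

theorem exists_minimalWord {n : ℕ} (π : Equiv.Perm (Fin n)) : ∃ w, IsMinimalWord π w := by
  have h1 : ∃ w : List (Fin (n - 1)), (w.map adjSwap).prod = π := by
    rcases n with _ | n
    · exact ⟨[], Subsingleton.elim _ _⟩
    · have h : π ∈ Submonoid.closure
          (Set.range fun i : Fin n => Equiv.swap i.castSucc i.succ) := by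
        rw [Equiv.Perm.mclosure_swap_castSucc_succ]; trivial
      induction h using Submonoid.closure_induction with
      | mem x hx =>
        obtain ⟨i, rfl⟩ := hx
        refine ⟨[i], ?_⟩
        simp only [List.map_cons, List.map_nil, List.prod_cons, List.prod_nil, mul_one]
        rfl
      | one => exact ⟨[], rfl⟩
      | mul x y _ _ hx hy =>
        obtain ⟨u, hu⟩ := hx
        obtain ⟨v, hv⟩ := hy
        exact ⟨u ++ v, by rw [List.map_append, List.prod_append, hu, hv]⟩
  classical
  have h2 : ∃ m, ∃ w : List (Fin (n - 1)), (w.map adjSwap).prod = π ∧ w.length = m := by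
    obtain ⟨w, hw⟩ := h1
    exact ⟨_, w, hw, rfl⟩
  obtain ⟨w, hw, hl⟩ := Nat.find_spec h2
  exact ⟨w, hw, fun w' hw' => hl ▸ Nat.find_min' h2 ⟨w', hw', rfl⟩⟩

/-- `R_π = R_{i₁} ⋯ R_{i_s}` for a chosen minimal decomposition `π = t_{i₁} ⋯ t_{i_s}`. If `R`
satisfies the braid equation, this does not depend on the choice. -/
def braidPerm (R : Matrix (I × I) (I × I) ℂ) {n : ℕ} (π : Equiv.Perm (Fin n)) :
    Matrix (Fin n → I) (Fin n → I) ℂ :=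
  ((exists_minimalWord π).choose.map (braidAt R)).prod

/-- `S_n = (1 / n!) ∑_π R_π`. -/
def symmetrizer (R : Matrix (I × I) (I × I) ℂ) (n : ℕ) : Matrix (Fin n → I) (Fin n → I) ℂ :=
  (n.factorial : ℂ)⁻¹ • ∑ π : Equiv.Perm (Fin n), braidPerm R π

/-- A basis of the `n`-th tensor power of `ℂ^I` which is the disjoint union of a basis of the
image of `S` and of a basis of the image of `1 - S`. -/
def IsAdapted {n : ℕ} {S : Matrix (Fin n → I) (Fin n → I) ℂ}
    (e : Module.Basis (Fin S.rank ⊕ Fin (1 - S).rank) ℂ ((Fin n → I) → ℂ)) : Prop :=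
  Submodule.span ℂ (Set.range (e ∘ Sum.inl)) = LinearMap.range S.mulVecLin ∧
  Submodule.span ℂ (Set.range (e ∘ Sum.inr)) = LinearMap.range (1 - S).mulVecLin

/-- The value `α(x ⊗ ⋯ ⊗ x) = ∑ α_{i₁ ⋯ i_n} x_{i₁} ⋯ x_{i_n}` of a functional `α` on the `n`-th
tensor power of `ℂ^I`, for a family `x` of elements of an algebra. -/
def evalTensor {C : Type*} [Ring C] [Algebra ℂ C] (x : I → C) {n : ℕ}
    (α : Module.Dual ℂ ((Fin n → I) → ℂ)) : C :=
  ∑ a : Fin n → I, α (Pi.single a 1) • (List.ofFn fun k => x (a k)).prod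

end Symmetrizer

/-- The coefficients of the commutation relations: the matrix `Λ`, the functionals `f_{ij}` and
`η_i` on `A` and the complex column `T`. -/
structure Coefficients (A I : Type*) [Ring A] [Bialgebra ℂ A] where
  Λ : Matrix I I A
  f : I → I → Module.Dual ℂ A
  η : I → Module.Dual ℂ A
  T : Matrix (I × I) Unit ℂ

namespace Coefficients

variable {A I : Type*} [Ring A] [Bialgebra ℂ A] [Fintype I] [DecidableEq I]
  (D : Coefficients A I)

/-- `R_{ij,sm} = f_{im}(Λ_{js})`. -/
def R : Matrix (I × I) (I × I) ℂ := Matrix.of fun a b => D.f a.1 b.2 (D.Λ a.2 b.1)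

/-- `Z_{ij,m} = η_i(Λ_{jm})`. -/
def Z : Matrix (I × I) I ℂ := Matrix.of fun a m => D.η a.1 (D.Λ a.2 m)

/-- `τ_{ij} = η_j * η_i - η_i(Λ_{js}) η_s + T_{ij} ε - (f_{jn} * f_{im}) T_{mn}`. -/
def τ (i j : I) : Module.Dual ℂ A :=
  convol (D.η j) (D.η i) - ∑ s, D.η i (D.Λ j s) • D.η s + D.T (i, j) () • Coalgebra.counit
    - ∑ m, ∑ n, D.T (m, n) () • convol (D.f j n) (D.f i m)

/-- `τ^{kl} = (R - 1)_{kl,ij} τ_{ij}`. -/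
def τ' (k l : I) : Module.Dual ℂ A := ∑ i, ∑ j, (D.R - 1) (k, l) (i, j) • D.τ i j

/-- `F_{ijk,m} = τ_{ij}(Λ_{km})`. -/
def F : Matrix (I × I × I) I ℂ := Matrix.of fun a m => D.τ a.1 a.2.1 (D.Λ a.2.2 m)

/-- The defining relations of the algebra `B`, imposed on the free algebra on the set `A ⊔ I`. -/
inductive RelB : FreeAlgebra ℂ (A ⊕ I) → FreeAlgebra ℂ (A ⊕ I) → Prop
  | one : RelB (FreeAlgebra.ι ℂ (Sum.inl 1)) 1
  | add (a b : A) : RelB (FreeAlgebra.ι ℂ (Sum.inl (a + b)))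
      (FreeAlgebra.ι ℂ (Sum.inl a) + FreeAlgebra.ι ℂ (Sum.inl b))
  | mul (a b : A) : RelB (FreeAlgebra.ι ℂ (Sum.inl (a * b)))
      (FreeAlgebra.ι ℂ (Sum.inl a) * FreeAlgebra.ι ℂ (Sum.inl b))
  | smul (c : ℂ) (a : A) : RelB (FreeAlgebra.ι ℂ (Sum.inl (c • a)))
      (c • FreeAlgebra.ι ℂ (Sum.inl a))
  /-- `p_s a = (a * f_{st}) p_t + a * η_s - Λ_{st} (η_t * a)` -/
  | comm (s : I) (a : A) :
      RelB (FreeAlgebra.ι ℂ (Sum.inr s) * FreeAlgebra.ι ℂ (Sum.inl a))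
        ((∑ t, FreeAlgebra.ι ℂ (Sum.inl (actL (D.f s t) a)) * FreeAlgebra.ι ℂ (Sum.inr t))
          + FreeAlgebra.ι ℂ (Sum.inl (actL (D.η s) a - ∑ t, D.Λ s t * actR (D.η t) a)))
  /-- `(R - 1)_{kl,ij} (p_i p_j - η_i(Λ_{js}) p_s + T_{ij} - Λ_{im} Λ_{jn} T_{mn}) = 0` -/
  | quad (k l : I) :
      RelB (∑ i, ∑ j, (D.R - 1) (k, l) (i, j) •
        (FreeAlgebra.ι ℂ (Sum.inr i) * FreeAlgebra.ι ℂ (Sum.inr j)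
          - ∑ s, D.η i (D.Λ j s) • FreeAlgebra.ι ℂ (Sum.inr s)
          + FreeAlgebra.ι ℂ (Sum.inl (D.T (i, j) () • (1 : A)
            - ∑ m, ∑ n, D.T (m, n) () • (D.Λ i m * D.Λ j n))))) 0

/-- The universal unital algebra generated by the algebra `A` and elements `p_i`, subject to the
two families of relations above. -/
def B : Type _ := RingQuot D.RelB

instance : Ring D.B := inferInstanceAs (Ring (RingQuot D.RelB))
instance : Algebra ℂ D.B := inferInstanceAs (Algebra ℂ (RingQuot D.RelB))

/-- The quotient map onto `B`. -/
def mkB : FreeAlgebra ℂ (A ⊕ I) →ₐ[ℂ] D.B := RingQuot.mkAlgHom ℂ D.RelB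

theorem mkB_rel {x y : FreeAlgebra ℂ (A ⊕ I)} (h : D.RelB x y) : D.mkB x = D.mkB y :=
  RingQuot.mkAlgHom_rel ℂ h

/-- The generators `p_i` of `B`. -/
def p (i : I) : D.B := D.mkB (FreeAlgebra.ι ℂ (Sum.inr i))

/-- The canonical homomorphism `A → B`. -/
def ι : A →ₐ[ℂ] D.B :=
  AlgHom.ofLinearMap
    { toFun := fun a => D.mkB (FreeAlgebra.ι ℂ (Sum.inl a))
      map_add' := fun a b => by rw [D.mkB_rel (RelB.add a b), map_add]
      map_smul' := fun c a => by rw [D.mkB_rel (RelB.smul c a), map_smul]; rfl }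
    (by
      change D.mkB _ = 1
      rw [D.mkB_rel RelB.one, map_one])
    (fun a b => by
      change D.mkB _ = D.mkB _ * D.mkB _
      rw [D.mkB_rel (RelB.mul a b), map_mul])

/-- The defining relations of the algebra `C`:
`(R - 1)_{ij,kl} (x_k x_l - η_k(Λ_{lm}) x_m + T_{kl}) = 0`. -/
inductive RelC : FreeAlgebra ℂ I → FreeAlgebra ℂ I → Prop
  | quad (i j : I) :
      RelC (∑ k, ∑ l, (D.R - 1) (i, j) (k, l) •
        (FreeAlgebra.ι ℂ k * FreeAlgebra.ι ℂ l
          - ∑ m, D.η k (D.Λ l m) • FreeAlgebra.ι ℂ m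
          + D.T (k, l) () • (1 : FreeAlgebra ℂ I))) 0

/-- The universal unital algebra generated by elements `x_i` subject to the relations above. -/
def C : Type _ := RingQuot D.RelC

instance : Ring D.C := inferInstanceAs (Ring (RingQuot D.RelC))
instance : Algebra ℂ D.C := inferInstanceAs (Algebra ℂ (RingQuot D.RelC))

/-- The generators `x_i` of `C`. -/
def x (i : I) : D.C := RingQuot.mkAlgHom ℂ D.RelC (FreeAlgebra.ι ℂ i)

/-- `C^N`, the span of the monomials in the `x_i` of degree at most `N`. -/
def filtC (N : ℕ) : Submodule ℂ D.C :=
  Submodule.span ℂ {y | ∃ n ≤ N, ∃ a : Fin n → I, y = (List.ofFn fun k => D.x (a k)).prod}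

end Coefficients

namespace Coefficients

variable {A I : Type*} [Ring A] [Bialgebra ℂ A] [Fintype I] [DecidableEq I]
  (D : Coefficients A I)

theorem ι_apply (a : A) : D.ι a = D.mkB (FreeAlgebra.ι ℂ (Sum.inl a)) := rfl

theorem mkB_inr (i : I) : D.mkB (FreeAlgebra.ι ℂ (Sum.inr i)) = D.p i := rfl

theorem p_mul_ι (s : I) (a : A) :
    D.p s * D.ι a = ∑ t, D.ι (actL (D.f s t) a) * D.p t
      + D.ι (actL (D.η s) a - ∑ t, D.Λ s t * actR (D.η t) a) := by
  have h := D.mkB_rel (RelB.comm s a)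
  simpa only [map_mul, map_add, map_sum, ← ι_apply, mkB_inr] using h

theorem quad_eq (k l : I) :
    ∑ i, ∑ j, (D.R - 1) (k, l) (i, j) • (D.p i * D.p j - ∑ s, D.Z (i, j) s • D.p s
      + D.ι (D.T (i, j) () • (1 : A) - ∑ m, ∑ n, D.T (m, n) () • (D.Λ i m * D.Λ j n))) = 0 := by
  have h := D.mkB_rel (RelB.quad k l)
  simpa only [map_mul, map_add, map_sub, map_sum, map_smul, map_zero, ← ι_apply, mkB_inr, Z,
    Matrix.of_apply] using h

/-- The universal property of `B`. -/
def liftB {E : Type*} [Ring E] [Algebra ℂ E] (g : A →ₐ[ℂ] E) (q : I → E)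
    (hcomm : ∀ s a, q s * g a = ∑ t, g (actL (D.f s t) a) * q t
      + g (actL (D.η s) a - ∑ t, D.Λ s t * actR (D.η t) a))
    (hquad : ∀ k l, ∑ i, ∑ j, (D.R - 1) (k, l) (i, j) •
      (q i * q j - ∑ s, D.Z (i, j) s • q s
      + g (D.T (i, j) () • (1 : A) - ∑ m, ∑ n, D.T (m, n) () • (D.Λ i m * D.Λ j n))) = 0) :
    D.B →ₐ[ℂ] E :=
  RingQuot.liftAlgHom ℂ ⟨FreeAlgebra.lift ℂ (Sum.elim g q), by
    intro u v h
    induction h with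
    | one => simp
    | add a b => simp
    | mul a b => simp
    | smul c a => simp
    | comm s a => simpa using hcomm s a
    | quad k l => simpa [Z] using hquad k l⟩

section
variable {E : Type*} [Ring E] [Algebra ℂ E] (g : A →ₐ[ℂ] E) (q : I → E)
    (hcomm : ∀ s a, q s * g a = ∑ t, g (actL (D.f s t) a) * q t
      + g (actL (D.η s) a - ∑ t, D.Λ s t * actR (D.η t) a))
    (hquad : ∀ k l, ∑ i, ∑ j, (D.R - 1) (k, l) (i, j) •
      (q i * q j - ∑ s, D.Z (i, j) s • q s
      + g (D.T (i, j) () • (1 : A) - ∑ m, ∑ n, D.T (m, n) () • (D.Λ i m * D.Λ j n))) = 0)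

theorem liftB_ι (a : A) : D.liftB g q hcomm hquad (D.ι a) = g a := by
  rw [ι_apply, liftB, mkB]
  erw [RingQuot.liftAlgHom_mkAlgHom_apply]
  simp

theorem liftB_p (i : I) : D.liftB g q hcomm hquad (D.p i) = q i := by
  rw [p, liftB, mkB]
  erw [RingQuot.liftAlgHom_mkAlgHom_apply]
  simp

end

theorem hom_ext {E : Type*} [Ring E] [Algebra ℂ E] {φ ψ : D.B →ₐ[ℂ] E}
    (h₁ : ∀ a, φ (D.ι a) = ψ (D.ι a)) (h₂ : ∀ i, φ (D.p i) = ψ (D.p i)) : φ = ψ := by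
  refine RingQuot.ringQuot_ext' ℂ (s := D.RelB) φ ψ (FreeAlgebra.hom_ext (funext fun z => ?_))
  rcases z with a | i
  · exact h₁ a
  · exact h₂ i

end Coefficients

/-- The parameters of an inhomogeneous quantum group: `Λ` is a representation, the functionals
`f`, `η` make `a ↦ [[f(a), η(a)], [0, ε(a)]]` a unital homomorphism and satisfy
`Λ_{st} (f_{tr} * a) = (a * f_{st}) Λ_{tr}`, and the matrices `R`, `Z`, `T`, `F` satisfy the
consistency conditions listed below. -/
structure InhomogeneousDatum (A I : Type*) [Ring A] [Bialgebra ℂ A] [Fintype I] [DecidableEq I]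
    extends Coefficients A I where
  comul_Λ : ∀ i j, Coalgebra.comul (R := ℂ) (Λ i j) = ∑ k, Λ i k ⊗ₜ[ℂ] Λ k j
  counit_Λ : ∀ i j, Coalgebra.counit (R := ℂ) (Λ i j) = if i = j then 1 else 0
  f_one : ∀ s t, f s t 1 = if s = t then 1 else 0
  f_mul : ∀ s t a b, f s t (a * b) = ∑ m, f s m a * f m t b
  η_one : ∀ s, η s 1 = 0
  η_mul : ∀ s a b, η s (a * b) = η s a * Coalgebra.counit (R := ℂ) b + ∑ t, f s t a * η t b
  Λ_mul_f : ∀ s r a, ∑ t, Λ s t * actR (f t r) a = ∑ t, actL (f s t) a * Λ t r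
  /-- `R² = 1` -/
  R_sq : toCoefficients.R * toCoefficients.R = 1
  /-- `(Λ ⊗ Λ)_{kl,ij} (τ^{ij} * b) = b * τ^{kl}` -/
  Λ_mul_τ : ∀ k l b, ∑ i, ∑ j, Λ k i * Λ l j * actR (toCoefficients.τ' i j) b
    = actL (toCoefficients.τ' k l) b
  /-- `A₃ F = 0` -/
  antisymm_F : antisymm₃ toCoefficients.R * toCoefficients.F = 0
  /-- `A₃ (Z ⊗ 1 - 1 ⊗ Z) T ∈ Mor(I, Λ ⊗ Λ ⊗ Λ)` -/
  antisymm_ZT : antisymm₃ toCoefficients.R *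
    (tensorOne toCoefficients.Z - oneTensor toCoefficients.Z) * T
      ∈ Mor (1 : Matrix Unit Unit A) (Λ ⊗ₖ (Λ ⊗ₖ Λ))

section CoalgebraLemmas

variable {A : Type*} [Ring A] [Bialgebra ℂ A]

theorem comul_actL (ρ : Module.Dual ℂ A) (a : A) :
    Coalgebra.comul (R := ℂ) (actL ρ a) = (actL ρ).rTensor A (Coalgebra.comul a) := by
  have h1 : ∀ t : A ⊗[ℂ] A, Coalgebra.comul (R := ℂ) (TensorProduct.lid ℂ A (ρ.rTensor A t)) =
      TensorProduct.lid ℂ _ (ρ.rTensor (A ⊗[ℂ] A) (Coalgebra.comul.lTensor A t)) := by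
    intro t
    induction t using TensorProduct.induction_on with
    | zero => simp
    | tmul x y => simp
    | add x y hx hy => simp only [map_add, hx, hy]
  have h2 : ∀ t : A ⊗[ℂ] (A ⊗[ℂ] A), TensorProduct.lid ℂ _ (ρ.rTensor (A ⊗[ℂ] A) t) =
      ((TensorProduct.lid ℂ A).toLinearMap ∘ₗ ρ.rTensor A).rTensor A
        ((TensorProduct.assoc ℂ A A A).symm t) := by
    intro t
    induction t using TensorProduct.induction_on with
    | zero => simp
    | tmul x y =>
      induction y using TensorProduct.induction_on with
      | zero => simp
      | tmul y z => simp [TensorProduct.smul_tmul']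
      | add x y hx hy => simp only [map_add, TensorProduct.tmul_add, hx, hy]
    | add x y hx hy => simp only [map_add, hx, hy]
  have h3 := Coalgebra.coassoc_symm_apply (R := ℂ) a
  change Coalgebra.comul (R := ℂ) (TensorProduct.lid ℂ A (ρ.rTensor A _)) = _
  rw [h1, h2, h3, ← LinearMap.comp_apply, ← LinearMap.rTensor_comp]
  rfl

theorem comul_actR (ρ : Module.Dual ℂ A) (a : A) :
    Coalgebra.comul (R := ℂ) (actR ρ a) = (actR ρ).lTensor A (Coalgebra.comul a) := by
  have h1 : ∀ t : A ⊗[ℂ] A, Coalgebra.comul (R := ℂ) (TensorProduct.rid ℂ A (ρ.lTensor A t)) =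
      TensorProduct.rid ℂ _ (ρ.lTensor (A ⊗[ℂ] A) (Coalgebra.comul.rTensor A t)) := by
    intro t
    induction t using TensorProduct.induction_on with
    | zero => simp
    | tmul x y => simp
    | add x y hx hy => simp only [map_add, hx, hy]
  have h2 : ∀ t : (A ⊗[ℂ] A) ⊗[ℂ] A, TensorProduct.rid ℂ _ (ρ.lTensor (A ⊗[ℂ] A) t) =
      ((TensorProduct.rid ℂ A).toLinearMap ∘ₗ ρ.lTensor A).lTensor A
        (TensorProduct.assoc ℂ A A A t) := by
    intro t
    induction t using TensorProduct.induction_on with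
    | zero => simp
    | tmul x y =>
      induction x using TensorProduct.induction_on with
      | zero => simp
      | tmul y z => simp
      | add x y hx hy => simp only [map_add, TensorProduct.add_tmul, hx, hy]
    | add x y hx hy => simp only [map_add, hx, hy]
  have h3 := Coalgebra.coassoc_apply (R := ℂ) a
  change Coalgebra.comul (R := ℂ) (TensorProduct.rid ℂ A (ρ.lTensor A _)) = _
  rw [h1, h2, h3, ← LinearMap.comp_apply, ← LinearMap.lTensor_comp]
  rfl

theorem lTensor_actL_comul (ρ : Module.Dual ℂ A) (a : A) :
    (actL ρ).lTensor A (Coalgebra.comul a) = (actR ρ).rTensor A (Coalgebra.comul a) := by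
  have h : ∀ t : A ⊗[ℂ] (A ⊗[ℂ] A),
      ((TensorProduct.lid ℂ A).toLinearMap ∘ₗ ρ.rTensor A).lTensor A t =
      ((TensorProduct.rid ℂ A).toLinearMap ∘ₗ ρ.lTensor A).rTensor A
        ((TensorProduct.assoc ℂ A A A).symm t) := by
    intro t
    induction t using TensorProduct.induction_on with
    | zero => simp
    | tmul x y =>
      induction y using TensorProduct.induction_on with
      | zero => simp
      | tmul y z => simp [TensorProduct.smul_tmul]
      | add x y hx hy => simp only [map_add, TensorProduct.tmul_add, hx, hy]
    | add x y hx hy => simp only [map_add, hx, hy]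
  have h3 := Coalgebra.coassoc_symm_apply (R := ℂ) a
  have h4 := h (Coalgebra.comul.lTensor A (Coalgebra.comul a))
  rw [h3, ← LinearMap.comp_apply, ← LinearMap.lTensor_comp] at h4
  refine h4.trans ?_
  rw [← LinearMap.comp_apply, ← LinearMap.rTensor_comp]
  rfl

theorem counit_actL (ρ : Module.Dual ℂ A) (a : A) :
    Coalgebra.counit (R := ℂ) (actL ρ a) = ρ a := by
  have h1 : ∀ t : A ⊗[ℂ] A, Coalgebra.counit (R := ℂ) (TensorProduct.lid ℂ A (ρ.rTensor A t)) =
      ρ (TensorProduct.rid ℂ A (Coalgebra.counit.lTensor A t)) := by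
    intro t
    induction t using TensorProduct.induction_on with
    | zero => simp
    | tmul x y => simp [mul_comm]
    | add x y hx hy => simp only [map_add, hx, hy]
  change Coalgebra.counit (R := ℂ) (TensorProduct.lid ℂ A (ρ.rTensor A _)) = _
  rw [h1]
  simp

theorem counit_actR (ρ : Module.Dual ℂ A) (a : A) :
    Coalgebra.counit (R := ℂ) (actR ρ a) = ρ a := by
  have h1 : ∀ t : A ⊗[ℂ] A, Coalgebra.counit (R := ℂ) (TensorProduct.rid ℂ A (ρ.lTensor A t)) =
      ρ (TensorProduct.lid ℂ A (Coalgebra.counit.rTensor A t)) := by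
    intro t
    induction t using TensorProduct.induction_on with
    | zero => simp
    | tmul x y => simp [mul_comm]
    | add x y hx hy => simp only [map_add, hx, hy]
  change Coalgebra.counit (R := ℂ) (TensorProduct.rid ℂ A (ρ.lTensor A _)) = _
  rw [h1]
  simp

end CoalgebraLemmas

namespace InhomogeneousDatum

variable {A I : Type*} [Ring A] [Bialgebra ℂ A] [Fintype I] [DecidableEq I]
  (D : InhomogeneousDatum A I)

/-- `Λ_{sj} ⊗ p_j + p_s ⊗ I` -/
def comulP (s : I) : D.B ⊗[ℂ] D.B := ∑ j, D.ι (D.Λ s j) ⊗ₜ[ℂ] D.p j + D.p s ⊗ₜ[ℂ] 1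

/-- The comultiplication of `A`, with values in `B ⊗ B`. -/
def comulA : A →ₐ[ℂ] D.B ⊗[ℂ] D.B :=
  (Algebra.TensorProduct.map D.ι D.ι).comp (Bialgebra.comulAlgHom ℂ A)

theorem aux₁ (s : I) (t : A ⊗[ℂ] A) :
    (∑ u, D.ι (D.Λ s u) ⊗ₜ[ℂ] D.p u) * Algebra.TensorProduct.map D.ι D.ι t =
      ∑ r, Algebra.TensorProduct.map D.ι D.ι
          (∑ u, (D.Λ s u ⊗ₜ[ℂ] 1) * (actL (D.f u r)).lTensor A t) * (1 ⊗ₜ[ℂ] D.p r)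
      + Algebra.TensorProduct.map D.ι D.ι
          (∑ u, (D.Λ s u ⊗ₜ[ℂ] 1) * (actL (D.η u)).lTensor A t
            - ∑ v, (∑ u, D.Λ s u ⊗ₜ[ℂ] D.Λ u v) * (actR (D.η v)).lTensor A t) := by
  induction t using TensorProduct.induction_on with
  | zero => simp
  | add x y hx hy =>
    simp only [map_add, mul_add, add_mul, hx, hy, Finset.sum_add_distrib, map_sub]
    abel
  | tmul x y =>
    simp only [Algebra.TensorProduct.map_tmul, LinearMap.lTensor_tmul, Finset.sum_mul,
      Algebra.TensorProduct.tmul_mul_tmul, map_sum, map_sub, one_mul, map_mul,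
      Coefficients.p_mul_ι, TensorProduct.tmul_add, TensorProduct.tmul_sub,
      TensorProduct.tmul_sum, mul_one, Finset.sum_add_distrib, Finset.sum_sub_distrib]
    rw [Finset.sum_comm]
    congr 2
    rw [Finset.sum_comm]

theorem aux₂ (s : I) (t : A ⊗[ℂ] A) :
    (D.p s ⊗ₜ[ℂ] 1) * Algebra.TensorProduct.map D.ι D.ι t =
      ∑ r, Algebra.TensorProduct.map D.ι D.ι ((actL (D.f s r)).rTensor A t) * (D.p r ⊗ₜ[ℂ] 1)
      + Algebra.TensorProduct.map D.ι D.ι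
          ((actL (D.η s)).rTensor A t
            - ∑ v, (D.Λ s v ⊗ₜ[ℂ] 1) * (actR (D.η v)).rTensor A t) := by
  induction t using TensorProduct.induction_on with
  | zero => simp
  | add x y hx hy =>
    simp only [map_add, mul_add, add_mul, hx, hy, Finset.sum_add_distrib, map_sub]
    abel
  | tmul x y =>
    simp only [Algebra.TensorProduct.map_tmul, LinearMap.rTensor_tmul,
      Algebra.TensorProduct.tmul_mul_tmul, map_sum, map_sub, one_mul, map_mul,
      Coefficients.p_mul_ι, TensorProduct.add_tmul, TensorProduct.sub_tmul,
      TensorProduct.sum_tmul, mul_one]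

theorem aux₃ (s r : I) (t : A ⊗[ℂ] A) :
    ∑ u, (D.Λ s u ⊗ₜ[ℂ] (1 : A)) * (actR (D.f u r)).rTensor A t =
      ∑ u, (actL (D.f s u)).rTensor A t * (D.Λ u r ⊗ₜ[ℂ] (1 : A)) := by
  induction t using TensorProduct.induction_on with
  | zero => simp
  | add x y hx hy => simp only [map_add, mul_add, add_mul, hx, hy, Finset.sum_add_distrib]
  | tmul x y =>
    simp only [LinearMap.rTensor_tmul, Algebra.TensorProduct.tmul_mul_tmul, one_mul, mul_one,
      ← TensorProduct.sum_tmul, D.Λ_mul_f]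

theorem comul_comm (s : I) (a : A) :
    D.comulP s * D.comulA a = ∑ t, D.comulA (actL (D.f s t) a) * D.comulP t
      + D.comulA (actL (D.η s) a - ∑ t, D.Λ s t * actR (D.η t) a) := by
  have e : ∀ b, D.comulA b = Algebra.TensorProduct.map D.ι D.ι (Coalgebra.comul (R := ℂ) b) :=
    fun b => rfl
  have hP : ∀ t, D.comulP t = ∑ r, Algebra.TensorProduct.map D.ι D.ι (D.Λ t r ⊗ₜ[ℂ] 1) *
      (1 ⊗ₜ[ℂ] D.p r) + D.p t ⊗ₜ[ℂ] 1 := by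
    intro t
    simp [comulP]
  have hL : D.comulP s * D.comulA a = (∑ u, D.ι (D.Λ s u) ⊗ₜ[ℂ] D.p u) * D.comulA a
      + (D.p s ⊗ₜ[ℂ] 1) * D.comulA a := by rw [comulP, add_mul]
  rw [hL, e a, aux₁, aux₂]
  simp only [lTensor_actL_comul, D.aux₃]
  simp only [e, hP, map_sub, map_sum, Bialgebra.comul_mul, comul_actL, comul_actR, D.comul_Λ]
  simp only [mul_add, Finset.sum_add_distrib, map_sum, map_mul, Finset.sum_mul, Finset.mul_sum,
    mul_assoc]
  rw [Finset.sum_comm]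
  abel

theorem actL_Λ (ρ : Module.Dual ℂ A) (i j : I) :
    actL ρ (D.Λ i j) = ∑ k, ρ (D.Λ i k) • D.Λ k j := by
  simp [actL, D.comul_Λ]

theorem actR_Λ (ρ : Module.Dual ℂ A) (i j : I) :
    actR ρ (D.Λ i j) = ∑ k, ρ (D.Λ k j) • D.Λ i k := by
  simp [actR, D.comul_Λ]

/-- `R ∈ Mor(Λ ⊗ Λ, Λ ⊗ Λ)` -/
theorem R_mem_Mor : D.R ∈ Mor (D.Λ ⊗ₖ D.Λ) (D.Λ ⊗ₖ D.Λ) := by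
  change D.R.map (algebraMap ℂ A) * (D.Λ ⊗ₖ D.Λ) = (D.Λ ⊗ₖ D.Λ) * D.R.map (algebraMap ℂ A)
  ext ⟨s, m⟩ ⟨n, r⟩
  have h := D.Λ_mul_f s r (D.Λ m n)
  simp only [actL_Λ, actR_Λ] at h
  simp only [Matrix.mul_apply, Fintype.sum_prod_type, Matrix.map_apply, Matrix.kronecker_apply,
    Coefficients.R, Matrix.of_apply]
  rw [Finset.sum_comm]
  simp only [← Algebra.smul_def, ← Algebra.commutes]
  simp only [Finset.mul_sum, Finset.sum_mul, smul_mul_assoc, mul_smul_comm] at h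
  exact h.symm

theorem quad_aux {M : Type*} [Ring M] (Rm : Matrix (I × I) (I × I) M) (Zm : Matrix (I × I) I M)
    (Tm : I × I → M) (L : Matrix I I M) (LL' : Matrix (I × I) (I × I) M) (P P' : I → M)
    (hR : Rm * Rm = 1) (hL : Rm * (L ⊗ₖ L) = (L ⊗ₖ L) * Rm)
    (hLP : ∀ i j k, P' i * L j k = L j k * P' i) (hPP : ∀ i j, P' i * P j = P j * P' i)
    (hK : (Matrix.of fun a k => P a.1 * L a.2 k : Matrix (I × I) I M) =
      Rm * (Matrix.of fun a k => L a.1 k * P a.2 : Matrix (I × I) I M) + Zm * L - (L ⊗ₖ L) * Zm)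
    (h₁ : (Rm - 1).mulVec ((fun a => P a.1 * P a.2) - Zm.mulVec P + (Tm - (L ⊗ₖ L).mulVec Tm)) = 0)
    (h₂ : (Rm - 1).mulVec ((fun a => P' a.1 * P' a.2) - Zm.mulVec P' + (Tm - LL'.mulVec Tm)) = 0) :
    (Rm - 1).mulVec ((fun a => (L.mulVec P' + P) a.1 * (L.mulVec P' + P) a.2)
      - Zm.mulVec (L.mulVec P' + P) + (Tm - ((L ⊗ₖ L) * LL').mulVec Tm)) = 0 := by
  set N : Matrix (I × I) I M := Matrix.of fun a k => L a.1 k * P a.2 with hN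
  set K : Matrix (I × I) I M := Matrix.of fun a k => P a.1 * L a.2 k with hKdef
  have e : (fun a : I × I => (L.mulVec P' + P) a.1 * (L.mulVec P' + P) a.2) =
      (L ⊗ₖ L).mulVec (fun a => P' a.1 * P' a.2) + N.mulVec P' + K.mulVec P'
        + fun a => P a.1 * P a.2 := by
    ext ⟨i, j⟩
    simp only [Pi.add_apply, Matrix.mulVec, dotProduct, hN, hKdef, Matrix.of_apply,
      Fintype.sum_prod_type, Matrix.kronecker_apply, add_mul, mul_add, Finset.sum_mul,
      Finset.mul_sum]
    have e1 : ∀ x y, L i x * P' x * (L j y * P' y) = L i x * L j y * (P' x * P' y) := by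
      intro x y
      rw [mul_assoc, ← mul_assoc (P' x), hLP, mul_assoc, mul_assoc]
    have e2 : ∀ x, L i x * P' x * P j = L i x * P j * P' x := by
      intro x
      rw [mul_assoc, hPP, mul_assoc]
    simp only [e1, e2, Finset.sum_add_distrib]
    rw [Finset.sum_comm]
    simp only [mul_assoc]
    abel
  have hc : (Rm - 1) * (L ⊗ₖ L) = (L ⊗ₖ L) * (Rm - 1) := by
    rw [sub_mul, mul_sub, hL, one_mul, mul_one]
  have hcK : (Rm - 1) * K = - ((Rm - 1) * N) + (Rm - 1) * (Zm * L)
      - (L ⊗ₖ L) * ((Rm - 1) * Zm) := by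
    have h3 : (Rm - 1) * Rm = - (Rm - 1) := by rw [sub_mul, hR, one_mul, neg_sub]
    rw [hK, Matrix.mul_sub, Matrix.mul_add, ← Matrix.mul_assoc _ (L ⊗ₖ L), hc,
      ← Matrix.mul_assoc _ Rm, h3, Matrix.neg_mul, Matrix.mul_assoc (L ⊗ₖ L)]
  rw [e]
  generalize Rm - 1 = c at *
  generalize L ⊗ₖ L = G at *
  have h₃ := congrArg G.mulVec h₂
  simp only [Matrix.mulVec_add, Matrix.mulVec_sub, Matrix.mulVec_mulVec, hcK, Matrix.sub_mulVec,
    Matrix.add_mulVec, Matrix.neg_mulVec, Matrix.mulVec_zero, ← Matrix.mul_assoc, hc] at h₁ h₃ ⊢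
  have h₄ := congrArg₂ (· + ·) h₁ h₃
  simp only [add_zero] at h₄
  rw [← h₄]
  abel

/-- The quadratic relations in matrix form. -/
theorem quad_iff {E : Type*} [Ring E] [Algebra ℂ E] (g : A →ₐ[ℂ] E) (q : I → E) :
    (∀ k l, ∑ i, ∑ j, (D.R - 1) (k, l) (i, j) • (q i * q j - ∑ s, D.Z (i, j) s • q s
      + g (D.T (i, j) () • (1 : A) - ∑ m, ∑ n, D.T (m, n) () • (D.Λ i m * D.Λ j n))) = 0) ↔
    (D.R.map (algebraMap ℂ E) - 1).mulVec ((fun a => q a.1 * q a.2)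
      - (D.Z.map (algebraMap ℂ E)).mulVec q
      + ((fun a => algebraMap ℂ E (D.T a ()))
        - (Matrix.of fun a b : I × I => g (D.Λ a.1 b.1 * D.Λ a.2 b.2)).mulVec
            fun a => algebraMap ℂ E (D.T a ()))) = 0 := by
  have e : D.R.map (algebraMap ℂ E) - 1 = (D.R - 1).map (algebraMap ℂ E) := by
    rw [Matrix.map_sub _ (by simp), Matrix.map_one _ (by simp) (by simp)]
  rw [e, funext_iff, Prod.forall]
  refine forall_congr' fun k => forall_congr' fun l => ?_
  simp only [Matrix.mulVec, dotProduct, Fintype.sum_prod_type, Matrix.map_apply, Pi.add_apply,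
    Pi.sub_apply, Matrix.of_apply, map_sub, map_sum,
    map_smul, map_one, Pi.zero_apply, Algebra.algebraMap_eq_smul_one]
  simp only [smul_mul_assoc, one_mul, mul_smul_comm, mul_one]

theorem comul_quad (k l : I) :
    ∑ i, ∑ j, (D.R - 1) (k, l) (i, j) • (D.comulP i * D.comulP j
      - ∑ s, D.Z (i, j) s • D.comulP s + D.comulA (D.T (i, j) () • (1 : A)
        - ∑ m, ∑ n, D.T (m, n) () • (D.Λ i m * D.Λ j n))) = 0 := by
  revert k l
  rw [quad_iff]
  let gl : A →ₐ[ℂ] D.B ⊗[ℂ] D.B := Algebra.TensorProduct.includeLeft.comp D.ι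
  let gr : A →ₐ[ℂ] D.B ⊗[ℂ] D.B := Algebra.TensorProduct.includeRight.comp D.ι
  have h₁ := (D.quad_iff gl (fun i => D.p i ⊗ₜ[ℂ] 1)).1 fun k l => by
    have h := congrArg (Algebra.TensorProduct.includeLeft (R := ℂ) (S := ℂ) (A := D.B) (B := D.B))
      (D.quad_eq k l)
    simp only [map_sum, map_smul, map_add, map_sub, map_mul, map_zero] at h ⊢
    exact h
  have h₂ := (D.quad_iff gr (fun i => 1 ⊗ₜ[ℂ] D.p i)).1 fun k l => by
    have h := congrArg (Algebra.TensorProduct.includeRight (R := ℂ) (A := D.B) (B := D.B))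
      (D.quad_eq k l)
    simp only [map_sum, map_smul, map_add, map_sub, map_mul, map_zero] at h ⊢
    exact h
  set L : Matrix I I (D.B ⊗[ℂ] D.B) := Matrix.of fun i j => D.ι (D.Λ i j) ⊗ₜ[ℂ] 1 with hLdef
  have hLL : (Matrix.of fun a b : I × I => gl (D.Λ a.1 b.1 * D.Λ a.2 b.2)) = L ⊗ₖ L := by
    ext a b
    simp [gl, L]
  have hP : D.comulP = L.mulVec (fun i => 1 ⊗ₜ[ℂ] D.p i) + fun i => D.p i ⊗ₜ[ℂ] 1 := by
    ext i
    simp [comulP, L, Matrix.mulVec, dotProduct]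
  have hA : (Matrix.of fun a b : I × I => D.comulA (D.Λ a.1 b.1 * D.Λ a.2 b.2)) =
      (L ⊗ₖ L) * Matrix.of fun a b : I × I => gr (D.Λ a.1 b.1 * D.Λ a.2 b.2) := by
    ext a b
    simp only [Matrix.of_apply, Matrix.mul_apply, Fintype.sum_prod_type,
      comulA, AlgHom.comp_apply, Bialgebra.comulAlgHom_apply, D.comul_Λ,
      map_mul, map_sum, Finset.sum_mul_sum]
    simp [L, gr]
  rw [hLL] at h₁
  rw [hA, hP]
  refine quad_aux _ _ _ L _ (fun i => D.p i ⊗ₜ[ℂ] 1) (fun i => 1 ⊗ₜ[ℂ] D.p i) ?_ ?_ ?_ ?_ ?_ h₁ h₂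
  · rw [← Matrix.map_mul, D.R_sq, Matrix.map_one _ (map_zero _) (map_one _)]
  · have h : D.R.map (algebraMap ℂ A) * (D.Λ ⊗ₖ D.Λ) = (D.Λ ⊗ₖ D.Λ) * D.R.map (algebraMap ℂ A) :=
      D.R_mem_Mor
    have h' := congrArg (fun X => X.map gl) h
    have e1 : (D.R.map (algebraMap ℂ A)).map gl = D.R.map (algebraMap ℂ (D.B ⊗[ℂ] D.B)) := by
      ext a b
      simp only [Matrix.map_apply, AlgHom.commutes]
    have e2 : (D.Λ ⊗ₖ D.Λ).map gl = L ⊗ₖ L := by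
      rw [← hLL]
      rfl
    simp only [Matrix.map_mul, e1, e2] at h'
    exact h'
  · intro i j k
    simp [L]
  · intro i j
    simp
  · ext ⟨i, j⟩ b
    have h := congrArg (Algebra.TensorProduct.includeLeft (R := ℂ) (S := ℂ) (A := D.B) (B := D.B))
      (D.p_mul_ι i (D.Λ j b))
    simp only [actL_Λ, actR_Λ, map_mul, map_add, map_sub, map_sum, map_smul,
      Algebra.TensorProduct.includeLeft_apply, Finset.sum_mul, Finset.mul_sum] at h
    simp only [Matrix.of_apply, Matrix.sub_apply, Matrix.add_apply, Matrix.mul_apply,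
      Matrix.map_apply, Matrix.kronecker_apply, Fintype.sum_prod_type, L, Coefficients.R,
      Coefficients.Z]
    rw [h, Finset.sum_comm]
    simp only [Algebra.algebraMap_eq_smul_one, smul_mul_assoc, one_mul, mul_smul_comm, mul_one]
    abel

/-- The comultiplication of `B`, given by the one of `A` and by
`Δ p_s = Λ_{sj} ⊗ p_j + p_s ⊗ I`. -/
def comulB : D.B →ₐ[ℂ] D.B ⊗[ℂ] D.B := D.liftB D.comulA D.comulP D.comul_comm D.comul_quad

theorem comulB_ι (a : A) : D.comulB (D.ι a) =
    Algebra.TensorProduct.map D.ι D.ι (Coalgebra.comul (R := ℂ) a) :=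
  D.liftB_ι _ _ _ _ a

theorem comulB_p (s : I) : D.comulB (D.p s) = ∑ j, D.ι (D.Λ s j) ⊗ₜ[ℂ] D.p j + D.p s ⊗ₜ[ℂ] 1 :=
  D.liftB_p _ _ _ _ s

/-- The counit of `B`, given by the one of `A` and by `ε(p_s) = 0`. -/
def counitB : D.B →ₐ[ℂ] ℂ := D.liftB (Bialgebra.counitAlgHom ℂ A) 0
  (fun s a => by simp [counit_actL, counit_actR, D.counit_Λ])
  (fun k l => by
    refine Finset.sum_eq_zero fun i _ => Finset.sum_eq_zero fun j _ => ?_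
    simp [D.counit_Λ])

theorem counitB_ι (a : A) : D.counitB (D.ι a) = Coalgebra.counit (R := ℂ) a :=
  D.liftB_ι _ _ _ _ a

theorem counitB_p (s : I) : D.counitB (D.p s) = 0 :=
  D.liftB_p _ _ _ _ s

instance : Bialgebra ℂ D.B := Bialgebra.ofAlgHom D.comulB D.counitB
  (by
    refine D.hom_ext (fun a => ?_) fun i => ?_
    · have h := congrArg (Algebra.TensorProduct.map D.ι (Algebra.TensorProduct.map D.ι D.ι))
        (Coalgebra.coassoc_apply (R := ℂ) a)
      have e1 : ∀ t : A ⊗[ℂ] A, Algebra.TensorProduct.map D.comulB (AlgHom.id ℂ D.B)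
          (Algebra.TensorProduct.map D.ι D.ι t) =
          Algebra.TensorProduct.map (Algebra.TensorProduct.map D.ι D.ι) D.ι
            (Coalgebra.comul.rTensor A t) := by
        intro t
        induction t using TensorProduct.induction_on with
        | zero => simp
        | tmul x y => simp [comulB_ι]
        | add x y hx hy => simp only [map_add, hx, hy]
      have e2 : ∀ t : A ⊗[ℂ] A, Algebra.TensorProduct.map (AlgHom.id ℂ D.B) D.comulB
          (Algebra.TensorProduct.map D.ι D.ι t) =
          Algebra.TensorProduct.map D.ι (Algebra.TensorProduct.map D.ι D.ι)
            (Coalgebra.comul.lTensor A t) := by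
        intro t
        induction t using TensorProduct.induction_on with
        | zero => simp
        | tmul x y => simp [comulB_ι]
        | add x y hx hy => simp only [map_add, hx, hy]
      have e3 : ∀ t : (A ⊗[ℂ] A) ⊗[ℂ] A,
          Algebra.TensorProduct.assoc ℂ ℂ ℂ D.B D.B D.B
            (Algebra.TensorProduct.map (Algebra.TensorProduct.map D.ι D.ι) D.ι t) =
          Algebra.TensorProduct.map D.ι (Algebra.TensorProduct.map D.ι D.ι)
            (TensorProduct.assoc ℂ A A A t) := by
        intro t
        induction t using TensorProduct.induction_on with
        | zero => simp
        | tmul x y =>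
          induction x using TensorProduct.induction_on with
          | zero => simp
          | tmul y z => simp
          | add x y hx hy => simp only [map_add, TensorProduct.add_tmul, hx, hy]
        | add x y hx hy => simp only [map_add, hx, hy]
      change Algebra.TensorProduct.assoc ℂ ℂ ℂ D.B D.B D.B
        (Algebra.TensorProduct.map D.comulB (AlgHom.id ℂ D.B) (D.comulB (D.ι a))) =
        Algebra.TensorProduct.map (AlgHom.id ℂ D.B) D.comulB (D.comulB (D.ι a))
      rw [comulB_ι, e1, e2, e3, h]
    · change Algebra.TensorProduct.assoc ℂ ℂ ℂ D.B D.B D.B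
        (Algebra.TensorProduct.map D.comulB (AlgHom.id ℂ D.B) (D.comulB (D.p i))) =
        Algebra.TensorProduct.map (AlgHom.id ℂ D.B) D.comulB (D.comulB (D.p i))
      simp only [comulB_p, map_add, map_sum, Algebra.TensorProduct.map_tmul, comulB_ι, D.comul_Λ,
        AlgHom.id_apply, TensorProduct.tmul_add, TensorProduct.add_tmul, TensorProduct.sum_tmul,
        TensorProduct.tmul_sum, Finset.sum_add_distrib, map_one,
        Algebra.TensorProduct.assoc_tmul, Algebra.TensorProduct.one_def]
      rw [Finset.sum_comm]
      abel)
  (by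
    refine D.hom_ext (fun a => ?_) fun i => ?_
    · have e1 : ∀ t : A ⊗[ℂ] A, Algebra.TensorProduct.map D.counitB (AlgHom.id ℂ D.B)
          (Algebra.TensorProduct.map D.ι D.ι t) =
          (D.ι.toLinearMap.lTensor ℂ) (Coalgebra.counit.rTensor A t) := by
        intro t
        induction t using TensorProduct.induction_on with
        | zero => simp
        | tmul x y => simp [counitB_ι]
        | add x y hx hy => simp only [map_add, hx, hy]
      change Algebra.TensorProduct.map D.counitB (AlgHom.id ℂ D.B) (D.comulB (D.ι a)) =
        1 ⊗ₜ[ℂ] D.ι a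
      rw [comulB_ι, e1]
      simp
    · change Algebra.TensorProduct.map D.counitB (AlgHom.id ℂ D.B) (D.comulB (D.p i)) =
        1 ⊗ₜ[ℂ] D.p i
      simp [comulB_p, counitB_ι, counitB_p, D.counit_Λ, TensorProduct.ite_tmul])
  (by
    refine D.hom_ext (fun a => ?_) fun i => ?_
    · have e1 : ∀ t : A ⊗[ℂ] A, Algebra.TensorProduct.map (AlgHom.id ℂ D.B) D.counitB
          (Algebra.TensorProduct.map D.ι D.ι t) =
          (D.ι.toLinearMap.rTensor ℂ) (Coalgebra.counit.lTensor A t) := by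
        intro t
        induction t using TensorProduct.induction_on with
        | zero => simp
        | tmul x y => simp [counitB_ι]
        | add x y hx hy => simp only [map_add, hx, hy]
      change Algebra.TensorProduct.map (AlgHom.id ℂ D.B) D.counitB (D.comulB (D.ι a)) =
        D.ι a ⊗ₜ[ℂ] 1
      rw [comulB_ι, e1]
      simp
    · change Algebra.TensorProduct.map (AlgHom.id ℂ D.B) D.counitB (D.comulB (D.p i)) =
        D.p i ⊗ₜ[ℂ] 1
      simp [comulB_p, counitB_p])

end InhomogeneousDatum

end QuantumGroup

end

/-! The hypotheses say that the overlaps in the relations of C resolve. Applying `f` and `η` to R(Λ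
⊗ Λ) = (Λ ⊗ Λ)R gives the braid equation and a relation between R and Z; A₃F = 0 gives one between Z
and T; and the vanishing of Mor(I, Λ ⊗ Λ ⊗ Λ) turns the last condition into A₃(Z ⊗ 1 - 1 ⊗ Z)T = 0
(`isConsistent`).

Basis. As R² = 1 and R satisfies the braid equation, the R_k represent the symmetric group and S_n
is the projection onto the invariants. Modulo lower degree R_k does not change a monomial, so
symmetric tensors span. Independence is proved dually: a functional on C is a function on words that
satisfies the relations (`exists_dual`). The relation at position k, in degree N + 1, says that the
function is fixed by the affine map ψ ↦ R_k ψ - b_k, with b_k made of its values in lower degree.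
Consistency says that these affine maps satisfy the Coxeter relations (`SolvesUpTo.isCoxeterA`), so
a finite group acts, and the average of an orbit is a fixed point (`SolvesUpTo.exists_succ`).
Averaging does not change the pairing with symmetric tensors; hence the values of a functional on
symmetric tensors can be prescribed by any function on words (`exists_dual_evalRow`).

Coaction. The relations of C are those of B with the constant T in place of T - (Λ ⊗ Λ)T, and the
computation behind Δ on B gives Ψ as well.

Minimality. Let χ_s be a functional on B with χ_s(ab) = ε(a)χ_s(b) for a in A, zero at 1 and dual to
the p_i. Then (χ_s ⊗ id)Ψ is a kind of partial derivative: modulo lower degree it sends a symmetric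
tensor of degree n + 1 to n + 1 times its contraction in the last index (`pair_derive_sub_mem`). It
kills W when Ψ(W) ⊂ A ⊗ W, which forces W into degree 0. That χ_s exists means that B has not
collapsed (`exists_dual_B`). This is seen from a representation of B in End A ⊗ C ⊗ C^op, in which
p_s is the difference of a left part and Λ_{st} times a right part; each part satisfies the
quadratic relations up to a term in τ, and the condition on τ cancels the two errors. -/

noncomputable section

namespace QuantumGroup

/-! ### Coxeter presentation of the symmetric group. -/

section Presentation

/-- `g_j g_{j+1} ⋯ g_m`. -/
def segProd {M : Type*} [Monoid M] (g : ℕ → M) (j m : ℕ) : M :=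
  ((List.range' j (m + 1 - j)).map g).prod

theorem segProd_of_lt {M : Type*} [Monoid M] (g : ℕ → M) {j m : ℕ} (h : m < j) :
    segProd g j m = 1 := by
  have : m + 1 - j = 0 := by omega
  simp [segProd, this]

theorem segProd_step {M : Type*} [Monoid M] (g : ℕ → M) {j m : ℕ} (h : j ≤ m) :
    segProd g j m = g j * segProd g (j + 1) m := by
  have : m + 1 - j = (m + 1 - (j + 1)) + 1 := by omega
  rw [segProd, this, List.range'_succ, List.map_cons, List.prod_cons, segProd]

/-- The Coxeter relations of type `A` for `g_0, …, g_{m-1}`. -/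
structure IsCoxeterA {M : Type*} [Monoid M] (g : ℕ → M) (m : ℕ) : Prop where
  sq : ∀ k < m, g k * g k = 1
  comm : ∀ k l, k + 2 ≤ l → l < m → g k * g l = g l * g k
  braid : ∀ k, k + 1 < m → g k * g (k + 1) * g k = g (k + 1) * g k * g (k + 1)

theorem IsCoxeterA.mono {M : Type*} [Monoid M] {g : ℕ → M} {m m' : ℕ} (hg : IsCoxeterA g m)
    (h : m' ≤ m) : IsCoxeterA g m' :=
  ⟨fun k hk => hg.sq k (by omega), fun k l hkl hl => hg.comm k l hkl (by omega),
    fun k hk => hg.braid k (by omega)⟩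

theorem IsCoxeterA.mul_segProd_of_lt {M : Type*} [Monoid M] {g : ℕ → M} {m : ℕ}
    (hg : IsCoxeterA g (m + 1)) {k : ℕ} (d : ℕ) :
    ∀ j, k + 1 < j → m + 1 - j = d → g k * segProd g j m = segProd g j m * g k := by
  induction d with
  | zero =>
    intro j hj hd
    rw [segProd_of_lt g (by omega), mul_one, one_mul]
  | succ d ih =>
    intro j hj hd
    rw [segProd_step g (by omega), ← mul_assoc, hg.comm k j (by omega) (by omega), mul_assoc,
      ih (j + 1) (by omega) (by omega), mul_assoc]

/-- The factor g_{k+1} commutes with g_j, …, g_{k-1}; at g_k g_{k+1} the braid relation turns it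
into a g_k on the right, which commutes with everything that follows. -/
theorem IsCoxeterA.mul_segProd_of_gt {M : Type*} [Monoid M] {g : ℕ → M} {m : ℕ}
    (hg : IsCoxeterA g (m + 1)) {k : ℕ} (hk : k + 1 ≤ m) (d : ℕ) :
    ∀ j, j ≤ k → k - j = d → g (k + 1) * segProd g j m = segProd g j m * g k := by
  induction d with
  | zero =>
    intro j hj hd
    obtain rfl : j = k := by omega
    rw [segProd_step g (by omega), segProd_step g (by omega), ← mul_assoc, ← mul_assoc,
      ← hg.braid j (by omega), mul_assoc, mul_assoc, hg.mul_segProd_of_lt _ (j + 2) (by omega) rfl]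
    simp only [mul_assoc]
  | succ d ih =>
    intro j hj hd
    rw [segProd_step g (by omega), ← mul_assoc, ← hg.comm j (k + 1) (by omega) (by omega),
      mul_assoc, ih (j + 1) (by omega) (by omega), mul_assoc]

/-- The products g_j ⋯ g_m with j ≤ m + 1 represent the left cosets of the submonoid without g_m:
left multiplication by a generator either moves j by one or passes through the segment into y. -/
theorem IsCoxeterA.normalForm {M : Type*} [Monoid M] {g : ℕ → M} {m : ℕ}
    (hg : IsCoxeterA g (m + 1)) {x : M}
    (hx : x ∈ Submonoid.closure (g '' {k | k < m + 1})) :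
    ∃ j ≤ m + 1, ∃ y ∈ Submonoid.closure (g '' {k | k < m}), x = segProd g j m * y := by
  induction hx using Submonoid.closure_induction_left with
  | one => exact ⟨m + 1, le_rfl, 1, one_mem _, by rw [segProd_of_lt g (by omega), one_mul]⟩
  | mul_left s hs x _ ih =>
    obtain ⟨k, hk, rfl⟩ := hs
    obtain ⟨j, hj, y, hy, rfl⟩ := ih
    have hk : k < m + 1 := hk
    have hmem : ∀ l < m, g l * y ∈ Submonoid.closure (g '' {k | k < m}) := fun l hl =>
      mul_mem (Submonoid.subset_closure ⟨l, hl, rfl⟩) hy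
    rcases lt_trichotomy (k + 1) j with h | h | h
    · exact ⟨j, hj, g k * y, hmem k (by omega), by
        rw [← mul_assoc, hg.mul_segProd_of_lt _ j h rfl, mul_assoc]⟩
    · subst h
      exact ⟨k, by omega, y, hy, by rw [← mul_assoc, ← segProd_step g (by omega)]⟩
    · rcases Nat.lt_or_ge j k with h' | h'
      · obtain ⟨l, rfl⟩ : ∃ l, k = l + 1 := ⟨k - 1, by omega⟩
        exact ⟨j, hj, g l * y, hmem l (by omega), by
          rw [← mul_assoc, hg.mul_segProd_of_gt (by omega) _ j (by omega) rfl, mul_assoc]⟩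
      · obtain rfl : k = j := by omega
        exact ⟨k + 1, by omega, y, hy, by
          rw [segProd_step g (by omega), ← mul_assoc, ← mul_assoc, hg.sq k (by omega), one_mul]⟩

/-- The adjacent transposition of `k` and `k + 1` as a permutation of `n` letters, for `k` in
`ℕ`; it is trivial when it does not make sense. -/
def natSwap (n k : ℕ) : Equiv.Perm (Fin n) :=
  if h : k + 1 < n then Equiv.swap ⟨k, by omega⟩ ⟨k + 1, h⟩ else 1

theorem natSwap_val (n k : ℕ) (h : k + 1 < n) (a : Fin n) :
    ((natSwap n k a : Fin n) : ℕ) = if (a : ℕ) = k then k + 1 else if (a : ℕ) = k + 1 then k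
      else a := by
  simp only [natSwap, h, dif_pos, Equiv.swap_apply_def, Fin.ext_iff]
  split_ifs <;> simp

theorem isCoxeterA_natSwap (n : ℕ) : IsCoxeterA (natSwap n) (n - 1) where
  sq k hk := by
    rw [natSwap, dif_pos (by omega), Equiv.swap_mul_self]
  comm k l hkl hl := by
    ext a
    simp only [Equiv.Perm.mul_apply, natSwap_val n k (by omega), natSwap_val n l (by omega)]
    split_ifs <;> omega
  braid k hk := by
    ext a
    simp only [Equiv.Perm.mul_apply, natSwap_val n k (by omega),
      natSwap_val n (k + 1) (by omega)]
    split_ifs <;> omega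

theorem IsCoxeterA.prodMk {M N : Type*} [Monoid M] [Monoid N] {g : ℕ → M} {g' : ℕ → N} {m : ℕ}
    (hg : IsCoxeterA g m) (hg' : IsCoxeterA g' m) : IsCoxeterA (fun k => (g k, g' k)) m where
  sq k hk := Prod.ext (hg.sq k hk) (hg'.sq k hk)
  comm k l hkl hl := Prod.ext (hg.comm k l hkl hl) (hg'.comm k l hkl hl)
  braid k hk := Prod.ext (hg.braid k hk) (hg'.braid k hk)

theorem segProd_natSwap_val (n m : ℕ) (hm : m + 1 < n) (d : ℕ) :
    ∀ j ≤ m + 1, m + 1 - j = d →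
      ((segProd (natSwap n) j m ⟨m + 1, hm⟩ : Fin n) : ℕ) = j := by
  induction d with
  | zero =>
    intro j hj hd
    rw [segProd_of_lt _ (by omega)]
    simp only [Equiv.Perm.one_apply]
    omega
  | succ d ih =>
    intro j hj hd
    rw [segProd_step _ (by omega), Equiv.Perm.mul_apply, natSwap_val n j (by omega),
      ih (j + 1) (by omega) (by omega)]
    split_ifs <;> omega

theorem segProd_prodMk {M N : Type*} [Monoid M] [Monoid N] (g : ℕ → M) (g' : ℕ → N) (j m : ℕ) :
    segProd (fun k => (g k, g' k)) j m = (segProd g j m, segProd g' j m) := by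
  unfold segProd
  induction List.range' j (m + 1 - j) with
  | nil => rfl
  | cons a l ih => simp only [List.map_cons, List.prod_cons, ih, Prod.mk_mul_mk]

/-- Membership of (x, 1) means that some word evaluates to x in M and to 1 in the symmetric group.
In its normal form, the permutation sends the last moved letter m + 1 to j; so j = m + 1, the
segment is empty, and induction on m applies to the remaining factor. -/
theorem IsCoxeterA.eq_one {M : Type*} [Monoid M] {n : ℕ} {g : ℕ → M} :
    ∀ m, m ≤ n - 1 → IsCoxeterA g m → ∀ x : M,
      (x, 1) ∈ Submonoid.closure ((fun k => (g k, natSwap n k)) '' {k | k < m}) → x = 1 := by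
  intro m
  induction m with
  | zero =>
    intro _ _ x hx
    simp only [Nat.not_lt_zero, Set.ofPred_false, Set.image_empty, Submonoid.closure_empty,
      Submonoid.mem_bot] at hx
    exact congrArg Prod.fst hx
  | succ m ih =>
    intro hm hg x hx
    have hg2 := hg.prodMk ((isCoxeterA_natSwap n).mono hm)
    obtain ⟨j, hj, ⟨y, σ⟩, hy, h⟩ := hg2.normalForm hx
    rw [segProd_prodMk, Prod.mk_mul_mk, Prod.mk.injEq] at h
    have hfix : ∀ z ∈ Submonoid.closure ((fun k => (g k, natSwap n k)) '' {k | k < m}),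
        z.2 ⟨m + 1, by omega⟩ = ⟨m + 1, by omega⟩ := by
      intro z hz
      induction hz using Submonoid.closure_induction with
      | mem z hz =>
        obtain ⟨k, hk, rfl⟩ := hz
        have hk : k < m := hk
        ext
        simp only [natSwap_val n k (by omega)]
        split_ifs <;> omega
      | one => rfl
      | mul z z' _ _ hz hz' => rw [Prod.snd_mul, Equiv.Perm.mul_apply, hz', hz]
    have h2 := hfix _ hy
    have h3 := segProd_natSwap_val n m (by omega) _ j hj rfl
    have h4 := congrArg (fun π : Equiv.Perm (Fin n) => ((π ⟨m + 1, by omega⟩ : Fin n) : ℕ)) h.2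
    simp only [Equiv.Perm.one_apply, Equiv.Perm.mul_apply] at h4 h2
    rw [h2, h3] at h4
    rw [segProd_of_lt _ (by omega), segProd_of_lt _ (by omega), one_mul, one_mul] at h
    obtain ⟨rfl, rfl⟩ := h
    exact ih (by omega) (hg.mono (by omega)) x hy

theorem adjSwap_eq_natSwap {n : ℕ} (k : Fin (n - 1)) : adjSwap k = natSwap n k := by
  rw [natSwap, dif_pos (by omega)]
  rfl

/-- The presentation of the symmetric group by adjacent transpositions. -/
theorem IsCoxeterA.exists_monoidHom {M : Type*} [Monoid M] {n : ℕ} {g : ℕ → M}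
    (hg : IsCoxeterA g (n - 1)) :
    ∃ Φ : Equiv.Perm (Fin n) →* M, ∀ k : Fin (n - 1), Φ (adjSwap k) = g k := by
  let G : List (Fin (n - 1)) → M := fun w => (w.map fun k : Fin (n - 1) => g k).prod
  let P : List (Fin (n - 1)) → Equiv.Perm (Fin n) := fun w => (w.map adjSwap).prod
  have hmem : ∀ w, (G w, P w) ∈
      Submonoid.closure ((fun k => (g k, natSwap n k)) '' {k | k < n - 1}) := by
    intro w
    induction w with
    | nil => exact one_mem _
    | cons k w ih =>
      have : (G (k :: w), P (k :: w)) = (g k, natSwap n k) * (G w, P w) := by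
        simp [G, P, adjSwap_eq_natSwap]
      rw [this]
      exact mul_mem (Submonoid.subset_closure ⟨k, k.2, rfl⟩) ih
  have hone : ∀ w, P w = 1 → G w = 1 := fun w hw =>
    hg.eq_one (n - 1) le_rfl (G w) (hw ▸ hmem w)
  have happ : ∀ v w, G (v ++ w) = G v * G w := fun v w => by simp [G]
  have happ' : ∀ v w, P (v ++ w) = P v * P w := fun v w => by simp [P]
  -- M is only a monoid, so inverses are supplied by reversed words, whose permutations are the
  -- inverse ones because the generators are involutions.
  have hrev : ∀ w, P w.reverse = (P w)⁻¹ := by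
    intro w
    induction w with
    | nil => simp [P]
    | cons k w ih =>
      have h : P (k :: w) = P [k] * P w := happ' [k] w
      rw [List.reverse_cons, happ', ih, h, mul_inv_rev]
      simp [P, adjSwap]
  have hG : ∀ v w, P v = P w → G v = G w := by
    intro v w h
    have h1 : G v * G w.reverse = 1 := by
      rw [← happ]
      exact hone _ (by rw [happ', hrev, h, mul_inv_cancel])
    have h2 : G w.reverse * G w = 1 := by
      rw [← happ]
      exact hone _ (by rw [happ', hrev, inv_mul_cancel])
    calc G v = G v * (G w.reverse * G w) := by rw [h2, mul_one]
      _ = G w := by rw [← mul_assoc, h1, one_mul]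
  have hex : ∀ π : Equiv.Perm (Fin n), ∃ w, P w = π := fun π =>
    ⟨_, (exists_minimalWord π).choose_spec.1⟩
  choose W hW using hex
  refine ⟨⟨⟨fun π => G (W π), hone _ (hW 1)⟩, fun π σ => ?_⟩, fun k => ?_⟩
  · change G _ = G _ * G _
    rw [← happ]
    exact hG _ _ (by rw [happ', hW, hW, hW])
  · change G _ = _
    rw [hG _ [k] (by rw [hW]; simp [P])]
    simp [G]

end Presentation

end QuantumGroup

end

noncomputable section

namespace QuantumGroup

/-! ### Operators on functions on words. -/

section Words

variable {I : Type*}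

/-- Linear operators on the functions on words. -/
abbrev WordOp (I : Type*) := Module.End ℂ (List I → ℂ)

/-- The operator `1 ⊗ P` acting on the tail of words. -/
def shift (P : WordOp I) : WordOp I where
  toFun φ w := match w with
    | [] => 0
    | i :: w => P (fun v => φ (i :: v)) w
  map_add' φ ψ := by
    funext w
    cases w with
    | nil => simp
    | cons i w => exact congrFun (map_add P (fun v => φ (i :: v)) fun v => ψ (i :: v)) w
  map_smul' c φ := by
    funext w
    cases w with
    | nil => simp
    | cons i w => exact congrFun (map_smul P c fun v => φ (i :: v)) w

theorem shift_nil (P : WordOp I) (φ : List I → ℂ) : shift P φ [] = 0 := rfl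

theorem shift_cons (P : WordOp I) (φ : List I → ℂ) (i : I) (w : List I) :
    shift P φ (i :: w) = P (fun v => φ (i :: v)) w := rfl

theorem shift_mul (P Q : WordOp I) : shift (P * Q) = shift P * shift Q := by
  ext φ w
  cases w <;> rfl

theorem shift_add (P Q : WordOp I) : shift (P + Q) = shift P + shift Q := by
  ext φ w
  cases w
  · simp [shift_nil]
  · rfl

theorem shift_neg (P : WordOp I) : shift (-P) = -shift P := by
  ext φ w
  cases w
  · simp [shift_nil]
  · rfl

theorem shift_sub (P Q : WordOp I) : shift (P - Q) = shift P - shift Q := by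
  rw [sub_eq_add_neg, shift_add, shift_neg, sub_eq_add_neg]

/-- The operator `P` acting after the first `k` letters. -/
def shiftN (k : ℕ) (P : WordOp I) : WordOp I := shift^[k] P

theorem shiftN_zero (P : WordOp I) : shiftN 0 P = P := rfl

theorem shiftN_succ (k : ℕ) (P : WordOp I) : shiftN (k + 1) P = shift (shiftN k P) :=
  Function.iterate_succ_apply' _ _ _

theorem shiftN_add (k l : ℕ) (P : WordOp I) : shiftN (k + l) P = shiftN k (shiftN l P) :=
  Function.iterate_add_apply _ _ _ _

theorem shiftN_mul (k : ℕ) (P Q : WordOp I) : shiftN k (P * Q) = shiftN k P * shiftN k Q := by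
  induction k with
  | zero => rfl
  | succ k ih => rw [shiftN_succ, ih, shift_mul, shiftN_succ, shiftN_succ]

theorem shiftN_sub (k : ℕ) (P Q : WordOp I) : shiftN k (P - Q) = shiftN k P - shiftN k Q := by
  induction k with
  | zero => rfl
  | succ k ih => rw [shiftN_succ, ih, shift_sub, shiftN_succ, shiftN_succ]

theorem shiftN_neg (k : ℕ) (P : WordOp I) : shiftN k (-P) = -shiftN k P := by
  induction k with
  | zero => rfl
  | succ k ih => rw [shiftN_succ, ih, shift_neg, shiftN_succ]

theorem shiftN_append (P : WordOp I) (u : List I) (φ : List I → ℂ) (v : List I) :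
    shiftN u.length P φ (u ++ v) = P (fun v => φ (u ++ v)) v := by
  induction u generalizing φ with
  | nil => rfl
  | cons i u ih =>
    rw [List.length_cons, shiftN_succ, List.cons_append, shift_cons, ih]
    rfl

/-- `φ` and `ψ` agree on words of length `m`. -/
def EqAt (m : ℕ) (φ ψ : List I → ℂ) : Prop := ∀ w, w.length = m → φ w = ψ w

/-- The values of `P φ` on words of length `m + d` are determined by those of `φ` on words of
length `m`, and vanish on words of length less than `d`. -/
structure Lowers (d : ℕ) (P : WordOp I) : Prop where
  eqAt : ∀ m φ ψ, EqAt m φ ψ → EqAt (m + d) (P φ) (P ψ)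
  eq_zero : ∀ φ w, w.length < d → P φ w = 0

theorem Lowers.shift {d : ℕ} {P : WordOp I} (h : Lowers d P) : Lowers d (shift P) where
  eqAt := by
    intro m φ ψ hφ w hw
    cases w with
    | nil => rfl
    | cons i w =>
      rw [List.length_cons] at hw
      rcases m with _ | m
      · rw [shift_cons, shift_cons, h.eq_zero _ _ (by omega), h.eq_zero _ _ (by omega)]
      · exact h.eqAt m _ _ (fun v hv => hφ _ (by simp [hv])) w (by omega)
  eq_zero := by
    intro φ w hw
    cases w with
    | nil => rfl
    | cons i w => exact h.eq_zero _ _ (by simp at hw; omega)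

theorem Lowers.shiftN {d : ℕ} {P : WordOp I} (h : Lowers d P) (k : ℕ) : Lowers d (shiftN k P) := by
  induction k with
  | zero => exact h
  | succ k ih => rw [shiftN_succ]; exact ih.shift

/-- If `P` vanishes on words of length less than `m`, then `1^{⊗ k} ⊗ P` vanishes on words of
length less than `m + k`. -/
theorem shiftN_eq_zero {P : WordOp I} {m : ℕ} (h : ∀ φ w, w.length < m → P φ w = 0) (k : ℕ) :
    ∀ φ w, w.length < m + k → shiftN k P φ w = 0 := by
  induction k with
  | zero => exact h
  | succ k ih =>
    intro φ w hw
    rw [shiftN_succ]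
    cases w with
    | nil => rfl
    | cons i w => exact ih _ _ (by simp at hw; omega)

variable [Fintype I]

/-- The action of a matrix `M` of size `I × I` on the first two letters. -/
def quadOp (M : Matrix (I × I) (I × I) ℂ) : WordOp I where
  toFun φ w := match w with
    | i :: j :: w => ∑ a : I × I, M (i, j) a * φ (a.1 :: a.2 :: w)
    | _ => 0
  map_add' φ ψ := by
    funext w
    rcases w with _ | ⟨i, _ | ⟨j, w⟩⟩ <;> simp [mul_add, Finset.sum_add_distrib]
  map_smul' c φ := by
    funext w
    rcases w with _ | ⟨i, _ | ⟨j, w⟩⟩ <;> simp [Finset.mul_sum, mul_left_comm]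

/-- The contraction of the first two letters by a matrix `Z`. -/
def linOp (Z : Matrix (I × I) I ℂ) : WordOp I where
  toFun φ w := match w with
    | i :: j :: w => ∑ t, Z (i, j) t * φ (t :: w)
    | _ => 0
  map_add' φ ψ := by
    funext w
    rcases w with _ | ⟨i, _ | ⟨j, w⟩⟩ <;> simp [mul_add, Finset.sum_add_distrib]
  map_smul' c φ := by
    funext w
    rcases w with _ | ⟨i, _ | ⟨j, w⟩⟩ <;> simp [Finset.mul_sum, mul_left_comm]

/-- The contraction of the first two letters by a column `T`. -/
def constOp (T : Matrix (I × I) Unit ℂ) : WordOp I where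
  toFun φ w := match w with
    | i :: j :: w => T (i, j) () * φ w
    | _ => 0
  map_add' φ ψ := by
    funext w
    rcases w with _ | ⟨i, _ | ⟨j, w⟩⟩ <;> simp [mul_add]
  map_smul' c φ := by
    funext w
    rcases w with _ | ⟨i, _ | ⟨j, w⟩⟩ <;> simp [mul_left_comm]

theorem quadOp_cons (M : Matrix (I × I) (I × I) ℂ) (φ : List I → ℂ) (i j : I) (w : List I) :
    quadOp M φ (i :: j :: w) = ∑ a : I × I, M (i, j) a * φ (a.1 :: a.2 :: w) := rfl

theorem linOp_cons (Z : Matrix (I × I) I ℂ) (φ : List I → ℂ) (i j : I) (w : List I) :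
    linOp Z φ (i :: j :: w) = ∑ t, Z (i, j) t * φ (t :: w) := rfl

theorem constOp_cons (T : Matrix (I × I) Unit ℂ) (φ : List I → ℂ) (i j : I) (w : List I) :
    constOp T φ (i :: j :: w) = T (i, j) () * φ w := rfl

theorem quadOp_mul (M N : Matrix (I × I) (I × I) ℂ) : quadOp (M * N) = quadOp M * quadOp N := by
  refine LinearMap.ext fun φ => funext fun w => ?_
  rcases w with _ | ⟨i, _ | ⟨j, w⟩⟩
  · rfl
  · rfl
  · simp only [Module.End.mul_apply, quadOp_cons, Matrix.mul_apply, Finset.sum_mul, Finset.mul_sum]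
    rw [Finset.sum_comm]
    simp only [mul_assoc]

theorem quadOp_neg (M : Matrix (I × I) (I × I) ℂ) : quadOp (-M) = -quadOp M := by
  refine LinearMap.ext fun φ => funext fun w => ?_
  rcases w with _ | ⟨i, _ | ⟨j, w⟩⟩
  · simp [quadOp]
  · simp [quadOp]
  · simp [quadOp_cons]

theorem lowers_quadOp (M : Matrix (I × I) (I × I) ℂ) : Lowers 0 (quadOp M) where
  eqAt := by
    intro m φ ψ h w hw
    rcases w with _ | ⟨i, _ | ⟨j, w⟩⟩
    · rfl
    · rfl
    · simp only [quadOp_cons]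
      exact Finset.sum_congr rfl fun a _ => by rw [h _ (by simpa using hw)]
  eq_zero := by simp

theorem lowers_linOp (Z : Matrix (I × I) I ℂ) : Lowers 1 (linOp Z) where
  eqAt := by
    intro m φ ψ h w hw
    rcases w with _ | ⟨i, _ | ⟨j, w⟩⟩
    · rfl
    · rfl
    · simp only [linOp_cons]
      exact Finset.sum_congr rfl fun a _ => by rw [h _ (by simpa using hw)]
  eq_zero := by
    intro φ w hw
    obtain rfl : w = [] := List.length_eq_zero_iff.1 (by omega)
    rfl

theorem lowers_constOp (T : Matrix (I × I) Unit ℂ) : Lowers 2 (constOp T) where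
  eqAt := by
    intro m φ ψ h w hw
    rcases w with _ | ⟨i, _ | ⟨j, w⟩⟩
    · rfl
    · rfl
    · simp only [constOp_cons]
      rw [h _ (by simpa using hw)]
  eq_zero := by
    intro φ w hw
    rcases w with _ | ⟨i, _ | ⟨j, w⟩⟩
    · rfl
    · rfl
    · simp at hw

theorem apply_sum_mul {ι : Type*} (s : Finset ι) (P : WordOp I) (c : ι → ℂ)
    (φ : ι → List I → ℂ) (w : List I) :
    P (fun v => ∑ a ∈ s, c a * φ a v) w = ∑ a ∈ s, c a * P (φ a) w := by
  have h : (fun v => ∑ a ∈ s, c a * φ a v) = ∑ a ∈ s, c a • φ a := by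
    funext v
    simp
  rw [h, map_sum, Finset.sum_apply]
  simp

theorem quadOp_shift_shift (M : Matrix (I × I) (I × I) ℂ) (P : WordOp I) :
    quadOp M * shift (shift P) = shift (shift P) * quadOp M := by
  refine LinearMap.ext fun φ => funext fun w => ?_
  rcases w with _ | ⟨i, _ | ⟨j, w⟩⟩
  · rfl
  · rfl
  · simp only [Module.End.mul_apply, quadOp_cons, shift_cons]
    rw [apply_sum_mul]

/-- Contracting two letters to one moves whatever acts further right by one place. The convention
that operators vanish on words too short for them makes this hold on all words. -/
theorem linOp_shift (Z : Matrix (I × I) I ℂ) (P : WordOp I) :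
    linOp Z * shift P = shift (shift P) * linOp Z := by
  refine LinearMap.ext fun φ => funext fun w => ?_
  rcases w with _ | ⟨i, _ | ⟨j, w⟩⟩
  · rfl
  · rfl
  · simp only [Module.End.mul_apply, linOp_cons, shift_cons]
    rw [apply_sum_mul]

theorem constOp_mul (T : Matrix (I × I) Unit ℂ) (P : WordOp I) :
    constOp T * P = shift (shift P) * constOp T := by
  refine LinearMap.ext fun φ => funext fun w => ?_
  rcases w with _ | ⟨i, _ | ⟨j, w⟩⟩
  · rfl
  · rfl
  · simp only [Module.End.mul_apply, constOp_cons, shift_cons]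
    rw [show (fun v => T (i, j) () * φ v) = T (i, j) () • φ from rfl, map_smul]
    rfl

theorem shiftN_quadOp_comm (M : Matrix (I × I) (I × I) ℂ) (P : WordOp I) (k l : ℕ) :
    shiftN k (quadOp M) * shiftN (k + l + 2) P = shiftN (k + l + 2) P * shiftN k (quadOp M) := by
  have h : shiftN (k + l + 2) P = shiftN k (shift (shift (shiftN l P))) := by
    rw [add_assoc, shiftN_add, shiftN_succ, shiftN_succ]
  rw [h, ← shiftN_mul, quadOp_shift_shift, shiftN_mul]

theorem shiftN_linOp_comm (Z : Matrix (I × I) I ℂ) (P : WordOp I) (k l : ℕ) :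
    shiftN k (linOp Z) * shiftN (k + l + 1) P = shiftN (k + l + 2) P * shiftN k (linOp Z) := by
  have h : shiftN (k + l + 2) P = shiftN k (shift (shift (shiftN l P))) := by
    rw [add_assoc, shiftN_add, shiftN_succ, shiftN_succ]
  have h' : shiftN (k + l + 1) P = shiftN k (shift (shiftN l P)) := by
    rw [add_assoc, shiftN_add, shiftN_succ]
  rw [h, h', ← shiftN_mul, linOp_shift, shiftN_mul]

theorem shiftN_constOp_comm (T : Matrix (I × I) Unit ℂ) (P : WordOp I) (k l : ℕ) :
    shiftN k (constOp T) * shiftN (k + l) P = shiftN (k + l + 2) P * shiftN k (constOp T) := by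
  have h : shiftN (k + l + 2) P = shiftN k (shift (shift (shiftN l P))) := by
    rw [add_assoc, shiftN_add, shiftN_succ, shiftN_succ]
  rw [h, shiftN_add, ← shiftN_mul, constOp_mul, shiftN_mul]

end Words

end QuantumGroup

end

noncomputable section

namespace QuantumGroup

/-! ### Consistency of the relations and the lower order terms b_k. -/

section PBW

variable {I : Type*} [Fintype I]

/-- The restriction of `φ` to words of the form `a ++ w` with `a` of length `2`. -/
def headTwo (φ : List I → ℂ) (w : List I) : I × I → ℂ := fun a => φ (a.1 :: a.2 :: w)

/-- The restriction of `φ` to words of the form `a ++ w` with `a` of length `3`. -/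
def headThree (φ : List I → ℂ) (w : List I) : I × I × I → ℂ :=
  fun a => φ (a.1 :: a.2.1 :: a.2.2 :: w)

/-- The column `T ⊗ 1`, with columns indexed by `I`. -/
def constOne [DecidableEq I] (T : Matrix (I × I) Unit ℂ) : Matrix (I × I × I) I ℂ :=
  (tensorOne T).submatrix id fun i => ((), i)

/-- The column `1 ⊗ T`, with columns indexed by `I`. -/
def oneConst [DecidableEq I] (T : Matrix (I × I) Unit ℂ) : Matrix (I × I × I) I ℂ :=
  (oneTensor T).submatrix id fun i => (i, ())

theorem headTwo_quadOp (M : Matrix (I × I) (I × I) ℂ) (φ : List I → ℂ) (w : List I) :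
    headTwo (quadOp M φ) w = M.mulVec (headTwo φ w) := rfl

theorem headTwo_linOp (Z : Matrix (I × I) I ℂ) (φ : List I → ℂ) (w : List I) :
    headTwo (linOp Z φ) w = Z.mulVec fun t => φ (t :: w) := rfl

theorem headTwo_constOp (T : Matrix (I × I) Unit ℂ) (φ : List I → ℂ) (w : List I) :
    headTwo (constOp T φ) w = T.mulVec fun _ => φ w := by
  ext a
  simp [headTwo, constOp_cons, Matrix.mulVec, dotProduct]

variable [DecidableEq I]

theorem tensorOne_apply {J : Type*} (M : Matrix (I × I) J ℂ) (i j k c : I) (a : J) :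
    tensorOne M (i, j, k) (a, c) = if k = c then M (i, j) a else 0 := by
  change M (i, j) a * (1 : Matrix I I ℂ) k c = _
  rw [Matrix.one_apply, mul_ite, mul_one, mul_zero]

theorem oneTensor_apply {J : Type*} (M : Matrix (I × I) J ℂ) (i j k c : I) (a : J) :
    oneTensor M (i, j, k) (c, a) = if i = c then M (j, k) a else 0 := by
  change (1 : Matrix I I ℂ) i c * M (j, k) a = _
  rw [Matrix.one_apply, ite_mul, one_mul, zero_mul]

theorem R₁₂_apply (M : Matrix (I × I) (I × I) ℂ) (i j k a b c : I) :
    R₁₂ M (i, j, k) (a, b, c) = if k = c then M (i, j) (a, b) else 0 :=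
  tensorOne_apply M i j k c (a, b)

theorem R₂₃_apply (M : Matrix (I × I) (I × I) ℂ) (i j k a b c : I) :
    R₂₃ M (i, j, k) (a, b, c) = if i = a then M (j, k) (b, c) else 0 :=
  oneTensor_apply M i j k a (b, c)

theorem constOne_apply (T : Matrix (I × I) Unit ℂ) (i j k c : I) :
    constOne T (i, j, k) c = if k = c then T (i, j) () else 0 :=
  tensorOne_apply T i j k c ()

theorem oneConst_apply (T : Matrix (I × I) Unit ℂ) (i j k c : I) :
    oneConst T (i, j, k) c = if i = c then T (j, k) () else 0 :=
  oneTensor_apply T i j k c ()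

theorem headThree_quadOp (M : Matrix (I × I) (I × I) ℂ) (φ : List I → ℂ) (w : List I) :
    headThree (quadOp M φ) w = (R₁₂ M).mulVec (headThree φ w) := by
  ext ⟨i, j, k⟩
  simp [headThree, quadOp_cons, Matrix.mulVec, dotProduct, R₁₂_apply, Fintype.sum_prod_type]

theorem headThree_shift_quadOp (M : Matrix (I × I) (I × I) ℂ) (φ : List I → ℂ) (w : List I) :
    headThree (shift (quadOp M) φ) w = (R₂₃ M).mulVec (headThree φ w) := by
  ext ⟨i, j, k⟩
  simp [headThree, shift_cons, quadOp_cons, Matrix.mulVec, dotProduct, R₂₃_apply,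
    Fintype.sum_prod_type, Finset.sum_ite_irrel]

theorem headThree_linOp (Z : Matrix (I × I) I ℂ) (φ : List I → ℂ) (w : List I) :
    headThree (linOp Z φ) w = (tensorOne Z).mulVec (headTwo φ w) := by
  ext ⟨i, j, k⟩
  simp [headThree, headTwo, linOp_cons, Matrix.mulVec, dotProduct, tensorOne_apply,
    Fintype.sum_prod_type]

theorem headThree_shift_linOp (Z : Matrix (I × I) I ℂ) (φ : List I → ℂ) (w : List I) :
    headThree (shift (linOp Z) φ) w = (oneTensor Z).mulVec (headTwo φ w) := by
  ext ⟨i, j, k⟩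
  simp [headThree, headTwo, shift_cons, linOp_cons, Matrix.mulVec, dotProduct, oneTensor_apply,
    Fintype.sum_prod_type, Finset.sum_ite_irrel]

theorem headThree_constOp (T : Matrix (I × I) Unit ℂ) (φ : List I → ℂ) (w : List I) :
    headThree (constOp T φ) w = (constOne T).mulVec fun t => φ (t :: w) := by
  ext ⟨i, j, k⟩
  simp [headThree, constOp_cons, Matrix.mulVec, dotProduct, constOne_apply]

theorem headThree_shift_constOp (T : Matrix (I × I) Unit ℂ) (φ : List I → ℂ) (w : List I) :
    headThree (shift (constOp T) φ) w = (oneConst T).mulVec fun t => φ (t :: w) := by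
  ext ⟨i, j, k⟩
  simp [headThree, shift_cons, constOp_cons, Matrix.mulVec, dotProduct, oneConst_apply]

/-- The consistency conditions on the coefficients of the quadratic relations
`(R - 1) (x ⊗ x - Z x + T) = 0`. -/
structure IsConsistent (R : Matrix (I × I) (I × I) ℂ) (Z : Matrix (I × I) I ℂ)
    (T : Matrix (I × I) Unit ℂ) : Prop where
  sq : R * R = 1
  braid : R₁₂ R * R₂₃ R * R₁₂ R = R₂₃ R * R₁₂ R * R₂₃ R
  quad : antisymm₃ R * (tensorOne Z - oneTensor Z)* R
    = -(antisymm₃ R * (tensorOne Z - oneTensor Z))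
  lin : antisymm₃ R * (oneTensor Z * Z - tensorOne Z * Z + constOne T - oneConst T) = 0
  const : antisymm₃ R * (tensorOne Z - oneTensor Z) * T = 0

theorem R₁₂_sub_one (R : Matrix (I × I) (I × I) ℂ) : R₁₂ (R - 1) = R₁₂ R - 1 := by
  ext ⟨i, j, k⟩ ⟨a, b, c⟩
  simp only [R₁₂_apply, Matrix.sub_apply, Matrix.one_apply, Prod.mk.injEq]
  split_ifs <;> simp_all

theorem R₂₃_sub_one (R : Matrix (I × I) (I × I) ℂ) : R₂₃ (R - 1) = R₂₃ R - 1 := by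
  ext ⟨i, j, k⟩ ⟨a, b, c⟩
  simp only [R₂₃_apply, Matrix.sub_apply, Matrix.one_apply, Prod.mk.injEq]
  split_ifs <;> simp_all

theorem R₁₂_mul (M N : Matrix (I × I) (I × I) ℂ) : R₁₂ (M * N) = R₁₂ M * R₁₂ N := by
  ext ⟨i, j, k⟩ ⟨a, b, c⟩
  simp only [Matrix.mul_apply, R₁₂_apply, Fintype.sum_prod_type]
  by_cases h : k = c <;> simp [h]

theorem R₂₃_mul (M N : Matrix (I × I) (I × I) ℂ) : R₂₃ (M * N) = R₂₃ M * R₂₃ N := by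
  ext ⟨i, j, k⟩ ⟨a, b, c⟩
  simp only [Matrix.mul_apply, R₂₃_apply, Fintype.sum_prod_type]
  by_cases h : i = a <;> simp [h, Finset.sum_ite_irrel]

theorem R₁₂_one : R₁₂ (1 : Matrix (I × I) (I × I) ℂ) = 1 := by
  ext ⟨i, j, k⟩ ⟨a, b, c⟩
  simp only [R₁₂_apply, Matrix.one_apply, Prod.mk.injEq]
  split_ifs <;> simp_all

theorem R₂₃_one : R₂₃ (1 : Matrix (I × I) (I × I) ℂ) = 1 := by
  ext ⟨i, j, k⟩ ⟨a, b, c⟩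
  simp only [R₂₃_apply, Matrix.one_apply, Prod.mk.injEq]
  split_ifs <;> simp_all

variable {R : Matrix (I × I) (I × I) ℂ} {Z : Matrix (I × I) I ℂ} {T : Matrix (I × I) Unit ℂ}

variable (R Z T) in
/-- The function `φ` on words is compatible, at words of length at most `N`, with the relations
`(R - 1) (x ⊗ x - Z x + T) = 0`. -/
def SolvesUpTo (N : ℕ) (φ : List I → ℂ) : Prop :=
  ∀ k w, w.length ≤ N →
    shiftN k (quadOp (R - 1)) φ w = shiftN k (quadOp (R - 1) * (linOp Z - constOp T)) φ w

variable (R Z T) in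
/-- The lower order terms of the relations at position `k`. -/
def lowerTerm (φ : List I → ℂ) (k : ℕ) : List I → ℂ :=
  shiftN k (quadOp (R - 1) * (linOp Z - constOp T)) φ

theorem IsConsistent.R_mul_sub_one (h : IsConsistent R Z T) : R * (R - 1) = -(R - 1) := by
  rw [mul_sub, h.sq, mul_one, neg_sub]

theorem IsConsistent.quadOp_lowerTerm (h : IsConsistent R Z T) (φ : List I → ℂ) (k : ℕ) :
    shiftN k (quadOp R) (lowerTerm R Z T φ k) = -lowerTerm R Z T φ k := by
  rw [lowerTerm, ← Module.End.mul_apply, ← shiftN_mul, ← mul_assoc, ← quadOp_mul,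
    h.R_mul_sub_one, quadOp_neg]
  have e : -quadOp (R - 1) * (linOp Z - constOp T) = -(quadOp (R - 1) * (linOp Z - constOp T)) :=
    LinearMap.ext fun _ => rfl
  rw [e, shiftN_neg]
  rfl

/-- Write c = R - 1, L = Z - T, b_k = c_k L_k φ. Since the positions are disjoint, the extra factor
c can be moved until it acts directly on φ, in degree at most N, where φ satisfies the relations and
c may be replaced by cL. Both sides then become (cL)_l b_k. -/
theorem SolvesUpTo.lowerTerm_comm {N : ℕ} {φ : List I → ℂ} (hφ : SolvesUpTo R Z T N φ)
    {k l : ℕ} (hkl : k + 2 ≤ l) :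
    EqAt (N + 1) (shiftN l (quadOp (R - 1)) (lowerTerm R Z T φ k))
      (shiftN k (quadOp (R - 1)) (lowerTerm R Z T φ l)) := by
  obtain ⟨d, rfl⟩ : ∃ d, l = k + d + 2 := ⟨l - k - 2, by omega⟩
  have hc : ∀ j m, m ≤ N → EqAt m (shiftN j (quadOp (R - 1)) φ) (lowerTerm R Z T φ j) :=
    fun j m hm w hw => hφ j w (by omega)
  set c := quadOp (R - 1) with hcdef
  set L := linOp Z - constOp T with hL
  have hlin : ∀ j ψ ψ', EqAt N ψ ψ' →
      EqAt (N + 1) (shiftN j (linOp Z) ψ) (shiftN j (linOp Z) ψ') :=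
    fun j ψ ψ' h => ((lowers_linOp Z).shiftN j).eqAt N ψ ψ' h
  have hconst : ∀ j ψ ψ', (∀ m, m + 1 = N → EqAt m ψ ψ') →
      EqAt (N + 1) (shiftN j (constOp T) ψ) (shiftN j (constOp T) ψ') := by
    intro j ψ ψ' h
    -- The constant term removes two letters, so it looks at degree N - 1; for N = 0 there is no
    -- such degree and both sides vanish.
    rcases N with _ | N
    · intro w hw
      rw [((lowers_constOp T).shiftN j).eq_zero _ _ (by omega),
        ((lowers_constOp T).shiftN j).eq_zero _ _ (by omega)]
    · exact ((lowers_constOp T).shiftN j).eqAt N ψ ψ' (h N rfl)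
  have hquad : ∀ j ψ ψ', EqAt (N + 1) ψ ψ' → EqAt (N + 1) (shiftN j c ψ) (shiftN j c ψ') :=
    fun j ψ ψ' h => ((lowers_quadOp (R - 1)).shiftN j).eqAt (N + 1) ψ ψ' h
  have hsub : ∀ ψ₁ ψ₂ ψ₁' ψ₂' : List I → ℂ, EqAt (N + 1) ψ₁ ψ₁' → EqAt (N + 1) ψ₂ ψ₂' →
      EqAt (N + 1) (ψ₁ - ψ₂) (ψ₁' - ψ₂') := by
    intro ψ₁ ψ₂ ψ₁' ψ₂' h₁ h₂ w hw
    simp only [Pi.sub_apply, h₁ w hw, h₂ w hw]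
  have hfin : shiftN k c (shiftN (k + d + 2) (c * L) (shiftN k L φ)) =
      shiftN (k + d + 2) (c * L) (lowerTerm R Z T φ k) := by
    have h1 : shiftN k c * shiftN (k + d + 2) (c * L) = shiftN (k + d + 2) (c * L) * shiftN k c :=
      shiftN_quadOp_comm _ _ _ _
    have h2 := congrArg (fun P : WordOp I => P (shiftN k L φ)) h1
    simp only [Module.End.mul_apply] at h2
    rw [h2, lowerTerm, shiftN_mul k, Module.End.mul_apply]
  have hleft : EqAt (N + 1) (shiftN (k + d + 2) c (lowerTerm R Z T φ k))
      (shiftN k c (shiftN (k + d + 2) (c * L) (shiftN k L φ))) := by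
    have h1 : shiftN (k + d + 2) c (lowerTerm R Z T φ k) = shiftN k c
        (shiftN k (linOp Z) (shiftN (k + d + 1) c φ) - shiftN k (constOp T) (shiftN (k + d) c φ)) := by
      have e1 := congrArg (fun P : WordOp I => P φ) (shiftN_linOp_comm Z c k d)
      have e2 := congrArg (fun P : WordOp I => P φ) (shiftN_constOp_comm T c k d)
      have e3 := congrArg (fun P : WordOp I => P (shiftN k L φ)) (shiftN_quadOp_comm (R - 1) c k d)
      simp only [Module.End.mul_apply] at e1 e2 e3
      rw [e1, e2, ← map_sub, lowerTerm, shiftN_mul, Module.End.mul_apply, ← hcdef, ← e3, hL,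
        shiftN_sub]
      rfl
    have h2 : shiftN (k + d + 2) (c * L) (shiftN k L φ) =
        shiftN k (linOp Z) (lowerTerm R Z T φ (k + d + 1))
          - shiftN k (constOp T) (lowerTerm R Z T φ (k + d)) := by
      have e1 := congrArg (fun P : WordOp I => P φ) (shiftN_linOp_comm Z (c * L) k d)
      have e2 := congrArg (fun P : WordOp I => P φ) (shiftN_constOp_comm T (c * L) k d)
      simp only [Module.End.mul_apply] at e1 e2
      rw [lowerTerm, lowerTerm, e1, e2, ← map_sub, ← LinearMap.sub_apply, ← shiftN_sub]
    rw [h1, h2]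
    exact hquad _ _ _ (hsub _ _ _ _ (hlin _ _ _ (hc _ _ le_rfl))
      (hconst _ _ _ fun m hm => hc _ _ (by omega)))
  have hright : EqAt (N + 1) (shiftN k c (lowerTerm R Z T φ (k + d + 2)))
      (shiftN (k + d + 2) (c * L) (lowerTerm R Z T φ k)) := by
    have h1 : shiftN k c (lowerTerm R Z T φ (k + d + 2)) =
        shiftN (k + d + 2) c (shiftN (k + d + 2) (linOp Z) (shiftN k c φ)
          - shiftN (k + d + 2) (constOp T) (shiftN k c φ)) := by
      have e1 := congrArg (fun P : WordOp I => P φ) (shiftN_quadOp_comm (R - 1) (c * L) k d)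
      simp only [Module.End.mul_apply] at e1
      rw [lowerTerm, e1, shiftN_mul, hL, shiftN_sub]
      rfl
    rw [h1, shiftN_mul, Module.End.mul_apply, hL, shiftN_sub]
    exact hquad _ _ _ (hsub _ _ _ _ (hlin _ _ _ (hc _ _ le_rfl))
      (hconst _ _ _ fun m hm => hc _ _ (by omega)))
  intro w hw
  rw [hleft w hw, hfin, hright w hw]

/-- Together with `IsConsistent.mul_R₂₃_sub_one`, this factors A₃ through R - 1 at either position:
the two ways of starting the reduction of a cubic expression. -/
theorem mul_R₁₂_sub_one (R : Matrix (I × I) (I × I) ℂ) :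
    (1 + R₁₂ R * R₂₃ R - R₂₃ R) * R₁₂ (R - 1) = -antisymm₃ R := by
  rw [R₁₂_sub_one, antisymm₃]
  noncomm_ring

theorem IsConsistent.mul_R₂₃_sub_one (h : IsConsistent R Z T) :
    (1 + R₂₃ R * R₁₂ R - R₁₂ R) * R₂₃ (R - 1) = -antisymm₃ R := by
  rw [R₂₃_sub_one, antisymm₃, h.braid]
  noncomm_ring

/-- The two ways of reducing `A₃ (x ⊗ x ⊗ x)` agree. -/
theorem IsConsistent.antisymm₃_mulVec (h : IsConsistent R Z T) (φ₂ : I × I → ℂ) (φ₁ : I → ℂ)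
    (φ₀ : Unit → ℂ)
    (hφ : (R - 1).mulVec φ₂ = (R - 1).mulVec (Z.mulVec φ₁ - T.mulVec φ₀)) :
    (antisymm₃ R).mulVec ((tensorOne Z).mulVec φ₂ - (constOne T).mulVec φ₁) =
      (antisymm₃ R).mulVec ((oneTensor Z).mulVec φ₂ - (oneConst T).mulVec φ₁) := by
  set X := antisymm₃ R * (tensorOne Z - oneTensor Z) with hX
  -- As X = -½ X(R - 1), the value of X on φ₂ depends only on (R - 1)φ₂, which the relation
  -- expresses through lower degree.
  have hq : X * (R - 1) = (-2 : ℂ) • X := by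
    rw [Matrix.mul_sub, h.quad, Matrix.mul_one]
    module
  have h1 : (-2 : ℂ) • X.mulVec φ₂ = (-2 : ℂ) • X.mulVec (Z.mulVec φ₁ - T.mulVec φ₀) := by
    rw [← Matrix.smul_mulVec, ← hq, ← Matrix.mulVec_mulVec, hφ, Matrix.mulVec_mulVec, hq,
      Matrix.smul_mulVec]
  have h2 : X.mulVec φ₂ = X.mulVec (Z.mulVec φ₁ - T.mulVec φ₀) :=
    smul_right_injective _ (by norm_num : (-2 : ℂ) ≠ 0) h1
  have h3 : X * Z = antisymm₃ R * (constOne T - oneConst T) := by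
    have := h.lin
    rw [hX]
    simp only [Matrix.mul_sub, Matrix.mul_add, Matrix.sub_mul,
      Matrix.mul_assoc] at this ⊢
    rw [← sub_eq_zero, ← neg_eq_zero, ← this]
    abel
  rw [Matrix.mulVec_sub, Matrix.mulVec_mulVec, Matrix.mulVec_mulVec, h.const, h3,
    Matrix.zero_mulVec, sub_zero, hX] at h2
  simp only [Matrix.mulVec_sub, Matrix.mulVec_mulVec, Matrix.mul_sub, Matrix.sub_mulVec] at h2 ⊢
  rw [sub_eq_sub_iff_add_eq_add] at h2 ⊢
  rw [h2, add_comm]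

end PBW

end QuantumGroup

end

noncomputable section

namespace QuantumGroup

/-! ### Pairing with symmetric tensors. -/

section Pairing

variable {I : Type*} [Fintype I] {E : Type*} [AddCommGroup E] [Module ℂ E]

/-- The contraction `∑ α_a g_a` over words `a` of length `n`. -/
def pair (n : ℕ) (α : List I → ℂ) (g : List I → E) : E :=
  ∑ a : Fin n → I, α (List.ofFn a) • g (List.ofFn a)

theorem pair_zero (α : List I → ℂ) (g : List I → E) : pair 0 α g = α [] • g [] := by
  simp [pair]

theorem pair_succ (n : ℕ) (α : List I → ℂ) (g : List I → E) :
    pair (n + 1) α g = ∑ i, pair n (fun w => α (i :: w)) (fun w => g (i :: w)) := by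
  simp only [pair]
  rw [← (Fin.consEquiv fun _ => I).sum_comp, Fintype.sum_prod_type]
  simp [Fin.consEquiv, List.ofFn_succ]

theorem pair_congr {n : ℕ} {α α' : List I → ℂ} {g g' : List I → E}
    (hα : ∀ w, w.length = n → α w = α' w) (hg : ∀ w, w.length = n → g w = g' w) :
    pair n α g = pair n α' g' :=
  Finset.sum_congr rfl fun a _ => by rw [hα _ (by simp), hg _ (by simp)]

theorem pair_sub (n : ℕ) (α : List I → ℂ) (g g' : List I → E) :
    pair n α (g - g') = pair n α g - pair n α g' := by
  simp [pair, smul_sub]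

theorem pair_add (n : ℕ) (α : List I → ℂ) (g g' : List I → E) :
    pair n α (g + g') = pair n α g + pair n α g' := by
  simp [pair, smul_add, Finset.sum_add_distrib]

theorem pair_sum {ι : Type*} (s : Finset ι) (n : ℕ) (α : List I → ℂ) (g : ι → List I → E) :
    pair n α (fun w => ∑ i ∈ s, g i w) = ∑ i ∈ s, pair n α (g i) := by
  simp only [pair, Finset.smul_sum]
  rw [Finset.sum_comm]

theorem pair_sum_left {ι : Type*} (s : Finset ι) (n : ℕ) (α : ι → List I → ℂ) (g : List I → E) :
    pair n (fun w => ∑ i ∈ s, α i w) g = ∑ i ∈ s, pair n (α i) g := by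
  simp only [pair, Finset.sum_smul]
  rw [Finset.sum_comm]

theorem pair_smul (n : ℕ) (c : ℂ) (α : List I → ℂ) (g : List I → E) :
    pair n α (fun w => c • g w) = c • pair n α g := by
  simp only [pair, Finset.smul_sum, smul_comm c]

theorem pair_mul_left (n : ℕ) (c : ℂ) (α : List I → ℂ) (g : List I → E) :
    pair n (fun w => c * α w) g = c • pair n α g := by
  simp only [pair, Finset.smul_sum, mul_smul]

theorem map_pair {F : Type*} [AddCommGroup F] [Module ℂ F] (f : E →ₗ[ℂ] F) (n : ℕ)
    (α : List I → ℂ) (g : List I → E) : f (pair n α g) = pair n α fun w => f (g w) := by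
  simp [pair]

/-- The functional `α` is invariant under the action of `R` at all positions. -/
def IsSymm (R : Matrix (I × I) (I × I) ℂ) (α : List I → ℂ) : Prop :=
  ∀ u v, ∀ b : I × I, ∑ a : I × I, α (u ++ a.1 :: a.2 :: v) * R a b = α (u ++ b.1 :: b.2 :: v)

variable {R : Matrix (I × I) (I × I) ℂ}

theorem IsSymm.cons {α : List I → ℂ} (h : IsSymm R α) (i : I) : IsSymm R fun w => α (i :: w) :=
  fun u v b => h (i :: u) v b

theorem IsSymm.concat {α : List I → ℂ} (h : IsSymm R α) (s : I) :
    IsSymm R fun w => α (w ++ [s]) := by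
  intro u v b
  simpa using h u (v ++ [s]) b

theorem IsSymm.pair_shiftN {α : List I → ℂ} (h : IsSymm R α) (k : ℕ) {n : ℕ} (hk : k + 2 ≤ n)
    (ψ : List I → ℂ) : pair n α (shiftN k (quadOp R) ψ) = pair n α ψ := by
  induction k generalizing n α ψ with
  | zero =>
    obtain ⟨n, rfl⟩ : ∃ m, n = m + 2 := ⟨n - 2, by omega⟩
    simp only [pair_succ, shiftN_zero]
    have h' : ∀ b : I × I, (fun w => α (b.1 :: b.2 :: w)) =
        fun w => ∑ a : I × I, R a b * α (a.1 :: a.2 :: w) := by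
      intro b
      funext w
      rw [← List.nil_append (b.1 :: b.2 :: w), ← h [] w b]
      simp [mul_comm]
    have h₁ : ∀ a : I × I, pair n (fun w => α (a.1 :: a.2 :: w))
        (fun w => quadOp R ψ (a.1 :: a.2 :: w)) =
        ∑ b : I × I, R a b • pair n (fun w => α (a.1 :: a.2 :: w)) fun w => ψ (b.1 :: b.2 :: w) := by
      intro a
      simp only [quadOp_cons, Prod.mk.eta, ← smul_eq_mul, ← pair_smul]
      exact pair_sum _ _ _ _
    have h₂ : ∀ b : I × I, pair n (fun w => α (b.1 :: b.2 :: w))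
        (fun w => ψ (b.1 :: b.2 :: w)) =
        ∑ a : I × I, R a b • pair n (fun w => α (a.1 :: a.2 :: w)) fun w => ψ (b.1 :: b.2 :: w) := by
      intro b
      rw [h' b, pair_sum_left]
      exact Finset.sum_congr rfl fun a _ => pair_mul_left _ _ _ _
    calc _ = ∑ a : I × I, pair n (fun w => α (a.1 :: a.2 :: w))
          fun w => quadOp R ψ (a.1 :: a.2 :: w) := (Fintype.sum_prod_type _).symm
      _ = ∑ b : I × I, pair n (fun w => α (b.1 :: b.2 :: w)) fun w => ψ (b.1 :: b.2 :: w) := by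
        simp only [h₁, h₂]
        exact Finset.sum_comm
      _ = _ := Fintype.sum_prod_type _
  | succ k ih =>
    obtain ⟨n, rfl⟩ : ∃ m, n = m + 1 := ⟨n - 1, by omega⟩
    rw [pair_succ, pair_succ]
    refine Finset.sum_congr rfl fun i _ => ?_
    rw [shiftN_succ]
    exact ih (h.cons i) (by omega) _

end Pairing

/-! ### Construction of functions on words that satisfy the relations. -/

section Solve

variable {I : Type*} [Fintype I] [DecidableEq I]

omit [Fintype I] [DecidableEq I] in
theorem shiftN_succ_comm (k : ℕ) (P : WordOp I) : shiftN (k + 1) P = shiftN k (shift P) := rfl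

theorem shiftN_quadOp_one (k : ℕ) (ψ : List I → ℂ) (w : List I) (hw : k + 2 ≤ w.length) :
    shiftN k (quadOp 1) ψ w = ψ w := by
  induction k generalizing ψ w with
  | zero =>
    rcases w with _ | ⟨i, _ | ⟨j, w⟩⟩
    · simp at hw
    · simp at hw
    · rw [shiftN_zero, quadOp_cons]
      simp [Matrix.one_apply]
  | succ k ih =>
    cases w with
    | nil => simp at hw
    | cons i w =>
      rw [shiftN_succ, shift_cons]
      exact ih _ w (by simp at hw; omega)

theorem quadOp_sub (M N : Matrix (I × I) (I × I) ℂ) : quadOp (M - N) = quadOp M - quadOp N := by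
  refine LinearMap.ext fun φ => funext fun w => ?_
  rcases w with _ | ⟨i, _ | ⟨j, w⟩⟩
  · simp [quadOp]
  · simp [quadOp]
  · simp [quadOp_cons, sub_mul]

theorem shiftN_quadOp_sub_one (M : Matrix (I × I) (I × I) ℂ) (k : ℕ) (ψ : List I → ℂ) (w : List I)
    (hw : k + 2 ≤ w.length) :
    shiftN k (quadOp (M - 1)) ψ w = shiftN k (quadOp M) ψ w - ψ w := by
  rw [quadOp_sub, shiftN_sub, LinearMap.sub_apply, Pi.sub_apply, shiftN_quadOp_one k ψ w hw]

theorem exists_eq_append_three {k : ℕ} {w : List I} (h : k + 3 ≤ w.length) :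
    ∃ u i j l v, w = u ++ i :: j :: l :: v ∧ u.length = k := by
  induction k generalizing w with
  | zero =>
    rcases w with _ | ⟨i, _ | ⟨j, _ | ⟨l, v⟩⟩⟩
    · simp at h
    · simp at h
    · simp at h
    · exact ⟨[], i, j, l, v, rfl, rfl⟩
  | succ k ih =>
    cases w with
    | nil => simp at h
    | cons a w =>
      obtain ⟨u, i, j, l, v, rfl, hu⟩ := ih (w := w) (by simp at h; omega)
      exact ⟨a :: u, i, j, l, v, rfl, by simp [hu]⟩

variable {R : Matrix (I × I) (I × I) ℂ} {Z : Matrix (I × I) I ℂ} {T : Matrix (I × I) Unit ℂ}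

theorem IsConsistent.shiftN_braid (h : IsConsistent R Z T) (k : ℕ) (ψ : List I → ℂ) {w : List I}
    (hw : k + 3 ≤ w.length) :
    shiftN k (quadOp R) (shiftN (k + 1) (quadOp R) (shiftN k (quadOp R) ψ)) w =
      shiftN (k + 1) (quadOp R) (shiftN k (quadOp R) (shiftN (k + 1) (quadOp R) ψ)) w := by
  obtain ⟨u, i, j, l, v, rfl, rfl⟩ := exists_eq_append_three hw
  simp only [shiftN_succ_comm u.length, ← Module.End.mul_apply, ← shiftN_mul, shiftN_append]
  set ψ' : List I → ℂ := fun v => ψ (u ++ v)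
  have e : headThree ((quadOp R * (shift (quadOp R) * quadOp R)) ψ') v =
      headThree ((shift (quadOp R) * (quadOp R * shift (quadOp R))) ψ') v := by
    simp only [Module.End.mul_apply, headThree_quadOp, headThree_shift_quadOp,
      Matrix.mulVec_mulVec]
    rw [← Matrix.mul_assoc, h.braid, Matrix.mul_assoc]
  exact congrFun e (i, j, l)

/-- On three consecutive letters, both sides are -A₃ applied to a lower order expression, obtained
by reducing the first pair or the second pair of letters; `IsConsistent.antisymm₃_mulVec` equates
them. -/
theorem SolvesUpTo.lowerTerm_braid {N : ℕ} {φ : List I → ℂ} (hφ : SolvesUpTo R Z T N φ)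
    (h : IsConsistent R Z T) (k : ℕ) (hk : k + 3 ≤ N + 1) {w : List I} (hw : w.length = N + 1) :
    lowerTerm R Z T φ k w
        + shiftN k (quadOp R) (shiftN (k + 1) (quadOp R) (lowerTerm R Z T φ k)) w
        - shiftN (k + 1) (quadOp R) (lowerTerm R Z T φ k) w =
      lowerTerm R Z T φ (k + 1) w
        + shiftN (k + 1) (quadOp R) (shiftN k (quadOp R) (lowerTerm R Z T φ (k + 1))) w
        - shiftN k (quadOp R) (lowerTerm R Z T φ (k + 1)) w := by
  obtain ⟨u, i, j, l, v, rfl, rfl⟩ := exists_eq_append_three (hw ▸ hk)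
  simp only [lowerTerm, shiftN_succ_comm u.length, ← Module.End.mul_apply, ← shiftN_mul, shiftN_append]
  set φ' : List I → ℂ := fun v => φ (u ++ v) with hφ'
  have hsol : (R - 1).mulVec (headTwo φ' v) =
      (R - 1).mulVec (Z.mulVec (fun t => φ' (t :: v)) - T.mulVec fun _ => φ' v) := by
    have h1 : headTwo (quadOp (R - 1) φ') v =
        headTwo ((quadOp (R - 1) * (linOp Z - constOp T) : WordOp I) φ') v := by
      ext ⟨s, t⟩
      have := hφ u.length (u ++ s :: t :: v) (by simp at hw ⊢; omega)
      rwa [shiftN_append, shiftN_append] at this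
    rw [headTwo_quadOp, Module.End.mul_apply, headTwo_quadOp, LinearMap.sub_apply] at h1
    rw [h1, ← headTwo_linOp, ← headTwo_constOp]
    rfl
  have key := h.antisymm₃_mulVec _ _ _ hsol
  have hsub : ∀ ψ ψ' : List I → ℂ, headThree (ψ - ψ') v = headThree ψ v - headThree ψ' v :=
    fun _ _ => rfl
  have e1 : headThree ((quadOp (R - 1) * (linOp Z - constOp T) : WordOp I) φ') v = (R₁₂ (R - 1)).mulVec
      ((tensorOne Z).mulVec (headTwo φ' v) - (constOne T).mulVec fun t => φ' (t :: v)) := by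
    rw [Module.End.mul_apply, headThree_quadOp, LinearMap.sub_apply, hsub, headThree_linOp,
      headThree_constOp]
  have e2 : headThree (shift (quadOp (R - 1) * (linOp Z - constOp T)) φ') v =
      (R₂₃ (R - 1)).mulVec
      ((oneTensor Z).mulVec (headTwo φ' v) - (oneConst T).mulVec fun t => φ' (t :: v)) := by
    rw [shift_mul, Module.End.mul_apply, headThree_shift_quadOp, shift_sub, LinearMap.sub_apply,
      hsub, headThree_shift_linOp, headThree_shift_constOp]
  set P := quadOp (R - 1) * (linOp Z - constOp T)
  have e : headThree (P φ') v + headThree ((quadOp R * (shift (quadOp R) * P)) φ') v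
        - headThree ((shift (quadOp R) * P) φ') v =
      headThree (shift P φ') v + headThree ((shift (quadOp R) * (quadOp R * shift P)) φ') v
        - headThree ((quadOp R * shift P) φ') v := by
    simp only [Module.End.mul_apply, headThree_quadOp, headThree_shift_quadOp, e1, e2] at key ⊢
    rw [← neg_inj, ← Matrix.neg_mulVec, ← Matrix.neg_mulVec] at key
    nth_rewrite 1 [← mul_R₁₂_sub_one] at key
    rw [← h.mul_R₂₃_sub_one] at key
    simpa only [← Matrix.mulVec_mulVec, Matrix.add_mulVec, Matrix.sub_mulVec,
      Matrix.one_mulVec] using key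
  exact congrFun e (i, j, l)

variable (R Z T) in
/-- The affine action on the functions on words of length `N + 1` of the transposition of the
letters `k` and `k + 1`. -/
def affineSwap (N : ℕ) (φ : List I → ℂ) (k : ℕ) : Function.End (List I → ℂ) := fun ψ w =>
  if w.length = N + 1 then (shiftN k (quadOp R) ψ - lowerTerm R Z T φ k) w else ψ w

theorem eqAt_affineSwap (N : ℕ) (φ : List I → ℂ) (k : ℕ) (ψ : List I → ℂ) :
    EqAt (N + 1) (affineSwap R Z T N φ k ψ) (shiftN k (quadOp R) ψ - lowerTerm R Z T φ k) :=
  fun _ hw => if_pos hw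

theorem shiftN_affineSwap (N : ℕ) (φ : List I → ℂ) (k l : ℕ) (ψ : List I → ℂ) :
    EqAt (N + 1) (shiftN l (quadOp R) (affineSwap R Z T N φ k ψ))
      (shiftN l (quadOp R) (shiftN k (quadOp R) ψ)
        - shiftN l (quadOp R) (lowerTerm R Z T φ k)) := by
  rw [← map_sub]
  exact ((lowers_quadOp R).shiftN l).eqAt (N + 1) _ _ (eqAt_affineSwap N φ k ψ)

theorem affineSwap_affineSwap (N : ℕ) (φ : List I → ℂ) (k l : ℕ) (ψ : List I → ℂ) {w : List I}
    (hw : w.length = N + 1) :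
    affineSwap R Z T N φ l (affineSwap R Z T N φ k ψ) w =
      shiftN l (quadOp R) (shiftN k (quadOp R) ψ) w
        - shiftN l (quadOp R) (lowerTerm R Z T φ k) w - lowerTerm R Z T φ l w := by
  rw [eqAt_affineSwap N φ l _ w hw, Pi.sub_apply, shiftN_affineSwap N φ k l ψ w hw, Pi.sub_apply]

theorem shiftN_affineSwap_affineSwap (N : ℕ) (φ : List I → ℂ) (k l m : ℕ) (ψ : List I → ℂ)
    {w : List I} (hw : w.length = N + 1) :
    affineSwap R Z T N φ m (affineSwap R Z T N φ l (affineSwap R Z T N φ k ψ)) w =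
      shiftN m (quadOp R) (shiftN l (quadOp R) (shiftN k (quadOp R) ψ)) w
        - shiftN m (quadOp R) (shiftN l (quadOp R) (lowerTerm R Z T φ k)) w
        - shiftN m (quadOp R) (lowerTerm R Z T φ l) w - lowerTerm R Z T φ m w := by
  rw [affineSwap_affineSwap N φ l m _ hw,
    ((lowers_quadOp R).shiftN m).eqAt (N + 1) _ _ (shiftN_affineSwap N φ k l ψ) w hw, map_sub,
    Pi.sub_apply]

theorem affineSwap_of_ne (N : ℕ) (φ : List I → ℂ) (k : ℕ) (ψ : List I → ℂ) {w : List I}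
    (hw : w.length ≠ N + 1) : affineSwap R Z T N φ k ψ w = ψ w :=
  if_neg hw

/-- The linear parts satisfy the Coxeter relations. The translation parts match by R_k b_k = -b_k
for the squares, by `lowerTerm_comm` for distant positions and by `lowerTerm_braid` for adjacent
ones. -/
theorem SolvesUpTo.isCoxeterA {N : ℕ} {φ : List I → ℂ} (hφ : SolvesUpTo R Z T N φ)
    (h : IsConsistent R Z T) : IsCoxeterA (affineSwap R Z T N φ) N where
  sq k hk := by
    funext ψ w
    change affineSwap R Z T N φ k (affineSwap R Z T N φ k ψ) w = ψ w
    by_cases hw : w.length = N + 1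
    · rw [affineSwap_affineSwap N φ k k ψ hw, h.quadOp_lowerTerm, ← Module.End.mul_apply,
        ← shiftN_mul, ← quadOp_mul, h.sq, shiftN_quadOp_one _ _ _ (by omega)]
      simp
    · rw [affineSwap_of_ne _ _ _ _ hw, affineSwap_of_ne _ _ _ _ hw]
  comm k l hkl hl := by
    funext ψ w
    change affineSwap R Z T N φ k (affineSwap R Z T N φ l ψ) w =
      affineSwap R Z T N φ l (affineSwap R Z T N φ k ψ) w
    by_cases hw : w.length = N + 1
    · have h1 := hφ.lowerTerm_comm hkl w hw
      rw [shiftN_quadOp_sub_one _ _ _ _ (by omega), shiftN_quadOp_sub_one _ _ _ _ (by omega)] at h1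
      obtain ⟨d, rfl⟩ : ∃ d, l = k + d + 2 := ⟨l - k - 2, by omega⟩
      have h2 := congrArg (fun P : WordOp I => P ψ w) (shiftN_quadOp_comm R (quadOp R) k d)
      simp only [Module.End.mul_apply] at h2
      rw [affineSwap_affineSwap N φ _ _ ψ hw, affineSwap_affineSwap N φ _ _ ψ hw, h2]
      linear_combination h1
    · simp only [affineSwap_of_ne _ _ _ _ hw]
  braid k hk := by
    funext ψ w
    change affineSwap R Z T N φ k (affineSwap R Z T N φ (k + 1) (affineSwap R Z T N φ k ψ)) w =
      affineSwap R Z T N φ (k + 1) (affineSwap R Z T N φ k (affineSwap R Z T N φ (k + 1) ψ)) w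
    by_cases hw : w.length = N + 1
    · rw [shiftN_affineSwap_affineSwap N φ _ _ _ ψ hw, shiftN_affineSwap_affineSwap N φ _ _ _ ψ hw,
        h.shiftN_braid k ψ (by omega)]
      linear_combination -hφ.lowerTerm_braid h k (by omega) hw
    · simp only [affineSwap_of_ne _ _ _ _ hw]

/-- The lower order term lies in the image of R_k - 1, and α(R_k - 1) = 0. -/
theorem IsSymm.pair_lowerTerm {α : List I → ℂ} (hα : IsSymm R α) {k n : ℕ} (hk : k + 2 ≤ n)
    (φ : List I → ℂ) : pair n α (lowerTerm R Z T φ k) = 0 := by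
  rw [lowerTerm, shiftN_mul, Module.End.mul_apply]
  set ψ := shiftN k (linOp Z - constOp T) φ
  rw [pair_congr (g' := shiftN k (quadOp R) ψ - ψ) (fun _ _ => rfl) fun w hw =>
      shiftN_quadOp_sub_one R k ψ w (by omega), pair_sub, hα.pair_shiftN k hk, sub_self]

theorem IsSymm.pair_affineSwap {α : List I → ℂ} (hα : IsSymm R α) {N k : ℕ} (hk : k < N)
    (φ ψ : List I → ℂ) (n : ℕ) : pair n α (affineSwap R Z T N φ k ψ) = pair n α ψ := by
  by_cases hn : n = N + 1
  · subst hn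
    rw [pair_congr (fun _ _ => rfl) (eqAt_affineSwap N φ k ψ), pair_sub,
      hα.pair_shiftN k (by omega), hα.pair_lowerTerm (by omega), sub_zero]
  · exact pair_congr (fun _ _ => rfl) fun w hw => affineSwap_of_ne _ _ _ _ (by omega)

/-- A solution of the relations up to degree `N` can be corrected in degree `N + 1`. -/
theorem SolvesUpTo.exists_succ {N : ℕ} {φ : List I → ℂ} (hφ : SolvesUpTo R Z T N φ)
    (h : IsConsistent R Z T) :
    ∃ ψ, SolvesUpTo R Z T (N + 1) ψ ∧ (∀ w, w.length ≠ N + 1 → ψ w = φ w) ∧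
      ∀ α, IsSymm R α → ∀ n, pair n α ψ = pair n α φ := by
  -- The group acts by affine maps, which is why the presentation was proved for arbitrary monoids
  -- and not only for algebras of matrices.
  obtain ⟨Φ, hΦ⟩ := IsCoxeterA.exists_monoidHom (n := N + 1) (hφ.isCoxeterA h)
  have hind : ∀ p : (List I → ℂ) → Prop, p φ →
      (∀ k < N, ∀ ψ, p ψ → p (affineSwap R Z T N φ k ψ)) → ∀ π, p (Φ π φ) := by
    intro p h0 hstep π
    obtain ⟨w, hw, -⟩ := exists_minimalWord π
    rw [← hw]
    clear hw
    induction w with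
    | nil => rwa [List.map_nil, List.prod_nil, map_one]
    | cons k w ih =>
      rw [List.map_cons, List.prod_cons, map_mul, hΦ]
      exact hstep k k.2 _ ih
  have hne : ∀ π w, w.length ≠ N + 1 → Φ π φ w = φ w := fun π =>
    hind (fun ψ => ∀ w, w.length ≠ N + 1 → ψ w = φ w) (fun _ _ => rfl)
      (fun k _ ψ hψ w (hw : w.length ≠ N + 1) => (affineSwap_of_ne _ _ _ _ hw).trans (hψ w hw)) π
  have hpair : ∀ π α, IsSymm R α → ∀ n, pair n α (Φ π φ) = pair n α φ := fun π =>
    hind (fun ψ => ∀ α, IsSymm R α → ∀ n, pair n α ψ = pair n α φ) (fun _ _ _ => rfl)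
      (fun k hk ψ hψ α hα n => (hα.pair_affineSwap hk φ ψ n).trans (hψ α hα n)) π
  set c : ℂ := (Fintype.card (Equiv.Perm (Fin (N + 1))) : ℂ)⁻¹ with hc
  have hcard : ∀ z : ℂ, c * ∑ _π : Equiv.Perm (Fin (N + 1)), z = z := by
    intro z
    rw [Finset.sum_const, Finset.card_univ, nsmul_eq_mul, hc, ← mul_assoc, inv_mul_cancel₀,
      one_mul]
    exact_mod_cast Fintype.card_ne_zero
  -- The barycentre of the orbit of φ: affine maps preserve barycentres and the group permutes the
  -- orbit, so ψ is fixed by every transposition, and being fixed is the relation in degree N + 1.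
  set ψ : List I → ℂ := c • ∑ π, Φ π φ with hψ
  have hval : ∀ w, ψ w = c * ∑ π, Φ π φ w := fun w => by simp [hψ]
  have hψne : ∀ w, w.length ≠ N + 1 → ψ w = φ w := by
    intro w hw
    rw [hval, Finset.sum_congr rfl fun π _ => hne π w hw, hcard]
  refine ⟨ψ, ?_, hψne, ?_⟩
  · intro k w hw
    have hzero : w.length < k + 2 → shiftN k (quadOp (R - 1)) ψ w =
        shiftN k (quadOp (R - 1) * (linOp Z - constOp T)) ψ w := by
      intro hlt
      have hq : ∀ φ' w', w'.length < 2 → quadOp (R - 1) φ' w' = 0 := by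
        intro φ' w' hw'
        rcases w' with _ | ⟨i, _ | ⟨j, w'⟩⟩
        · rfl
        · rfl
        · simp at hw'
      rw [shiftN_mul, Module.End.mul_apply, shiftN_eq_zero hq k _ _ (by omega),
        shiftN_eq_zero hq k _ _ (by omega)]
    -- The lower order terms at words of length at most N + 1 involve only words of length at most
    -- N, where ψ and φ agree.
    have hlow : w.length ≤ N + 1 → shiftN k (quadOp (R - 1) * (linOp Z - constOp T)) ψ w =
        lowerTerm R Z T φ k w := by
      intro hle
      simp only [lowerTerm, shiftN_mul, Module.End.mul_apply]
      refine ((lowers_quadOp (R - 1)).shiftN k).eqAt w.length _ _ ?_ w rfl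
      intro v hv
      rw [shiftN_sub, LinearMap.sub_apply, LinearMap.sub_apply, Pi.sub_apply, Pi.sub_apply]
      congr 1
      · rcases hm : v.length with _ | m
        · rw [((lowers_linOp Z).shiftN k).eq_zero _ _ (by omega),
            ((lowers_linOp Z).shiftN k).eq_zero _ _ (by omega)]
        · exact ((lowers_linOp Z).shiftN k).eqAt m _ _ (fun v' hv' => hψne v' (by omega)) v hm
      · rcases hm : v.length with _ | _ | m
        · rw [((lowers_constOp T).shiftN k).eq_zero _ _ (by omega),
            ((lowers_constOp T).shiftN k).eq_zero _ _ (by omega)]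
        · rw [((lowers_constOp T).shiftN k).eq_zero _ _ (by omega),
            ((lowers_constOp T).shiftN k).eq_zero _ _ (by omega)]
        · exact ((lowers_constOp T).shiftN k).eqAt m _ _ (fun v' hv' => hψne v' (by omega)) v hm
    rcases Nat.lt_or_ge w.length (k + 2) with hlt | hge
    · exact hzero hlt
    · rw [hlow hw]
      by_cases hN : w.length = N + 1
      · have hk : k < N := by omega
        rw [shiftN_quadOp_sub_one _ _ _ _ hge, sub_eq_iff_eq_add]
        have h1 : ψ w = c * ∑ π, affineSwap R Z T N φ k (Φ π φ) w := by
          rw [hval]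
          congr 1
          -- Reindexing by π ↦ t_k⁻¹ π pulls the affine map of position k out of every summand.
          refine Fintype.sum_equiv (Equiv.mulLeft (adjSwap (⟨k, hk⟩ : Fin (N + 1 - 1)))⁻¹) _ _
            fun π => ?_
          have h2 := hΦ ⟨k, hk⟩
          have h3 : Φ π = affineSwap R Z T N φ k * Φ ((adjSwap (⟨k, hk⟩ : Fin (N + 1 - 1)))⁻¹ * π) := by
            rw [← show Φ _ = affineSwap R Z T N φ k from h2, ← map_mul, mul_inv_cancel_left]
          exact congrFun (congrFun h3 φ) w
        have h2 : ∀ π, affineSwap R Z T N φ k (Φ π φ) w =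
            shiftN k (quadOp R) (Φ π φ) w - lowerTerm R Z T φ k w :=
          fun π => eqAt_affineSwap N φ k _ w hN
        rw [h1]
        simp only [h2, Finset.sum_sub_distrib, mul_sub, hcard]
        rw [hψ, map_smul, map_sum]
        simp
      · have h1 := hφ k w (by omega)
        rw [← lowerTerm] at h1
        rw [← h1]
        exact ((lowers_quadOp (R - 1)).shiftN k).eqAt w.length _ _
          (fun v hv => hψne v (by omega)) w rfl
  · intro α hα n
    have h1 : pair n α ψ = c * ∑ π, pair n α (Φ π φ) := by
      rw [← pair_sum, ← smul_eq_mul, ← pair_smul]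
      exact pair_congr (fun _ _ => rfl) fun w _ => hval w
    rw [h1, Finset.sum_congr rfl fun π _ => hpair π α hα n, hcard]

variable (R Z T) in
/-- The functions on words which satisfy the relations `(R - 1) (x ⊗ x - Z x + T) = 0`. -/
def solutions : Submodule ℂ (List I → ℂ) where
  carrier := {φ | ∀ u v : List I, ∀ b : I × I, ∑ a : I × I, (R - 1) b a *
    (φ (u ++ a.1 :: a.2 :: v) - ∑ m, Z a m * φ (u ++ m :: v) + T a () * φ (u ++ v)) = 0}
  zero_mem' := by simp
  add_mem' := by
    intro φ ψ hφ hψ u v b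
    have := congrArg₂ (· + ·) (hφ u v b) (hψ u v b)
    simp only [← Finset.sum_add_distrib, add_zero] at this
    rw [← this]
    refine Finset.sum_congr rfl fun a _ => ?_
    simp only [Pi.add_apply, mul_add, Finset.sum_add_distrib]
    ring
  smul_mem' := by
    intro c φ hφ u v b
    have := congrArg (c * ·) (hφ u v b)
    simp only [Finset.mul_sum, mul_zero] at this
    rw [← this]
    refine Finset.sum_congr rfl fun a _ => ?_
    simp only [Pi.smul_apply, smul_eq_mul, mul_left_comm _ c, ← Finset.mul_sum]
    ring

/-- Every function on words agrees on the symmetric tensors with a solution of the relations. -/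
theorem IsConsistent.exists_solution (h : IsConsistent R Z T) (φ : List I → ℂ) :
    ∃ ψ ∈ solutions R Z T, ∀ α, IsSymm R α → ∀ n, pair n α ψ = pair n α φ := by
  have h0 : SolvesUpTo R Z T 0 φ := by
    intro k w hw
    obtain rfl : w = [] := List.length_eq_zero_iff.1 (by omega)
    rcases k with _ | k
    · rfl
    · rw [shiftN_succ, shiftN_succ]
      rfl
  let s : ∀ N, {ψ : List I → ℂ // SolvesUpTo R Z T N ψ} := fun N =>
    Nat.rec ⟨φ, h0⟩ (fun N p => ⟨(p.2.exists_succ h).choose, (p.2.exists_succ h).choose_spec.1⟩) N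
  have hs : ∀ N, (∀ w, w.length ≠ N + 1 → (s (N + 1)).1 w = (s N).1 w) ∧
      ∀ α, IsSymm R α → ∀ n, pair n α (s (N + 1)).1 = pair n α (s N).1 :=
    fun N => ((s N).2.exists_succ h).choose_spec.2
  -- Stage N + 1 changes only words of length N + 1. So the value at a word is final from the stage
  -- equal to its length on, and the stages glue to one function.
  have hstab : ∀ d w, (s (w.length + d)).1 w = (s w.length).1 w := by
    intro d w
    induction d with
    | zero => rfl
    | succ d ih => rw [← ih, ← add_assoc, (hs _).1 w (by omega)]
  have hpair : ∀ α, IsSymm R α → ∀ n N, pair n α (s N).1 = pair n α φ := by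
    intro α hα n N
    induction N with
    | zero => rfl
    | succ N ih => rw [(hs N).2 α hα n, ih]
  refine ⟨fun w => (s w.length).1 w, ?_, ?_⟩
  · intro u v b
    have h1 := (s (u.length + v.length + 2)).2 u.length (u ++ b.1 :: b.2 :: v) (by simp; omega)
    have h2 : ∀ w : List I, w.length ≤ u.length + v.length + 2 →
        (s w.length).1 w = (s (u.length + v.length + 2)).1 w := by
      intro w hw
      obtain ⟨d, hd⟩ := Nat.exists_eq_add_of_le hw
      rw [hd, hstab]
    have e1 : ∀ i j : I, (s (u ++ i :: j :: v).length).1 (u ++ i :: j :: v) =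
        (s (u.length + v.length + 2)).1 (u ++ i :: j :: v) :=
      fun i j => h2 _ (by simp; omega)
    have e2 : ∀ i : I, (s (u ++ i :: v).length).1 (u ++ i :: v) =
        (s (u.length + v.length + 2)).1 (u ++ i :: v) :=
      fun i => h2 _ (by simp; omega)
    have e3 : (s (u ++ v).length).1 (u ++ v) = (s (u.length + v.length + 2)).1 (u ++ v) :=
      h2 _ (by simp)
    simp only [e1, e2, e3]
    rw [shiftN_append, shiftN_append, Module.End.mul_apply, quadOp_cons, quadOp_cons,
      ← sub_eq_zero, ← Finset.sum_sub_distrib] at h1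
    rw [← h1]
    refine Finset.sum_congr rfl fun a _ => ?_
    rw [LinearMap.sub_apply, Pi.sub_apply, linOp_cons, constOp_cons]
    ring
  · intro α hα n
    rw [← hpair α hα n n]
    exact pair_congr (fun _ _ => rfl) fun w hw => by rw [hw]

end Solve

end QuantumGroup

end

noncomputable section

namespace QuantumGroup

/-! ### Words of fixed length: comparison of R_k as a matrix with R_k as an operator on words. -/

section Letters

variable {I : Type*}

/-- The word `u ++ [p.1, p.2] ++ v` as a function on its positions. -/
def insertTwo (u v : List I) {n : ℕ} (hn : n = u.length + v.length + 2) (p : I × I) : Fin n → I :=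
  fun l => (u ++ p.1 :: p.2 :: v)[(l : ℕ)]'(by simp; omega)

theorem ofFn_insertTwo (u v : List I) {n : ℕ} (hn : n = u.length + v.length + 2) (p : I × I) :
    List.ofFn (insertTwo u v hn p) = u ++ p.1 :: p.2 :: v := by
  refine List.ext_getElem (by simp; omega) fun i h₁ h₂ => ?_
  simp [insertTwo]

theorem insertTwo_posL (u v : List I) {n : ℕ} (hn : n = u.length + v.length + 2) (p : I × I)
    (k : Fin (n - 1)) (hk : (k : ℕ) = u.length) : insertTwo u v hn p (posL k) = p.1 := by
  simp [insertTwo, posL, hk]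

theorem insertTwo_posR (u v : List I) {n : ℕ} (hn : n = u.length + v.length + 2) (p : I × I)
    (k : Fin (n - 1)) (hk : (k : ℕ) = u.length) : insertTwo u v hn p (posR k) = p.2 := by
  simp [insertTwo, posR, hk]

theorem insertTwo_of_ne (u v : List I) {n : ℕ} (hn : n = u.length + v.length + 2) (p q : I × I)
    (k : Fin (n - 1)) (hk : (k : ℕ) = u.length) (l : Fin n) (h₁ : l ≠ posL k) (h₂ : l ≠ posR k) :
    insertTwo u v hn p l = insertTwo u v hn q l := by
  have h₁' : (l : ℕ) ≠ u.length := fun h => h₁ (Fin.ext (by simp [posL, h, hk]))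
  have h₂' : (l : ℕ) ≠ u.length + 1 := fun h => h₂ (Fin.ext (by simp [posR, h, hk]))
  simp only [insertTwo, List.getElem_append, List.getElem_cons]
  split_ifs with h₃ h₄ h₅
  · rfl
  · omega
  · omega
  · rfl

theorem exists_insertTwo {n : ℕ} (k : Fin (n - 1)) (a : Fin n → I) :
    ∃ (u v : List I) (hn : n = u.length + v.length + 2) (p : I × I), (k : ℕ) = u.length ∧
      a = insertTwo u v hn p := by
  have hn : n = ((List.ofFn a).take k).length + ((List.ofFn a).drop (k + 2)).length + 2 := by
    simp
    omega
  refine ⟨_, _, hn, (a (posL k), a (posR k)), by simp; omega, List.ofFn_injective ?_⟩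
  rw [ofFn_insertTwo]
  refine List.ext_getElem (by simp; omega) fun i h₁ h₂ => ?_
  simp only [List.getElem_ofFn, List.getElem_append, List.getElem_cons, List.length_take,
    List.length_ofFn, List.getElem_take, List.getElem_drop, posL, posR]
  split_ifs with h₃ h₄ h₅
  · rfl
  · congr 1; ext; simp; omega
  · congr 1; ext; simp; omega
  · congr 1; ext; simp; omega

variable [Fintype I] [DecidableEq I]

theorem insertTwo_injective (u v : List I) {n : ℕ} (hn : n = u.length + v.length + 2) :
    Function.Injective (insertTwo u v hn) := by
  intro p q h
  have h' := congrArg List.ofFn h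
  rw [ofFn_insertTwo, ofFn_insertTwo, List.append_cancel_left_eq] at h'
  simp only [List.cons.injEq, and_true] at h'
  exact Prod.ext h'.1 h'.2

theorem braidAt_insertTwo (M : Matrix (I × I) (I × I) ℂ) (u v : List I) {n : ℕ}
    (hn : n = u.length + v.length + 2) (k : Fin (n - 1)) (hk : (k : ℕ) = u.length) (p q : I × I) :
    braidAt M k (insertTwo u v hn p) (insertTwo u v hn q) = M p q := by
  rw [braidAt, Matrix.of_apply, if_pos fun l h₁ h₂ => insertTwo_of_ne u v hn p q k hk l h₁ h₂]
  simp only [insertTwo_posL u v hn _ k hk, insertTwo_posR u v hn _ k hk]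

theorem eq_insertTwo (u v : List I) {n : ℕ} (hn : n = u.length + v.length + 2) (k : Fin (n - 1))
    (hk : (k : ℕ) = u.length) (q : I × I) (a : Fin n → I)
    (h : ∀ l, l ≠ posL k → l ≠ posR k → a l = insertTwo u v hn q l) :
    a ∈ Set.range (insertTwo u v hn) := by
  refine ⟨(a (posL k), a (posR k)), ?_⟩
  funext l
  by_cases h₁ : l = posL k
  · rw [h₁, insertTwo_posL u v hn _ k hk]
  by_cases h₂ : l = posR k
  · rw [h₂, insertTwo_posR u v hn _ k hk]
  rw [h l h₁ h₂, insertTwo_of_ne u v hn _ q k hk l h₁ h₂]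

/-- The row of `R_k` at a given word. -/
theorem sum_braidAt_smul {E : Type*} [AddCommGroup E] [Module ℂ E] (M : Matrix (I × I) (I × I) ℂ)
    (u v : List I) {n : ℕ} (hn : n = u.length + v.length + 2) (k : Fin (n - 1))
    (hk : (k : ℕ) = u.length) (p : I × I) (g : (Fin n → I) → E) :
    ∑ b, braidAt M k (insertTwo u v hn p) b • g b = ∑ q, M p q • g (insertTwo u v hn q) := by
  symm
  refine Fintype.sum_of_injective _ (insertTwo_injective u v hn) _ _ (fun b hb => ?_) fun q => ?_
  · rw [braidAt, Matrix.of_apply, if_neg, zero_smul]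
    exact fun h => hb (eq_insertTwo u v hn k hk p b fun l h₁ h₂ => (h l h₁ h₂).symm)
  · rw [braidAt_insertTwo M u v hn k hk]

/-- The column of `R_k` at a given word. -/
theorem sum_mul_braidAt (M : Matrix (I × I) (I × I) ℂ)
    (u v : List I) {n : ℕ} (hn : n = u.length + v.length + 2) (k : Fin (n - 1))
    (hk : (k : ℕ) = u.length) (q : I × I) (g : (Fin n → I) → ℂ) :
    ∑ a, g a * braidAt M k a (insertTwo u v hn q) = ∑ p, g (insertTwo u v hn p) * M p q := by
  symm
  refine Fintype.sum_of_injective _ (insertTwo_injective u v hn) _ _ (fun b hb => ?_) fun q => ?_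
  · rw [braidAt, Matrix.of_apply, if_neg, mul_zero]
    exact fun h => hb (eq_insertTwo u v hn k hk q b h)
  · rw [braidAt_insertTwo M u v hn k hk]

/-- This carries every identity proved for operators on words over to the matrices R_k. -/
theorem braidAt_mulVec_ofFn (M : Matrix (I × I) (I × I) ℂ) {n : ℕ} (k : Fin (n - 1))
    (φ : List I → ℂ) : (braidAt M k).mulVec (fun a => φ (List.ofFn a)) =
      fun a => shiftN k (quadOp M) φ (List.ofFn a) := by
  funext a
  obtain ⟨u, v, hn, p, hk, rfl⟩ := exists_insertTwo k a
  simp only [Matrix.mulVec, dotProduct, ← smul_eq_mul]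
  rw [sum_braidAt_smul M u v hn k hk, ofFn_insertTwo, hk, shiftN_append, quadOp_cons]
  simp [ofFn_insertTwo]

/-- The function on words which is given by `α` on words of length `n`, and vanishes on other
words. -/
def wordExt {n : ℕ} (α : (Fin n → I) → ℂ) (w : List I) : ℂ :=
  ∑ a, if List.ofFn a = w then α a else 0

theorem wordExt_ofFn {n : ℕ} (α : (Fin n → I) → ℂ) (a : Fin n → I) :
    wordExt α (List.ofFn a) = α a := by
  simp [wordExt, List.ofFn_inj]

theorem wordExt_of_ne {n : ℕ} (α : (Fin n → I) → ℂ) {w : List I} (hw : w.length ≠ n) :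
    wordExt α w = 0 := by
  refine Finset.sum_eq_zero fun a _ => if_neg ?_
  rintro rfl
  simp at hw

theorem pair_wordExt {E : Type*} [AddCommGroup E] [Module ℂ E] {n : ℕ} (α : (Fin n → I) → ℂ)
    (g : List I → E) : pair n (wordExt α) g = ∑ a, α a • g (List.ofFn a) := by
  simp only [pair, wordExt_ofFn]

theorem isSymm_wordExt {R : Matrix (I × I) (I × I) ℂ} {n : ℕ} {α : (Fin n → I) → ℂ}
    (h : ∀ k, Matrix.vecMul α (braidAt R k) = α) : IsSymm R (wordExt α) := by
  intro u v b
  by_cases hn : n = u.length + v.length + 2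
  · have h1 := congrFun (h ⟨u.length, by omega⟩) (insertTwo u v hn b)
    simp only [Matrix.vecMul, dotProduct] at h1
    rw [sum_mul_braidAt R u v hn _ rfl] at h1
    simp only [← ofFn_insertTwo u v hn, wordExt_ofFn, h1]
  · rw [wordExt_of_ne _ (by simp; omega)]
    refine Finset.sum_eq_zero fun a _ => ?_
    rw [wordExt_of_ne _ (by simp; omega), zero_mul]

end Letters

/-! ### The symmetrizer as a projection. -/

section Symmetrizer

variable {I : Type*} [Fintype I] [DecidableEq I] {R : Matrix (I × I) (I × I) ℂ}
  {Z : Matrix (I × I) I ℂ} {T : Matrix (I × I) Unit ℂ}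

theorem matrix_ext_ofFn {n : ℕ} {M N : Matrix (Fin n → I) (Fin n → I) ℂ}
    (h : ∀ φ : List I → ℂ, M.mulVec (fun a => φ (List.ofFn a)) =
      N.mulVec fun a => φ (List.ofFn a)) : M = N := by
  refine Matrix.ext_of_mulVec_single fun i => ?_
  have := h (wordExt (Pi.single i 1))
  simpa only [wordExt_ofFn] using this

/-- The R_k satisfy the Coxeter relations. Hence R_π does not depend on the minimal word, and S_n is
the average of a group representation. -/
theorem IsConsistent.exists_braidHom (h : IsConsistent R Z T) (n : ℕ) :
    ∃ Φ : Equiv.Perm (Fin n) →* Matrix (Fin n → I) (Fin n → I) ℂ,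
      ∀ k, Φ (adjSwap k) = braidAt R k := by
  let g : ℕ → Matrix (Fin n → I) (Fin n → I) ℂ := fun k =>
    if hk : k < n - 1 then braidAt R ⟨k, hk⟩ else 1
  have hg : ∀ k, k < n - 1 → ∀ φ : List I → ℂ, (g k).mulVec (fun a => φ (List.ofFn a)) =
      fun a => shiftN k (quadOp R) φ (List.ofFn a) := by
    intro k hk φ
    simp only [g, dif_pos hk]
    exact braidAt_mulVec_ofFn R ⟨k, hk⟩ φ
  have hcox : IsCoxeterA g (n - 1) :=
    { sq := by
        intro k hk
        refine matrix_ext_ofFn fun φ => ?_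
        rw [← Matrix.mulVec_mulVec, hg k hk, hg k hk, Matrix.one_mulVec]
        funext a
        rw [← Module.End.mul_apply, ← shiftN_mul, ← quadOp_mul, h.sq,
          shiftN_quadOp_one _ _ _ (by simp; omega)]
      comm := by
        intro k l hkl hl
        refine matrix_ext_ofFn fun φ => ?_
        obtain ⟨d, rfl⟩ : ∃ d, l = k + d + 2 := ⟨l - k - 2, by omega⟩
        rw [← Matrix.mulVec_mulVec, ← Matrix.mulVec_mulVec, hg _ hl, hg k (by omega),
          hg k (by omega), hg _ hl, ← Module.End.mul_apply, shiftN_quadOp_comm]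
        rfl
      braid := by
        intro k hk
        refine matrix_ext_ofFn fun φ => ?_
        simp only [← Matrix.mulVec_mulVec, hg (k + 1) hk, hg k (by omega : k < n - 1)]
        funext a
        exact h.shiftN_braid k φ (by simp; omega) }
  obtain ⟨Φ, hΦ⟩ := hcox.exists_monoidHom
  exact ⟨Φ, fun k => (hΦ k).trans (dif_pos k.2)⟩

theorem braidPerm_eq {n : ℕ} {Φ : Equiv.Perm (Fin n) →* Matrix (Fin n → I) (Fin n → I) ℂ}
    (hΦ : ∀ k, Φ (adjSwap k) = braidAt R k) (π : Equiv.Perm (Fin n)) : braidPerm R π = Φ π := by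
  have h := (exists_minimalWord π).choose_spec.1
  conv_rhs => rw [← h]
  rw [braidPerm, map_list_prod, List.map_map]
  congr 2
  funext k
  exact (hΦ k).symm

theorem symmetrizer_eq {n : ℕ} {Φ : Equiv.Perm (Fin n) →* Matrix (Fin n → I) (Fin n → I) ℂ}
    (hΦ : ∀ k, Φ (adjSwap k) = braidAt R k) :
    symmetrizer R n = (n.factorial : ℂ)⁻¹ • ∑ π, Φ π := by
  simp only [symmetrizer, braidPerm_eq hΦ]

theorem IsConsistent.symmetrizer_mul_braidAt (h : IsConsistent R Z T) {n : ℕ} (k : Fin (n - 1)) :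
    symmetrizer R n * braidAt R k = symmetrizer R n := by
  obtain ⟨Φ, hΦ⟩ := h.exists_braidHom n
  rw [symmetrizer_eq hΦ, ← hΦ, Matrix.smul_mul, Finset.sum_mul]
  simp only [← map_mul]
  congr 1
  exact Fintype.sum_equiv (Equiv.mulRight (adjSwap k)) _ _ fun π => rfl

theorem vecMul_list_prod {n : ℕ} {α : (Fin n → I) → ℂ}
    (hα : ∀ k, Matrix.vecMul α (braidAt R k) = α) (w : List (Fin (n - 1))) :
    Matrix.vecMul α (w.map (braidAt R)).prod = α := by
  induction w with
  | nil => simp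
  | cons k w ih => rw [List.map_cons, List.prod_cons, ← Matrix.vecMul_vecMul, hα, ih]

theorem factorial_average {E : Type*} [AddCommGroup E] [Module ℂ E] (n : ℕ) (z : E) :
    (n.factorial : ℂ)⁻¹ • ∑ _π : Equiv.Perm (Fin n), z = z := by
  rw [Finset.sum_const, Finset.card_univ, Fintype.card_perm, Fintype.card_fin,
    ← Nat.cast_smul_eq_nsmul ℂ, smul_smul, inv_mul_cancel₀, one_smul]
  exact_mod_cast n.factorial_ne_zero

theorem vecMul_symmetrizer {n : ℕ} {α : (Fin n → I) → ℂ}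
    (hα : ∀ k, Matrix.vecMul α (braidAt R k) = α) : Matrix.vecMul α (symmetrizer R n) = α := by
  rw [symmetrizer, Matrix.vecMul_smul, Matrix.vecMul_sum]
  simp only [braidPerm, vecMul_list_prod hα]
  exact factorial_average n α

theorem IsConsistent.vecMul_braidAt (h : IsConsistent R Z T) {n : ℕ} {α : (Fin n → I) → ℂ}
    (hα : Matrix.vecMul α (symmetrizer R n) = α) (k : Fin (n - 1)) :
    Matrix.vecMul α (braidAt R k) = α := by
  rw [← hα, Matrix.vecMul_vecMul, h.symmetrizer_mul_braidAt]

/-- Each row of S_n is fixed by all the R_k, hence by their average. -/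
theorem IsConsistent.symmetrizer_mul_self (h : IsConsistent R Z T) (n : ℕ) :
    symmetrizer R n * symmetrizer R n = symmetrizer R n := by
  ext a b
  have h1 := congrFun (vecMul_symmetrizer (R := R) (α := (symmetrizer R n) a) fun k => by
    funext c
    exact congrFun (congrFun (h.symmetrizer_mul_braidAt k) a) c) b
  exact h1

/-- An idempotent matrix has an adapted basis. -/
theorem exists_isAdapted {n : ℕ} {S : Matrix (Fin n → I) (Fin n → I) ℂ} (hS : S * S = S) :
    ∃ e : Module.Basis (Fin S.rank ⊕ Fin (1 - S).rank) ℂ ((Fin n → I) → ℂ), IsAdapted e := by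
  have hc : IsCompl (LinearMap.range S.mulVecLin) (LinearMap.range (1 - S).mulVecLin) := by
    refine IsCompl.of_eq ?_ ?_
    · rw [eq_bot_iff]
      rintro _ ⟨⟨v, rfl⟩, w, hw⟩
      simp only [Matrix.mulVecLin_apply] at hw ⊢
      have h1 := congrArg S.mulVec hw
      rw [Matrix.mulVec_mulVec, Matrix.mulVec_mulVec, mul_sub, hS, mul_one, sub_self,
        Matrix.zero_mulVec] at h1
      rw [← h1]
      exact zero_mem _
    · rw [eq_top_iff]
      intro v _
      have : v = S.mulVecLin v + (1 - S).mulVecLin v := by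
        simp [Matrix.sub_mulVec]
      rw [this]
      exact Submodule.add_mem_sup ⟨v, rfl⟩ ⟨v, rfl⟩
  let b₁ := Module.finBasisOfFinrankEq ℂ (LinearMap.range S.mulVecLin) (n := S.rank) rfl
  let b₂ := Module.finBasisOfFinrankEq ℂ (LinearMap.range (1 - S).mulVecLin) (n := (1 - S).rank) rfl
  have key : ∀ {m : ℕ} {W : Submodule ℂ ((Fin n → I) → ℂ)} (b : Module.Basis (Fin m) ℂ W),
      Submodule.span ℂ (Set.range fun i => (b i : (Fin n → I) → ℂ)) = W := by
    intro m W b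
    have := congrArg (Submodule.map W.subtype) b.span_eq
    rw [Submodule.map_span, Submodule.map_top, Submodule.range_subtype, ← Set.range_comp] at this
    exact this
  refine ⟨(b₁.prod b₂).map (Submodule.prodEquivOfIsCompl _ _ hc), ?_, ?_⟩
  · refine Eq.trans ?_ (key b₁)
    congr 2
    funext i
    simp
  · refine Eq.trans ?_ (key b₂)
    congr 2
    funext i
    simp

end Symmetrizer

end QuantumGroup

end

noncomputable section

namespace QuantumGroup

/-! ### The filtration of C by degree, and functionals on C. -/

namespace Coefficients

variable {A I : Type*} [Ring A] [Bialgebra ℂ A] [Fintype I] [DecidableEq I]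
  (D : Coefficients A I)

/-- The monomial `x_{w_1} ⋯ x_{w_n}`. -/
def monomial (w : List I) : D.C := (w.map D.x).prod

theorem monomial_cons (i : I) (w : List I) : D.monomial (i :: w) = D.x i * D.monomial w := by
  simp [monomial]

theorem monomial_append (v w : List I) : D.monomial (v ++ w) = D.monomial v * D.monomial w := by
  simp [monomial]

theorem monomial_nil : D.monomial [] = 1 := rfl

/-- The span of the monomials of degree less than `n`. -/
def filtLT (n : ℕ) : Submodule ℂ D.C :=
  Submodule.span ℂ {y | ∃ w : List I, w.length < n ∧ y = D.monomial w}

theorem monomial_mem {n : ℕ} {w : List I} (hw : w.length < n) : D.monomial w ∈ D.filtLT n :=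
  Submodule.subset_span ⟨w, hw, rfl⟩

theorem filtLT_mono {m n : ℕ} (h : m ≤ n) : D.filtLT m ≤ D.filtLT n := by
  refine Submodule.span_mono ?_
  rintro _ ⟨w, hw, rfl⟩
  exact ⟨w, by omega, rfl⟩

theorem filtLT_zero : D.filtLT 0 = ⊥ := by
  simp [filtLT]

theorem filtC_eq (N : ℕ) : D.filtC N = D.filtLT (N + 1) := by
  refine le_antisymm (Submodule.span_mono ?_) (Submodule.span_mono ?_)
  · rintro _ ⟨n, hn, a, rfl⟩
    exact ⟨List.ofFn a, by simp; omega, by rw [monomial, List.map_ofFn]; rfl⟩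
  · rintro _ ⟨w, hw, rfl⟩
    refine ⟨w.length, by omega, w.get, ?_⟩
    change (w.map D.x).prod = (List.ofFn (D.x ∘ w.get)).prod
    rw [← List.map_ofFn, List.ofFn_get]

theorem x_mul_mem {n : ℕ} (i : I) {y : D.C} (hy : y ∈ D.filtLT n) :
    D.x i * y ∈ D.filtLT (n + 1) := by
  induction hy using Submodule.span_induction with
  | mem y hy =>
    obtain ⟨w, hw, rfl⟩ := hy
    rw [← monomial_cons]
    exact D.monomial_mem (by simp; omega)
  | zero => simp
  | add y z _ _ hy hz => rw [mul_add]; exact add_mem hy hz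
  | smul c y _ hy => rw [mul_smul_comm]; exact Submodule.smul_mem _ _ hy

theorem exists_mem_filtLT (y : D.C) : ∃ n, y ∈ D.filtLT n := by
  let q : FreeAlgebra ℂ I →ₐ[ℂ] D.C := RingQuot.mkAlgHom ℂ D.RelC
  obtain ⟨z, rfl⟩ : ∃ z, q z = y := RingQuot.mkAlgHom_surjective ℂ D.RelC y
  -- Phrased for left multiplication, the claim passes through products in the free algebra without
  -- a rule for products of the filtration.
  have key : ∀ (z : FreeAlgebra ℂ I) (n : ℕ), ∀ y ∈ D.filtLT n, ∃ m, q z * y ∈ D.filtLT m := by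
    intro z
    induction z using FreeAlgebra.induction with
    | grade0 c =>
      intro n y hy
      refine ⟨n, ?_⟩
      rw [AlgHom.commutes, ← Algebra.smul_def]
      exact Submodule.smul_mem _ _ hy
    | grade1 i => exact fun n y hy => ⟨n + 1, D.x_mul_mem i hy⟩
    | mul a b ha hb =>
      intro n y hy
      obtain ⟨m, hm⟩ := hb n y hy
      obtain ⟨l, hl⟩ := ha m _ hm
      exact ⟨l, by rwa [map_mul, mul_assoc]⟩
    | add a b ha hb =>
      intro n y hy
      obtain ⟨m, hm⟩ := ha n y hy
      obtain ⟨l, hl⟩ := hb n y hy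
      refine ⟨max m l, ?_⟩
      rw [map_add, add_mul]
      exact add_mem (D.filtLT_mono (le_max_left _ _) hm) (D.filtLT_mono (le_max_right _ _) hl)
  obtain ⟨m, hm⟩ := key z 1 1 (by rw [← monomial_nil]; exact D.monomial_mem (by simp))
  exact ⟨m, by rwa [mul_one] at hm⟩

theorem quadC_eq (b : I × I) :
    ∑ a : I × I, (D.R - 1) b a • (D.x a.1 * D.x a.2 - ∑ m, D.Z a m • D.x m
      + algebraMap ℂ D.C (D.T a ())) = 0 := by
  have h := RingQuot.mkAlgHom_rel ℂ (RelC.quad (D := D) b.1 b.2)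
  rw [Fintype.sum_prod_type]
  simp only [map_mul, map_add, map_sub, map_sum, map_smul, map_zero, map_one] at h
  simp only [Z, Matrix.of_apply, Algebra.algebraMap_eq_smul_one]
  exact h

/-- The universal property of `C`. -/
def liftC {E : Type*} [Ring E] [Algebra ℂ E] (y : I → E)
    (hy : ∀ b, ∑ a : I × I, (D.R - 1) b a • (y a.1 * y a.2 - ∑ m, D.Z a m • y m
      + algebraMap ℂ E (D.T a ())) = 0) : D.C →ₐ[ℂ] E :=
  RingQuot.liftAlgHom ℂ ⟨FreeAlgebra.lift ℂ y, by
    intro u v h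
    induction h with
    | quad i j =>
      have h := hy (i, j)
      rw [Fintype.sum_prod_type] at h
      simpa [Z, Algebra.algebraMap_eq_smul_one] using h⟩

theorem liftC_x {E : Type*} [Ring E] [Algebra ℂ E] (y : I → E)
    (hy : ∀ b, ∑ a : I × I, (D.R - 1) b a • (y a.1 * y a.2 - ∑ m, D.Z a m • y m
      + algebraMap ℂ E (D.T a ())) = 0) (i : I) : D.liftC y hy (D.x i) = y i := by
  rw [x, liftC]
  erw [RingQuot.liftAlgHom_mkAlgHom_apply]
  simp

theorem algHomC_ext {E : Type*} [Ring E] [Algebra ℂ E] {φ ψ : D.C →ₐ[ℂ] E}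
    (h : ∀ i, φ (D.x i) = ψ (D.x i)) : φ = ψ :=
  RingQuot.ringQuot_ext' ℂ (s := D.RelC) φ ψ (FreeAlgebra.hom_ext (funext h))

/-- Right translation of the solutions of the relations. -/
def solTranslate (i : I) : Module.End ℂ (solutions D.R D.Z D.T) where
  toFun φ := ⟨fun w => φ.1 (w ++ [i]), fun u v b => by
    simpa only [List.append_assoc, List.cons_append] using φ.2 u (v ++ [i]) b⟩
  map_add' _ _ := rfl
  map_smul' _ _ := rfl

/-- A solution of the relations defines a functional on `C`. -/
theorem exists_dual {φ : List I → ℂ} (hφ : φ ∈ solutions D.R D.Z D.T) :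
    ∃ f : Module.Dual ℂ D.C, ∀ w, f (D.monomial w) = φ w := by
  -- Right translations satisfy the relations of C, because a solution satisfies them at the end of
  -- every word. So C acts on the solutions, and evaluating the result at the empty word turns a
  -- solution into a functional.
  have hy : ∀ b, ∑ a : I × I, (D.R - 1) b a • (D.solTranslate a.1 * D.solTranslate a.2
      - ∑ m, D.Z a m • D.solTranslate m
      + algebraMap ℂ (Module.End ℂ (solutions D.R D.Z D.T)) (D.T a ())) = 0 := by
    intro b
    refine LinearMap.ext fun ψ => Subtype.ext (funext fun w => ?_)
    have h := ψ.2 w [] b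
    simp only [LinearMap.sum_apply, LinearMap.smul_apply, LinearMap.add_apply,
      LinearMap.sub_apply, Module.End.mul_apply, Module.algebraMap_end_apply,
      Submodule.coe_sum, Submodule.coe_smul, Submodule.coe_add, Submodule.coe_sub,
      Finset.sum_apply, Pi.smul_apply, Pi.add_apply, Pi.sub_apply, smul_eq_mul]
    simpa [solTranslate] using h
  let Θ := D.liftC D.solTranslate hy
  have hΘ : ∀ w (ψ : solutions D.R D.Z D.T), (Θ (D.monomial w) ψ).1 = fun v => ψ.1 (v ++ w) := by
    intro w
    induction w with
    | nil => intro ψ; simp [monomial_nil]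
    | cons i w ih =>
      intro ψ
      rw [monomial_cons, map_mul, Module.End.mul_apply]
      rw [show Θ (D.x i) = D.solTranslate i from D.liftC_x _ _ i]
      funext v
      change (Θ (D.monomial w) ψ).1 (v ++ [i]) = _
      rw [ih]
      simp
  refine ⟨(LinearMap.proj ([] : List I) ∘ₗ (solutions D.R D.Z D.T).subtype) ∘ₗ
    LinearMap.applyₗ ⟨φ, hφ⟩ ∘ₗ Θ.toLinearMap, fun w => ?_⟩
  change (Θ (D.monomial w) ⟨φ, hφ⟩).1 [] = φ w
  rw [hΘ]
  rfl

/-- `α ↦ α(x ⊗ ⋯ ⊗ x)`, for row vectors `α`. -/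
def evalRow (n : ℕ) : ((Fin n → I) → ℂ) →ₗ[ℂ] D.C :=
  Fintype.linearCombination ℂ fun a : Fin n → I => D.monomial (List.ofFn a)

theorem evalRow_apply (n : ℕ) (α : (Fin n → I) → ℂ) :
    D.evalRow n α = ∑ a, α a • D.monomial (List.ofFn a) := rfl

theorem evalRow_eq_pair (n : ℕ) (α : (Fin n → I) → ℂ) :
    D.evalRow n α = pair n (wordExt α) D.monomial := (pair_wordExt α _).symm

theorem evalTensor_eq (n : ℕ) (α : Module.Dual ℂ ((Fin n → I) → ℂ)) :
    evalTensor D.x α = D.evalRow n fun a => α (Pi.single a 1) := by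
  simp only [evalTensor, evalRow_apply, monomial, List.map_ofFn]
  rfl

theorem evalRow_mem (n : ℕ) (α : (Fin n → I) → ℂ) : D.evalRow n α ∈ D.filtLT (n + 1) :=
  Submodule.sum_mem _ fun a _ => Submodule.smul_mem _ _ (D.monomial_mem (by simp))

/-- Functionals on `C` with given values on symmetric tensors. -/
theorem exists_dual_evalRow (h : IsConsistent D.R D.Z D.T) (φ : List I → ℂ) :
    ∃ f : Module.Dual ℂ D.C, ∀ (n : ℕ) (α : (Fin n → I) → ℂ),
      Matrix.vecMul α (symmetrizer D.R n) = α →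
      f (D.evalRow n α) = ∑ a, α a * φ (List.ofFn a) := by
  obtain ⟨ψ, hψ, hpair⟩ := h.exists_solution φ
  obtain ⟨f, hf⟩ := D.exists_dual hψ
  refine ⟨f, fun n α hα => ?_⟩
  have h1 := hpair (wordExt α) (isSymm_wordExt (h.vecMul_braidAt hα)) n
  rw [pair_wordExt, pair_wordExt] at h1
  rw [evalRow_apply, map_sum]
  simpa only [map_smul, hf, smul_eq_mul] using h1

/-- The quadratic relation, multiplied by monomials on both sides, says that (R_k - 1) applied to
monomials of degree n has degree less than n. -/
theorem evalRow_braidAt_sub_mem (n : ℕ) (k : Fin (n - 1)) (α : (Fin n → I) → ℂ) :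
    D.evalRow n (Matrix.vecMul α (braidAt D.R k)) - D.evalRow n α ∈ D.filtLT n := by
  have h1 : D.evalRow n (Matrix.vecMul α (braidAt D.R k)) - D.evalRow n α =
      ∑ c, α c • (∑ a, braidAt D.R k c a • D.monomial (List.ofFn a)
        - D.monomial (List.ofFn c)) := by
    simp only [evalRow_apply, Matrix.vecMul, dotProduct, smul_sub, Finset.sum_sub_distrib,
      Finset.sum_smul, Finset.smul_sum, smul_smul]
    rw [Finset.sum_comm]
  rw [h1]
  refine Submodule.sum_mem _ fun c _ => Submodule.smul_mem _ _ ?_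
  obtain ⟨u, v, hn, p, hk, rfl⟩ := exists_insertTwo k c
  rw [sum_braidAt_smul D.R u v hn k hk]
  simp only [ofFn_insertTwo]
  have h2 := congrArg (fun y => D.monomial u * y * D.monomial v) (D.quadC_eq p)
  simp only [mul_zero, zero_mul, Finset.mul_sum, Finset.sum_mul] at h2
  have h3 : ∀ q : I × I, D.monomial u * ((D.R - 1) p q • (D.x q.1 * D.x q.2
        - ∑ m, D.Z q m • D.x m + algebraMap ℂ D.C (D.T q ()))) * D.monomial v =
      (D.R - 1) p q • D.monomial (u ++ q.1 :: q.2 :: v)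
        - (D.R - 1) p q • (∑ m, D.Z q m • D.monomial (u ++ m :: v)
          - D.T q () • D.monomial (u ++ v)) := by
    intro q
    simp only [monomial_append, monomial_cons, mul_smul_comm, smul_mul_assoc, mul_add, mul_sub,
      add_mul, sub_mul, Finset.mul_sum, Finset.sum_mul, Algebra.algebraMap_eq_smul_one, mul_one,
      mul_assoc, smul_add, smul_sub]
    abel
  simp only [h3, Finset.sum_sub_distrib] at h2
  have h4 : ∑ q, (D.R - 1) p q • D.monomial (u ++ q.1 :: q.2 :: v) =
      ∑ q, D.R p q • D.monomial (u ++ q.1 :: q.2 :: v) - D.monomial (u ++ p.1 :: p.2 :: v) := by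
    simp [Matrix.sub_apply, sub_smul, Finset.sum_sub_distrib, Matrix.one_apply]
  rw [← h4, sub_eq_zero.1 h2]
  refine Submodule.sum_mem _ fun q _ => Submodule.smul_mem _ _ (sub_mem
    (Submodule.sum_mem _ fun m _ => Submodule.smul_mem _ _ (D.monomial_mem ?_))
    (Submodule.smul_mem _ _ (D.monomial_mem ?_)))
  · simp; omega
  · simp; omega

theorem evalRow_symmetrizer_sub_mem (n : ℕ) (α : (Fin n → I) → ℂ) :
    D.evalRow n (Matrix.vecMul α (symmetrizer D.R n)) - D.evalRow n α ∈ D.filtLT n := by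
  have h1 : ∀ (w : List (Fin (n - 1))) (α : (Fin n → I) → ℂ),
      D.evalRow n (Matrix.vecMul α (w.map (braidAt D.R)).prod) - D.evalRow n α ∈ D.filtLT n := by
    intro w
    induction w with
    | nil => intro α; simp
    | cons k w ih =>
      intro α
      rw [List.map_cons, List.prod_cons, ← Matrix.vecMul_vecMul]
      have := add_mem (ih (Matrix.vecMul α (braidAt D.R k))) (D.evalRow_braidAt_sub_mem n k α)
      rwa [sub_add_sub_cancel] at this
  have h2 : D.evalRow n (Matrix.vecMul α (symmetrizer D.R n)) - D.evalRow n α =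
      (n.factorial : ℂ)⁻¹ • ∑ π : Equiv.Perm (Fin n),
        (D.evalRow n (Matrix.vecMul α (braidPerm D.R π)) - D.evalRow n α) := by
    rw [symmetrizer, Matrix.vecMul_smul, Matrix.vecMul_sum, map_smul, map_sum,
      Finset.sum_sub_distrib, smul_sub, factorial_average]
  rw [h2]
  exact Submodule.smul_mem _ _ (Submodule.sum_mem _ fun π _ => h1 _ α)

/-- Every element of degree at most `n` has a symmetric leading term. -/
theorem exists_evalRow_sub_mem (h : IsConsistent D.R D.Z D.T) (n : ℕ) {y : D.C}
    (hy : y ∈ D.filtLT (n + 1)) : ∃ α : (Fin n → I) → ℂ,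
      Matrix.vecMul α (symmetrizer D.R n) = α ∧ y - D.evalRow n α ∈ D.filtLT n := by
  induction hy using Submodule.span_induction with
  | mem y hy =>
    obtain ⟨w, hw, rfl⟩ := hy
    by_cases hn : w.length = n
    · subst hn
      -- The leading term is the symmetrized indicator row of the word; symmetrizing costs only
      -- lower degree.
      refine ⟨Matrix.vecMul (Pi.single w.get 1) (symmetrizer D.R w.length), ?_, ?_⟩
      · rw [Matrix.vecMul_vecMul, h.symmetrizer_mul_self]
      · have h1 : D.monomial w = D.evalRow w.length (Pi.single w.get 1) := by
          simp [evalRow, List.ofFn_get]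
        rw [h1, ← neg_sub]
        exact neg_mem (D.evalRow_symmetrizer_sub_mem _ _)
    · exact ⟨0, by simp, by simpa using D.monomial_mem (by omega)⟩
  | zero => exact ⟨0, by simp, by simp⟩
  | add y z _ _ hy hz =>
    obtain ⟨α, hα, hy⟩ := hy
    obtain ⟨β, hβ, hz⟩ := hz
    refine ⟨α + β, by rw [Matrix.add_vecMul, hα, hβ], ?_⟩
    rw [map_add, add_sub_add_comm]
    exact add_mem hy hz
  | smul c y _ hy =>
    obtain ⟨α, hα, hy⟩ := hy
    refine ⟨c • α, by rw [Matrix.smul_vecMul, hα], ?_⟩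
    rw [map_smul, ← smul_sub]
    exact Submodule.smul_mem _ _ hy

/-- A symmetric tensor whose evaluation has lower degree vanishes. -/
theorem eq_zero_of_evalRow_mem (h : IsConsistent D.R D.Z D.T) {n : ℕ} {α : (Fin n → I) → ℂ}
    (hα : Matrix.vecMul α (symmetrizer D.R n) = α) (hmem : D.evalRow n α ∈ D.filtLT n) :
    α = 0 := by
  funext b
  -- This functional reads off the coefficient at b of a symmetric tensor of degree n and kills
  -- symmetric tensors of other degrees. By successive leading terms it kills everything of degree
  -- less than n.
  obtain ⟨f, hf⟩ := D.exists_dual_evalRow h (wordExt (Pi.single b 1))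
  have hlow : ∀ m ≤ n, ∀ y ∈ D.filtLT m, f y = 0 := by
    intro m
    induction m with
    | zero =>
      intro _ y hy
      rw [filtLT_zero, Submodule.mem_bot] at hy
      rw [hy, map_zero]
    | succ m ih =>
      intro hm y hy
      obtain ⟨β, hβ, hy⟩ := D.exists_evalRow_sub_mem h m hy
      have h1 := ih (by omega) _ hy
      rw [map_sub, hf m β hβ, sub_eq_zero] at h1
      rw [h1]
      refine Finset.sum_eq_zero fun a _ => ?_
      rw [wordExt_of_ne _ (by simp; omega), mul_zero]
  have h1 := hlow n le_rfl _ hmem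
  rw [hf n α hα] at h1
  simpa [wordExt_ofFn, Pi.single_apply] using h1

end Coefficients

/-! ### Bases of C^N. -/

namespace Coefficients

variable {A I : Type*} [Ring A] [Bialgebra ℂ A] [Fintype I] [DecidableEq I]
  (D : Coefficients A I)

/-- The row vector of a functional. -/
theorem dual_apply_eq {n : ℕ} (α : Module.Dual ℂ ((Fin n → I) → ℂ)) (v : (Fin n → I) → ℂ) :
    α v = ∑ a, α (Pi.single a 1) * v a := by
  conv_lhs => rw [pi_eq_sum_univ' v, map_sum]
  refine Finset.sum_congr rfl fun a _ => ?_
  rw [map_smul, smul_eq_mul, mul_comm]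

/-- A coordinate belonging to im S vanishes on im(1 - S), and this is invariance of its row under S.
-/
theorem vecMul_coord {n : ℕ} {S : Matrix (Fin n → I) (Fin n → I) ℂ}
    {e : Module.Basis (Fin S.rank ⊕ Fin (1 - S).rank) ℂ ((Fin n → I) → ℂ)} (he : IsAdapted e)
    (i : Fin S.rank) : Matrix.vecMul (fun a => e.coord (Sum.inl i) (Pi.single a 1)) S =
      fun a => e.coord (Sum.inl i) (Pi.single a 1) := by
  have hker : ∀ v, e.coord (Sum.inl i) ((1 - S).mulVec v) = 0 := by
    intro v
    have hv : (1 - S).mulVec v ∈ Submodule.span ℂ (Set.range (e ∘ Sum.inr)) := by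
      rw [he.2]
      exact ⟨v, rfl⟩
    generalize (1 - S).mulVec v = z at hv
    induction hv using Submodule.span_induction with
    | mem y hy =>
      obtain ⟨j, rfl⟩ := hy
      simp
    | zero => simp
    | add y z _ _ hy hz => rw [map_add, hy, hz, add_zero]
    | smul c y _ hy => rw [map_smul, hy, smul_zero]
  funext a
  have h1 := hker (Pi.single a 1)
  rw [Matrix.sub_mulVec, Matrix.one_mulVec, map_sub, sub_eq_zero] at h1
  rw [h1, dual_apply_eq]
  simp [Matrix.vecMul, dotProduct]

/-- An S-invariant row kills im(1 - S), so its expansion in the dual basis involves only the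
coordinates belonging to im S. -/
theorem row_eq_sum_coord {n : ℕ} {S : Matrix (Fin n → I) (Fin n → I) ℂ}
    {e : Module.Basis (Fin S.rank ⊕ Fin (1 - S).rank) ℂ ((Fin n → I) → ℂ)} (he : IsAdapted e)
    {α : (Fin n → I) → ℂ} (hα : Matrix.vecMul α S = α) :
    α = ∑ i, dotProduct α (e (Sum.inl i)) • fun a => e.coord (Sum.inl i) (Pi.single a 1) := by
  have hzero : ∀ j, dotProduct α (e (Sum.inr j)) = 0 := by
    intro j
    have hj : e (Sum.inr j) ∈ LinearMap.range (1 - S).mulVecLin := by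
      rw [← he.2]
      exact Submodule.subset_span ⟨j, rfl⟩
    obtain ⟨v, hv⟩ := hj
    rw [← hv, Matrix.mulVecLin_apply, Matrix.sub_mulVec, Matrix.one_mulVec, dotProduct_sub,
      Matrix.dotProduct_mulVec, hα, sub_self]
  funext a
  have h1 : dotProduct α (Pi.single a 1) = α a := by simp
  rw [← h1]
  conv_lhs => rw [← e.sum_repr (Pi.single a 1)]
  rw [dotProduct_sum, Fintype.sum_sum_type]
  simp only [dotProduct_smul, hzero, smul_zero, Finset.sum_const_zero, add_zero]
  simp [mul_comm]

variable {e : ∀ n, Module.Basis (Fin (symmetrizer D.R n).rank ⊕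
  Fin (1 - symmetrizer D.R n).rank) ℂ ((Fin n → I) → ℂ)}

/-- A dual family is obtained by prescribing, in degree n, the vectors of the basis of im S_n as
values on words and zero in the other degrees. -/
theorem linearIndependent_evalTensor (h : IsConsistent D.R D.Z D.T) (he : ∀ n, IsAdapted (e n))
    (N : ℕ) : LinearIndependent ℂ
      (fun i : (Σ n : Fin (N + 1), Fin (symmetrizer D.R n).rank) =>
        evalTensor D.x ((e i.1).coord (Sum.inl i.2))) := by
  choose f hf using fun i : (Σ n : Fin (N + 1), Fin (symmetrizer D.R n).rank) =>
    D.exists_dual_evalRow h (wordExt (e i.1 (Sum.inl i.2)))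
  have hval : ∀ i j : (Σ n : Fin (N + 1), Fin (symmetrizer D.R n).rank),
      f i (evalTensor D.x ((e j.1).coord (Sum.inl j.2))) = if i = j then 1 else 0 := by
    rintro ⟨m, i⟩ ⟨n, j⟩
    rw [evalTensor_eq, hf _ _ _ (vecMul_coord (he n) j)]
    by_cases hmn : m = n
    · subst hmn
      simp only [wordExt_ofFn]
      rw [← dual_apply_eq]
      simp [Finsupp.single_apply]
    · rw [if_neg (fun hij => hmn (congrArg Sigma.fst hij))]
      refine Finset.sum_eq_zero fun a _ => ?_
      rw [wordExt_of_ne _ (by simpa using fun h => hmn (Fin.ext h.symm)), mul_zero]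
  refine LinearIndependent.of_pairwise_dual_eq_zero_one _ f (fun i j hij => ?_) fun i => ?_
  · exact (hval i j).trans (if_neg hij)
  · exact (hval i i).trans (if_pos rfl)

theorem span_evalTensor (h : IsConsistent D.R D.Z D.T) (he : ∀ n, IsAdapted (e n)) (N : ℕ) :
    Submodule.span ℂ (Set.range
      (fun i : (Σ n : Fin (N + 1), Fin (symmetrizer D.R n).rank) =>
        evalTensor D.x ((e i.1).coord (Sum.inl i.2)))) = D.filtC N := by
  rw [filtC_eq]
  refine le_antisymm (Submodule.span_le.2 ?_) ?_
  · rintro _ ⟨⟨n, i⟩, rfl⟩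
    dsimp only
    rw [evalTensor_eq]
    exact D.filtLT_mono (by omega) (D.evalRow_mem n _)
  · have key : ∀ m ≤ N + 1, D.filtLT m ≤ Submodule.span ℂ (Set.range
        (fun i : (Σ n : Fin (N + 1), Fin (symmetrizer D.R n).rank) =>
          evalTensor D.x ((e i.1).coord (Sum.inl i.2)))) := by
      intro m
      induction m with
      | zero => intro _; rw [filtLT_zero]; exact bot_le
      | succ m ih =>
        intro hm y hy
        obtain ⟨α, hα, hy⟩ := D.exists_evalRow_sub_mem h m hy
        rw [← sub_add_cancel y (D.evalRow m α)]
        refine add_mem (ih (by omega) hy) ?_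
        rw [row_eq_sum_coord (he m) hα, map_sum]
        refine Submodule.sum_mem _ fun i _ => ?_
        rw [map_smul, ← evalTensor_eq]
        exact Submodule.smul_mem _ _ (Submodule.subset_span ⟨⟨⟨m, by omega⟩, i⟩, rfl⟩)
    exact key (N + 1) le_rfl

theorem finrank_filtC (h : IsConsistent D.R D.Z D.T) (N : ℕ) :
    Module.finrank ℂ (D.filtC N) =
      ∑ n ∈ Finset.range (N + 1), (symmetrizer D.R n).rank := by
  choose e he using fun n => exists_isAdapted (h.symmetrizer_mul_self n)
  rw [← D.span_evalTensor h he N, finrank_span_eq_card (D.linearIndependent_evalTensor h he N)]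
  simp [Finset.sum_range]

end Coefficients

end QuantumGroup

end

noncomputable section

namespace QuantumGroup

/-! ### Consistency of R, Z, T for an inhomogeneous quantum group. -/

namespace InhomogeneousDatum

variable {A I : Type*} [Ring A] [Bialgebra ℂ A] [Fintype I] [DecidableEq I]
  (D : InhomogeneousDatum A I)

omit [DecidableEq I] in
theorem sum_comm_three {M : Type*} [AddCommMonoid M] (g : I → I → I → M) :
    ∑ x, ∑ y, ∑ z, g x y z = ∑ z, ∑ y, ∑ x, g x y z := by
  rw [Finset.sum_comm]
  simp only [Finset.sum_comm (f := fun x z => g x _ z)]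
  rw [Finset.sum_comm]

theorem convol_Λ (ρ ρ' : Module.Dual ℂ A) (i j : I) :
    convol ρ ρ' (D.Λ i j) = ∑ k, ρ (D.Λ i k) * ρ' (D.Λ k j) := by
  simp [convol, D.comul_Λ]

theorem R_apply (i j s m : I) : D.R (i, j) (s, m) = D.f i m (D.Λ j s) := rfl

theorem Z_apply (i j m : I) : D.Z (i, j) m = D.η i (D.Λ j m) := rfl

theorem R_mul_ΛΛ (k l m n : I) :
    ∑ i, ∑ j, D.R (k, l) (i, j) • (D.Λ i m * D.Λ j n) =
      ∑ i, ∑ j, D.R (i, j) (m, n) • (D.Λ k i * D.Λ l j) := by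
  have h := congrFun (congrFun (show D.R.map (algebraMap ℂ A) * (D.Λ ⊗ₖ D.Λ) =
    (D.Λ ⊗ₖ D.Λ) * D.R.map (algebraMap ℂ A) from D.R_mem_Mor) (k, l)) (m, n)
  simp only [Matrix.mul_apply, Fintype.sum_prod_type, Matrix.map_apply,
    Matrix.kronecker_apply] at h
  simpa only [← Algebra.smul_def, ← Algebra.commutes] using h

/-- Apply f_{st} to R(Λ ⊗ Λ) = (Λ ⊗ Λ)R; multiplicativity of f turns products of entries of Λ into
products of entries of R. -/
theorem R_braid : R₁₂ D.R * R₂₃ D.R * R₁₂ D.R = R₂₃ D.R * R₁₂ D.R * R₂₃ D.R := by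
  ext ⟨s, k, l⟩ ⟨m, n, t⟩
  have h := congrArg (D.f s t) (D.R_mul_ΛΛ k l m n)
  simp only [map_sum, map_smul, D.f_mul, ← R_apply, smul_eq_mul] at h
  simp only [Matrix.mul_apply, Fintype.sum_prod_type, R₁₂_apply, R₂₃_apply]
  simp only [ite_mul, mul_ite, zero_mul, mul_zero, Finset.sum_ite_eq, Finset.sum_ite_eq',
    Finset.mem_univ, if_true, Finset.sum_ite_irrel, Finset.sum_const_zero]
  simp only [Finset.mul_sum] at h
  calc _ = ∑ x, ∑ y, ∑ i, D.R (x, y) (m, n) * (D.R (s, k) (x, i) * D.R (i, l) (y, t)) :=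
        Finset.sum_congr rfl fun x _ => Finset.sum_congr rfl fun y _ => by
          rw [Finset.sum_mul]
          exact Finset.sum_congr rfl fun i _ => mul_comm _ _
    _ = ∑ x, ∑ y, ∑ i, D.R (k, l) (x, y) * (D.R (s, x) (m, i) * D.R (i, y) (n, t)) := h.symm
    _ = ∑ i, ∑ y, ∑ x, D.R (k, l) (x, y) * (D.R (s, x) (m, i) * D.R (i, y) (n, t)) := by
        rw [sum_comm_three]
    _ = _ := Finset.sum_congr rfl fun x _ => Finset.sum_congr rfl fun y _ => by
          rw [Finset.sum_mul]
          exact Finset.sum_congr rfl fun i _ => (mul_assoc _ _ _).symm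

/-- The same intertwining relation, with η_s applied in place of f_{st}. -/
theorem R_mul_Z : R₂₃ D.R * (tensorOne D.Z + R₁₂ D.R * oneTensor D.Z) =
    (tensorOne D.Z + R₁₂ D.R * oneTensor D.Z) * D.R := by
  ext ⟨s, k, l⟩ ⟨m, n⟩
  have h := congrArg (D.η s) (D.R_mul_ΛΛ k l m n)
  simp only [map_sum, map_smul, D.η_mul, D.counit_Λ, ← R_apply, ← Z_apply, smul_eq_mul] at h
  simp only [Matrix.mul_apply, Matrix.add_apply, Fintype.sum_prod_type, R₁₂_apply, R₂₃_apply,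
    tensorOne_apply, oneTensor_apply]
  simp only [ite_mul, mul_ite, zero_mul, mul_zero, Finset.sum_ite_eq, Finset.sum_ite_eq',
    Finset.mem_univ, if_true, Finset.sum_ite_irrel, Finset.sum_const_zero]
  simp only [mul_ite, mul_one, mul_zero] at h
  exact h.trans (Finset.sum_congr rfl fun x _ => Finset.sum_congr rfl fun y _ => mul_comm _ _)

theorem F_eq : D.F = oneTensor D.Z * D.Z - tensorOne D.Z * D.Z + constOne D.T
    - R₂₃ D.R * (R₁₂ D.R * oneConst D.T) := by
  ext ⟨i, j, k⟩ m
  simp only [Coefficients.F, Matrix.of_apply, Coefficients.τ, LinearMap.sub_apply,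
    LinearMap.add_apply, LinearMap.sum_apply, LinearMap.smul_apply, convol_Λ, D.counit_Λ,
    ← R_apply, ← Z_apply, smul_eq_mul]
  simp only [Matrix.mul_apply, Matrix.add_apply, Matrix.sub_apply, Fintype.sum_prod_type,
    R₁₂_apply, R₂₃_apply, tensorOne_apply, oneTensor_apply, constOne_apply, oneConst_apply]
  simp only [ite_mul, mul_ite, zero_mul, mul_zero, Finset.sum_ite_eq, Finset.sum_ite_eq',
    Finset.mem_univ, if_true, Finset.sum_ite_irrel, Finset.sum_const_zero]
  simp only [mul_one, Finset.mul_sum]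
  congr 1
  rw [sum_comm_three]
  refine Finset.sum_congr rfl fun a _ => Finset.sum_congr rfl fun b _ =>
    Finset.sum_congr rfl fun c _ => ?_
  ring

theorem antisymm₃_mul_R₁₂ : antisymm₃ D.R * R₁₂ D.R = -antisymm₃ D.R := by
  have h : R₁₂ D.R * R₁₂ D.R = 1 := by rw [← R₁₂_mul, D.R_sq, R₁₂_one]
  rw [antisymm₃]
  generalize R₁₂ D.R = a at *
  generalize R₂₃ D.R = b
  simp only [sub_mul, add_mul, one_mul, mul_assoc, h, mul_one]
  abel

theorem antisymm₃_mul_R₂₃ : antisymm₃ D.R * R₂₃ D.R = -antisymm₃ D.R := by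
  have h : R₂₃ D.R * R₂₃ D.R = 1 := by rw [← R₂₃_mul, D.R_sq, R₂₃_one]
  have hb := D.R_braid
  rw [antisymm₃]
  generalize R₁₂ D.R = a at *
  generalize R₂₃ D.R = b at *
  have h' : a * b * a * b = b * a := by rw [hb, mul_assoc, h, mul_one]
  simp only [sub_mul, add_mul, one_mul, h']
  rw [mul_assoc a b b, h, mul_one, ← hb]
  abel

/-- Since A₃R₁₂ = A₃R₂₃ = -A₃, the factors R on the left of the other terms reduce to signs. Thus
`R_mul_Z` becomes the condition `quad` and A₃F = 0 becomes `lin`; `const` is where the absence of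
invariant cubic tensors enters. -/
theorem isConsistent
    (hMor : Mor (1 : Matrix Unit Unit A) (D.Λ ⊗ₖ (D.Λ ⊗ₖ D.Λ)) = ⊥) :
    IsConsistent D.R D.Z D.T where
  sq := D.R_sq
  braid := D.R_braid
  quad := by
    have h := congrArg (antisymm₃ D.R * ·) D.R_mul_Z
    simp only [Matrix.mul_add, Matrix.add_mul, ← Matrix.mul_assoc, D.antisymm₃_mul_R₁₂,
      D.antisymm₃_mul_R₂₃, Matrix.neg_mul, neg_neg] at h
    rw [Matrix.mul_sub, Matrix.sub_mul, neg_sub]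
    rw [← sub_eq_add_neg] at h
    rw [← h]
    abel
  lin := by
    have h := D.antisymm_F
    rw [F_eq, Matrix.mul_sub, ← Matrix.mul_assoc, ← Matrix.mul_assoc, D.antisymm₃_mul_R₂₃,
      Matrix.neg_mul, D.antisymm₃_mul_R₁₂, neg_neg, ← Matrix.mul_sub] at h
    exact h
  const := by
    have h := D.antisymm_ZT
    rwa [hMor, Submodule.mem_bot] at h

end InhomogeneousDatum

end QuantumGroup

end

noncomputable section

namespace QuantumGroup

/-! ### The coaction Ψ. -/

namespace InhomogeneousDatum

variable {A I : Type*} [Ring A] [Bialgebra ℂ A] [Fintype I] [DecidableEq I]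
  (D : InhomogeneousDatum A I)

/-- The relations of `C` in matrix form. -/
theorem quadC_iff {E : Type*} [Ring E] [Algebra ℂ E] (y : I → E) :
    (∀ b, ∑ a : I × I, (D.R - 1) b a • (y a.1 * y a.2 - ∑ m, D.Z a m • y m
      + algebraMap ℂ E (D.T a ())) = 0) ↔
    (D.R.map (algebraMap ℂ E) - 1).mulVec ((fun a => y a.1 * y a.2)
      - (D.Z.map (algebraMap ℂ E)).mulVec y
      + ((fun a => algebraMap ℂ E (D.T a ()))
        - (0 : Matrix (I × I) (I × I) E).mulVec fun a => algebraMap ℂ E (D.T a ()))) = 0 := by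
  have e : D.R.map (algebraMap ℂ E) - 1 = (D.R - 1).map (algebraMap ℂ E) := by
    rw [Matrix.map_sub _ (by simp), Matrix.map_one _ (by simp) (by simp)]
  rw [e, funext_iff]
  refine forall_congr' fun b => ?_
  simp only [Matrix.mulVec, dotProduct, Matrix.map_apply, Pi.add_apply, Pi.sub_apply,
    Matrix.zero_apply, zero_mul, Finset.sum_const_zero, sub_zero, Pi.zero_apply,
    ← Algebra.smul_def]

/-- `Λ_{ij} ⊗ x_j + p_i ⊗ I` -/
def coactX (i : I) : D.B ⊗[ℂ] D.C := ∑ j, D.ι (D.Λ i j) ⊗ₜ[ℂ] D.x j + D.p i ⊗ₜ[ℂ] (1 : D.C)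

theorem coactX_quad (b : I × I) : ∑ a : I × I, (D.R - 1) b a •
    (D.coactX a.1 * D.coactX a.2 - ∑ m, D.Z a m • D.coactX m
      + algebraMap ℂ (D.B ⊗[ℂ] D.C) (D.T a ())) = 0 := by
  revert b
  rw [quadC_iff]
  let gl : A →ₐ[ℂ] D.B ⊗[ℂ] D.C := Algebra.TensorProduct.includeLeft.comp D.ι
  have h₁ := (D.quad_iff gl (fun i => D.p i ⊗ₜ[ℂ] 1)).1 fun k l => by
    have h := congrArg (Algebra.TensorProduct.includeLeft (R := ℂ) (S := ℂ) (A := D.B) (B := D.C))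
      (D.quad_eq k l)
    simp only [map_sum, map_smul, map_add, map_sub, map_mul, map_zero] at h ⊢
    exact h
  have h₂ := (D.quadC_iff (fun i => (1 : D.B) ⊗ₜ[ℂ] D.x i)).1 fun b => by
    have h := congrArg (Algebra.TensorProduct.includeRight (R := ℂ) (A := D.B) (B := D.C))
      (D.quadC_eq b)
    simp only [map_sum, map_smul, map_add, map_sub, map_mul, map_zero, AlgHom.commutes] at h ⊢
    exact h
  set L : Matrix I I (D.B ⊗[ℂ] D.C) := Matrix.of fun i j => D.ι (D.Λ i j) ⊗ₜ[ℂ] 1 with hLdef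
  have hLL : (Matrix.of fun a b : I × I => gl (D.Λ a.1 b.1 * D.Λ a.2 b.2)) = L ⊗ₖ L := by
    ext a b
    simp [gl, L]
  have hP : D.coactX = L.mulVec (fun i => 1 ⊗ₜ[ℂ] D.x i) + fun i => D.p i ⊗ₜ[ℂ] 1 := by
    ext i
    simp [coactX, L, Matrix.mulVec, dotProduct]
  rw [hLL] at h₁
  -- In `quad_aux` the second set of relations has constant term T - L'T; the relations of C are the
  -- case L' = 0, and (L ⊗ L)·0 = 0 is the matrix of the sum.
  rw [← Matrix.mul_zero (L ⊗ₖ L), hP]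
  refine quad_aux _ _ _ L _ (fun i => D.p i ⊗ₜ[ℂ] 1) (fun i => 1 ⊗ₜ[ℂ] D.x i) ?_ ?_ ?_ ?_ ?_ h₁ h₂
  · rw [← Matrix.map_mul, D.R_sq, Matrix.map_one _ (map_zero _) (map_one _)]
  · have h : D.R.map (algebraMap ℂ A) * (D.Λ ⊗ₖ D.Λ) = (D.Λ ⊗ₖ D.Λ) * D.R.map (algebraMap ℂ A) :=
      D.R_mem_Mor
    have h' := congrArg (fun X => X.map gl) h
    have e1 : (D.R.map (algebraMap ℂ A)).map gl = D.R.map (algebraMap ℂ (D.B ⊗[ℂ] D.C)) := by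
      ext a b
      simp only [Matrix.map_apply, AlgHom.commutes]
    have e2 : (D.Λ ⊗ₖ D.Λ).map gl = L ⊗ₖ L := by
      rw [← hLL]
      rfl
    simp only [Matrix.map_mul, e1, e2] at h'
    exact h'
  · intro i j k
    simp [L]
  · intro i j
    simp
  · ext ⟨i, j⟩ b
    have h := congrArg (Algebra.TensorProduct.includeLeft (R := ℂ) (S := ℂ) (A := D.B) (B := D.C))
      (D.p_mul_ι i (D.Λ j b))
    simp only [actL_Λ, actR_Λ, map_mul, map_add, map_sub, map_sum, map_smul,
      Algebra.TensorProduct.includeLeft_apply, Finset.sum_mul, Finset.mul_sum] at h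
    simp only [Matrix.of_apply, Matrix.sub_apply, Matrix.add_apply, Matrix.mul_apply,
      Matrix.map_apply, Matrix.kronecker_apply, Fintype.sum_prod_type, L, Coefficients.R,
      Coefficients.Z]
    rw [h, Finset.sum_comm]
    simp only [Algebra.algebraMap_eq_smul_one, smul_mul_assoc, one_mul, mul_smul_comm, mul_one]
    abel

/-- The coaction `Ψ` of `B` on `C`. -/
def coact : D.C →ₐ[ℂ] D.B ⊗[ℂ] D.C := D.liftC D.coactX D.coactX_quad

theorem coact_x (i : I) : D.coact (D.x i) =
    ∑ j, D.ι (D.Λ i j) ⊗ₜ[ℂ] D.x j + D.p i ⊗ₜ[ℂ] (1 : D.C) :=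
  D.liftC_x _ _ i

theorem counit_coact (y : D.C) : TensorProduct.lid ℂ D.C
    ((Coalgebra.counit (R := ℂ) (A := D.B)).rTensor D.C (D.coact y)) = y := by
  have h : (Algebra.TensorProduct.lid ℂ D.C).toAlgHom.comp
      ((Algebra.TensorProduct.map D.counitB (AlgHom.id ℂ D.C)).comp D.coact) =
      AlgHom.id ℂ D.C := by
    refine D.algHomC_ext fun i => ?_
    simp [coact_x, counitB_ι, counitB_p, D.counit_Λ, ite_smul]
  exact congrArg (fun φ : D.C →ₐ[ℂ] D.C => φ y) h

theorem coact_coassoc (y : D.C) : TensorProduct.assoc ℂ D.B D.B D.C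
      ((Coalgebra.comul (R := ℂ) (A := D.B)).rTensor D.C (D.coact y)) =
    D.coact.toLinearMap.lTensor D.B (D.coact y) := by
  have h : (Algebra.TensorProduct.assoc ℂ ℂ ℂ D.B D.B D.C).toAlgHom.comp
      ((Algebra.TensorProduct.map D.comulB (AlgHom.id ℂ D.C)).comp D.coact) =
      (Algebra.TensorProduct.map (AlgHom.id ℂ D.B) D.coact).comp D.coact := by
    refine D.algHomC_ext fun i => ?_
    simp only [AlgHom.comp_apply, coact_x, map_add,
      map_sum, Algebra.TensorProduct.map_tmul, comulB_ι, comulB_p, D.comul_Λ, AlgHom.id_apply,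
      TensorProduct.tmul_add, TensorProduct.add_tmul, TensorProduct.sum_tmul,
      TensorProduct.tmul_sum, Finset.sum_add_distrib, map_one,
      Algebra.TensorProduct.one_def]
    rw [Finset.sum_comm]
    abel
  exact congrArg (fun φ : D.C →ₐ[ℂ] D.B ⊗[ℂ] (D.B ⊗[ℂ] D.C) => φ y) h

end InhomogeneousDatum

end QuantumGroup

end

noncomputable section

namespace QuantumGroup

/-! ### Left and right actions of functionals on A. -/

section Convolution

variable {A : Type*} [Ring A] [Bialgebra ℂ A]

theorem apply_actL (ρ ρ' : Module.Dual ℂ A) (a : A) : ρ (actL ρ' a) = convol ρ' ρ a := by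
  simp only [actL, convol, LinearMap.comp_apply]
  induction Coalgebra.comul (R := ℂ) a using TensorProduct.induction_on with
  | zero => simp
  | tmul x y => simp
  | add x y hx hy => simp only [map_add, hx, hy]

theorem apply_actR (ρ ρ' : Module.Dual ℂ A) (a : A) : ρ (actR ρ' a) = convol ρ ρ' a := by
  simp only [actR, convol, LinearMap.comp_apply]
  induction Coalgebra.comul (R := ℂ) a using TensorProduct.induction_on with
  | zero => simp
  | tmul x y => simp [mul_comm]
  | add x y hx hy => simp only [map_add, hx, hy]

/-- The order is reversed here and kept in `actR_actR`. For this reason the right part of the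
representation of B will need the opposite algebra of C. -/
theorem actL_actL (ρ ρ' : Module.Dual ℂ A) (a : A) :
    actL ρ (actL ρ' a) = actL (convol ρ' ρ) a := by
  have h : ∀ t : A ⊗[ℂ] A, TensorProduct.lid ℂ A (ρ.rTensor A ((actL ρ').rTensor A t)) =
      TensorProduct.lid ℂ A ((convol ρ' ρ).rTensor A t) := by
    intro t
    induction t using TensorProduct.induction_on with
    | zero => simp
    | tmul x y => simp [apply_actL]
    | add x y hx hy => simp only [map_add, hx, hy]
  change TensorProduct.lid ℂ A (ρ.rTensor A (Coalgebra.comul (actL ρ' a))) = _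
  rw [comul_actL, h]
  rfl

theorem actR_actR (ρ ρ' : Module.Dual ℂ A) (a : A) :
    actR ρ (actR ρ' a) = actR (convol ρ ρ') a := by
  have h : ∀ t : A ⊗[ℂ] A, TensorProduct.rid ℂ A (ρ.lTensor A ((actR ρ').lTensor A t)) =
      TensorProduct.rid ℂ A ((convol ρ ρ').lTensor A t) := by
    intro t
    induction t using TensorProduct.induction_on with
    | zero => simp
    | tmul x y => simp [apply_actR]
    | add x y hx hy => simp only [map_add, hx, hy]
  change TensorProduct.rid ℂ A (ρ.lTensor A (Coalgebra.comul (actR ρ' a))) = _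
  rw [comul_actR, h]
  rfl

theorem actL_actR (ρ ρ' : Module.Dual ℂ A) (a : A) : actL ρ (actR ρ' a) = actR ρ' (actL ρ a) := by
  have h : ∀ t : A ⊗[ℂ] A, TensorProduct.lid ℂ A (ρ.rTensor A ((actR ρ').lTensor A t)) =
      actR ρ' (TensorProduct.lid ℂ A (ρ.rTensor A t)) := by
    intro t
    induction t using TensorProduct.induction_on with
    | zero => simp
    | tmul x y => simp
    | add x y hx hy => simp only [map_add, hx, hy]
  change TensorProduct.lid ℂ A (ρ.rTensor A (Coalgebra.comul (actR ρ' a))) = _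
  rw [comul_actR, h]
  rfl

theorem actL_counit (a : A) : actL (Coalgebra.counit (R := ℂ)) a = a := by
  simp [actL]

theorem actR_counit (a : A) : actR (Coalgebra.counit (R := ℂ)) a = a := by
  simp [actR]

theorem counit_convol (ρ : Module.Dual ℂ A) : convol Coalgebra.counit ρ = ρ := by
  ext a
  rw [← apply_actR, counit_actR]

/-- The action `ρ ↦ (a ↦ a * ρ)`. -/
def actLHom : Module.Dual ℂ A →ₗ[ℂ] Module.End ℂ A where
  toFun := actL
  map_add' ρ ρ' := by ext a; simp [actL, LinearMap.rTensor_add]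
  map_smul' c ρ := by ext a; simp [actL, LinearMap.rTensor_smul]

/-- The action `ρ ↦ (a ↦ ρ * a)`. -/
def actRHom : Module.Dual ℂ A →ₗ[ℂ] Module.End ℂ A where
  toFun := actR
  map_add' ρ ρ' := by ext a; simp [actR, LinearMap.lTensor_add]
  map_smul' c ρ := by ext a; simp [actR, LinearMap.lTensor_smul]

theorem actL_mul {ι : Type*} [Fintype ι] {ρ : Module.Dual ℂ A} {σ σ' : ι → Module.Dual ℂ A}
    (h : ∀ a b, ρ (a * b) = ∑ i, σ i a * σ' i b) (a b : A) :
    actL ρ (a * b) = ∑ i, actL (σ i) a * actL (σ' i) b := by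
  have key : ∀ s t : A ⊗[ℂ] A, TensorProduct.lid ℂ A (ρ.rTensor A (s * t)) =
      ∑ i, TensorProduct.lid ℂ A ((σ i).rTensor A s) *
        TensorProduct.lid ℂ A ((σ' i).rTensor A t) := by
    intro s t
    induction s using TensorProduct.induction_on with
    | zero => simp
    | add x y hx hy => simp only [add_mul, map_add, hx, hy, Finset.sum_add_distrib]
    | tmul x y =>
      induction t using TensorProduct.induction_on with
      | zero => simp
      | add x y hx hy => simp only [mul_add, map_add, hx, hy, Finset.sum_add_distrib]
      | tmul z w => simp [h, Finset.sum_smul, smul_smul, mul_comm]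
  simp only [actL, LinearMap.comp_apply, Bialgebra.comul_mul]
  exact key _ _

theorem actR_mul {ι : Type*} [Fintype ι] {ρ : Module.Dual ℂ A} {σ σ' : ι → Module.Dual ℂ A}
    (h : ∀ a b, ρ (a * b) = ∑ i, σ i a * σ' i b) (a b : A) :
    actR ρ (a * b) = ∑ i, actR (σ i) a * actR (σ' i) b := by
  have key : ∀ s t : A ⊗[ℂ] A, TensorProduct.rid ℂ A (ρ.lTensor A (s * t)) =
      ∑ i, TensorProduct.rid ℂ A ((σ i).lTensor A s) *
        TensorProduct.rid ℂ A ((σ' i).lTensor A t) := by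
    intro s t
    induction s using TensorProduct.induction_on with
    | zero => simp
    | add x y hx hy => simp only [add_mul, map_add, hx, hy, Finset.sum_add_distrib]
    | tmul x y =>
      induction t using TensorProduct.induction_on with
      | zero => simp
      | add x y hx hy => simp only [mul_add, map_add, hx, hy, Finset.sum_add_distrib]
      | tmul z w => simp [h, Finset.sum_smul, smul_smul, mul_comm]
  simp only [actR, LinearMap.comp_apply, Bialgebra.comul_mul]
  exact key _ _

end Convolution

/-! ### Quadratic relations for a solution twisted by f and η. -/

namespace InhomogeneousDatum

variable {A I : Type*} [Ring A] [Bialgebra ℂ A] [Fintype I] [DecidableEq I]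
  (D : InhomogeneousDatum A I)

/-- Apply f_{uv} to Λ_{st}(f_{tr} * a) = (a * f_{st})Λ_{tr}; applying η_u instead gives
`R_convol_η`. -/
theorem R_convol_f (u s r v : I) :
    ∑ t, ∑ w, D.R (u, s) (t, w) • convol (D.f w v) (D.f t r) =
      ∑ t, ∑ w, D.R (w, t) (r, v) • convol (D.f s t) (D.f u w) := by
  ext a
  have h := congrArg (D.f u v) (D.Λ_mul_f s r a)
  simp only [map_sum, D.f_mul, ← R_apply, apply_actR, apply_actL] at h
  simp only [LinearMap.sum_apply, LinearMap.smul_apply, smul_eq_mul]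
  rw [h]
  exact Finset.sum_congr rfl fun _ _ => Finset.sum_congr rfl fun _ _ => mul_comm _ _

theorem R_convol_η (u s r : I) :
    ∑ t, D.Z (u, s) t • D.f t r + ∑ t, ∑ w, D.R (u, s) (t, w) • convol (D.η w) (D.f t r) =
      convol (D.f s r) (D.η u) + ∑ t, ∑ w, D.Z (w, t) r • convol (D.f s t) (D.f u w) := by
  ext a
  have h := congrArg (D.η u) (D.Λ_mul_f s r a)
  simp only [map_sum, D.η_mul, ← R_apply, ← Z_apply, apply_actR, apply_actL, counit_convol,
    Finset.sum_add_distrib, D.counit_Λ, mul_ite, mul_one, mul_zero, Finset.sum_ite_eq',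
    Finset.mem_univ, if_true] at h
  simp only [LinearMap.sum_apply, LinearMap.smul_apply, LinearMap.add_apply, smul_eq_mul]
  rw [h]
  congr 1
  exact Finset.sum_congr rfl fun _ _ => Finset.sum_congr rfl fun _ _ => mul_comm _ _

omit [DecidableEq I] in
-- Same cancellation as in `quad_aux`, but with a defect v: the constants (L ⊗ L)T of the two
-- summands cancel, and the defect of P is that of the sum.
theorem quad_add {M : Type*} [Ring M] [DecidableEq I] (Rm : Matrix (I × I) (I × I) M)
    (Zm : Matrix (I × I) I M) (Tm : I × I → M) (L : Matrix I I M) (P P' : I → M) (v : I × I → M)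
    (hR : Rm * Rm = 1) (hL : Rm * (L ⊗ₖ L) = (L ⊗ₖ L) * Rm)
    (hLP : ∀ i j k, P' i * L j k = L j k * P' i) (hPP : ∀ i j, P' i * P j = P j * P' i)
    (hK : (Matrix.of fun a k => P a.1 * L a.2 k : Matrix (I × I) I M) =
      Rm * (Matrix.of fun a k => L a.1 k * P a.2 : Matrix (I × I) I M) + Zm * L - (L ⊗ₖ L) * Zm)
    (h₁ : (Rm - 1).mulVec ((fun a => P a.1 * P a.2) - Zm.mulVec P + (Tm - (L ⊗ₖ L).mulVec Tm)) = v)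
    (h₂ : (Rm - 1).mulVec ((fun a => P' a.1 * P' a.2) - Zm.mulVec P' + Tm) = 0) :
    (Rm - 1).mulVec ((fun a => (L.mulVec P' + P) a.1 * (L.mulVec P' + P) a.2)
      - Zm.mulVec (L.mulVec P' + P) + Tm) = v := by
  set N : Matrix (I × I) I M := Matrix.of fun a k => L a.1 k * P a.2 with hN
  set K : Matrix (I × I) I M := Matrix.of fun a k => P a.1 * L a.2 k with hKdef
  have e : (fun a : I × I => (L.mulVec P' + P) a.1 * (L.mulVec P' + P) a.2) =
      (L ⊗ₖ L).mulVec (fun a => P' a.1 * P' a.2) + N.mulVec P' + K.mulVec P'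
        + fun a => P a.1 * P a.2 := by
    ext ⟨i, j⟩
    simp only [Pi.add_apply, Matrix.mulVec, dotProduct, hN, hKdef, Matrix.of_apply,
      Fintype.sum_prod_type, Matrix.kronecker_apply, add_mul, mul_add, Finset.sum_mul,
      Finset.mul_sum]
    have e1 : ∀ x y, L i x * P' x * (L j y * P' y) = L i x * L j y * (P' x * P' y) := by
      intro x y
      rw [mul_assoc, ← mul_assoc (P' x), hLP, mul_assoc, mul_assoc]
    have e2 : ∀ x, L i x * P' x * P j = L i x * P j * P' x := by
      intro x
      rw [mul_assoc, hPP, mul_assoc]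
    simp only [e1, e2, Finset.sum_add_distrib]
    rw [Finset.sum_comm]
    simp only [mul_assoc]
    abel
  have hc : (Rm - 1) * (L ⊗ₖ L) = (L ⊗ₖ L) * (Rm - 1) := by
    rw [sub_mul, mul_sub, hL, one_mul, mul_one]
  have hcK : (Rm - 1) * K = - ((Rm - 1) * N) + (Rm - 1) * (Zm * L)
      - (L ⊗ₖ L) * ((Rm - 1) * Zm) := by
    have h3 : (Rm - 1) * Rm = - (Rm - 1) := by rw [sub_mul, hR, one_mul, neg_sub]
    rw [hK, Matrix.mul_sub, Matrix.mul_add, ← Matrix.mul_assoc _ (L ⊗ₖ L), hc,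
      ← Matrix.mul_assoc _ Rm, h3, Matrix.neg_mul, Matrix.mul_assoc (L ⊗ₖ L)]
  rw [e]
  generalize Rm - 1 = c at *
  generalize L ⊗ₖ L = G at *
  have h₃ := congrArg G.mulVec h₂
  simp only [Matrix.mulVec_add, Matrix.mulVec_sub, Matrix.mulVec_mulVec, hcK, Matrix.sub_mulVec,
    Matrix.add_mulVec, Matrix.neg_mulVec, Matrix.mulVec_zero, ← Matrix.mul_assoc, hc] at h₁ h₃ ⊢
  have h₄ := congrArg₂ (· + ·) h₁ h₃
  simp only [add_zero] at h₄
  rw [← h₄]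
  abel

/-- The quadratic expression `(R - 1) (y ⊗ y - Z y + T)`. -/
def quadExpr {E : Type*} [Ring E] [Algebra ℂ E] (y : I → E) (b : I × I) : E :=
  ∑ a : I × I, (D.R - 1) b a • (y a.1 * y a.2 - ∑ m, D.Z a m • y m + algebraMap ℂ E (D.T a ()))

theorem quadExpr_eq {E : Type*} [Ring E] [Algebra ℂ E] (y : I → E) :
    D.quadExpr y = (D.R.map (algebraMap ℂ E) - 1).mulVec ((fun a => y a.1 * y a.2)
      - (D.Z.map (algebraMap ℂ E)).mulVec y + (fun a => algebraMap ℂ E (D.T a ()))) := by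
  have e : D.R.map (algebraMap ℂ E) - 1 = (D.R - 1).map (algebraMap ℂ E) := by
    rw [Matrix.map_sub _ (by simp), Matrix.map_one _ (by simp) (by simp)]
  rw [e]
  funext b
  simp only [quadExpr, Matrix.mulVec, dotProduct, Matrix.map_apply, Pi.add_apply, Pi.sub_apply,
    ← Algebra.smul_def]

/-- `∑_t f_{st} X_t + η_s`, for an action of the functionals on `A`. -/
def twisted {W : Type*} [Ring W] [Algebra ℂ W] (act : Module.Dual ℂ A →ₗ[ℂ] W) (X : I → W)
    (s : I) : W :=
  ∑ t, act (D.f s t) * X t + act (D.η s)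

/-- The twisted family is a sum of L = act(f) applied to X and of P = act(η). As X has no defect,
the defect is that of P alone, and the definition of τ is made so that this is act(τ^{kl}). The
convolution identities for f and η are the commutation rules that `quad_add` asks for. -/
theorem quadExpr_twisted {W : Type*} [Ring W] [Algebra ℂ W] (act : Module.Dual ℂ A →ₗ[ℂ] W)
    (X : I → W) (hone : act Coalgebra.counit = 1)
    (hmul : ∀ ρ ρ', act ρ * act ρ' = act (convol ρ' ρ))
    (hX : ∀ i ρ, X i * act ρ = act ρ * X i) (hquad : ∀ b, D.quadExpr X b = 0) (b : I × I) :
    D.quadExpr (D.twisted act X) b = act (D.τ' b.1 b.2) := by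
  set L : Matrix I I W := Matrix.of fun i j => act (D.f i j) with hL
  set P : I → W := fun i => act (D.η i) with hP
  have hq : D.twisted act X = L.mulVec X + P := by
    ext i
    simp [twisted, L, P, Matrix.mulVec, dotProduct]
  have hkron : ∀ k l m n, (L ⊗ₖ L) (k, l) (m, n) = act (convol (D.f l n) (D.f k m)) :=
    fun k l m n => hmul _ _
  revert b
  rw [← funext_iff, quadExpr_eq, hq]
  refine quad_add _ _ _ L P X _ ?_ ?_ (fun i j k => hX _ _) (fun i j => hX _ _) ?_ ?_ ?_
  · rw [← Matrix.map_mul, D.R_sq, Matrix.map_one _ (map_zero _) (map_one _)]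
  · ext ⟨u, s⟩ ⟨r, v⟩
    have h := congrArg act (D.R_convol_f u s r v)
    simp only [map_sum, map_smul] at h
    simp only [Matrix.mul_apply, Fintype.sum_prod_type, hkron, Matrix.map_apply]
    simp only [← Algebra.smul_def, ← Algebra.commutes]
    rw [h, Finset.sum_comm]
  · ext ⟨u, s⟩ r
    have h := congrArg act (D.R_convol_η u s r)
    simp only [map_sum, map_smul, map_add] at h
    simp only [Matrix.of_apply, Matrix.sub_apply, Matrix.add_apply, Matrix.mul_apply,
      Fintype.sum_prod_type, hkron, Matrix.map_apply, L, P, hmul]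
    simp only [← Algebra.smul_def, ← Algebra.commutes]
    rw [eq_sub_iff_add_eq, add_comm (∑ x, ∑ y, D.R (u, s) (x, y) • _), h,
      Finset.sum_comm (γ := I) (f := fun x y => D.Z (x, y) r • _)]
  · have e : D.R.map (algebraMap ℂ W) - 1 = (D.R - 1).map (algebraMap ℂ W) := by
      rw [Matrix.map_sub _ (by simp), Matrix.map_one _ (by simp) (by simp)]
    rw [e]
    ext ⟨k, l⟩
    simp only [Matrix.mulVec, dotProduct, Fintype.sum_prod_type, Matrix.map_apply, Pi.add_apply,
      Pi.sub_apply, hkron, Coefficients.τ', map_sum, map_smul, ← Algebra.smul_def]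
    refine Finset.sum_congr rfl fun i _ => Finset.sum_congr rfl fun j _ => ?_
    simp only [P, hmul, Coefficients.τ, map_sub, map_add, map_sum, map_smul, hone,
      Algebra.algebraMap_eq_smul_one, mul_smul_comm, mul_one]
    rw [add_sub_assoc]
    rfl
  · rw [← quadExpr_eq]
    exact funext hquad

end InhomogeneousDatum

end QuantumGroup

end

noncomputable section

namespace QuantumGroup

/-! ### Solutions of the relations of B from a left and a right part. -/

namespace InhomogeneousDatum

variable {A I : Type*} [Ring A] [Bialgebra ℂ A] [Fintype I] [DecidableEq I]
  (D : InhomogeneousDatum A I)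

section Combination

variable {W : Type*} [Ring W] [Algebra ℂ W] (g : A →ₐ[ℂ] W) (P y : I → W)

/-- `P_s - Λ_{st} y_t` -/
def combination (s : I) : W := P s - ∑ t, g (D.Λ s t) * y t

variable {g P y}
  (hP : ∀ s a, P s * g a = ∑ t, g (actL (D.f s t) a) * P t + g (actL (D.η s) a))
  (hy : ∀ s a, y s * g a = ∑ t, g (actR (D.f s t) a) * y t + g (actR (D.η s) a))

include hP hy

/-- Moving a through Λ_{st} y_t produces Λ_{st}(f_{tr} * a), and the exchange rule rewrites this as
(a * f_{st})Λ_{tr}, the coefficient that the left part carries. -/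
theorem combination_mul (s : I) (a : A) : D.combination g P y s * g a =
    ∑ t, g (actL (D.f s t) a) * D.combination g P y t
      + g (actL (D.η s) a - ∑ t, D.Λ s t * actR (D.η t) a) := by
  have h : ∀ r, ∑ t, g (D.Λ s t) * g (actR (D.f t r) a) =
      ∑ t, g (actL (D.f s t) a) * g (D.Λ t r) := fun r => by
    simpa only [map_sum, map_mul] using congrArg g (D.Λ_mul_f s r a)
  have h' : ∑ t, ∑ r, g (D.Λ s t) * g (actR (D.f t r) a) * y r =
      ∑ t, ∑ r, g (actL (D.f s t) a) * g (D.Λ t r) * y r := by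
    rw [Finset.sum_comm, Finset.sum_comm (γ := I) (f := fun t r => _ * g (D.Λ t r) * y r)]
    simp only [← Finset.sum_mul, h]
  simp only [combination, sub_mul, mul_sub, Finset.sum_mul, mul_assoc, hP, hy, mul_add,
    Finset.mul_sum, Finset.sum_add_distrib, Finset.sum_sub_distrib, map_sub, map_sum, map_mul]
  simp only [← mul_assoc, h']
  abel

/-- After applying R - 1, the mixed terms drop out because (R - 1)(R + 1) = 0. The terms in y⊗y
carry a factor R, and (R - 1)R = -(R - 1). What remains is the defect of P minus (Λ ⊗ Λ) times the
defect of y, and `hlr` says that this vanishes. -/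
theorem combination_quad (hPy : ∀ s t, P s * y t = y t * P s) {l r : I × I → W}
    (hl : ∀ b, D.quadExpr P b = l b)
    (hr : ∀ b, ∑ a : I × I, (D.R - 1) b a •
      (y a.2 * y a.1 - ∑ m, D.Z a m • y m + algebraMap ℂ W (D.T a ())) = r b)
    (hlr : ∀ k l', ∑ i, ∑ j, g (D.Λ k i * D.Λ l' j) * r (i, j) = l (k, l')) (k l' : I) :
    ∑ i, ∑ j, (D.R - 1) (k, l') (i, j) • (D.combination g P y i * D.combination g P y j
      - ∑ s, D.Z (i, j) s • D.combination g P y s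
      + g (D.T (i, j) () • (1 : A) - ∑ m, ∑ n, D.T (m, n) () • (D.Λ i m * D.Λ j n))) = 0 := by
  set L : Matrix I I W := D.Λ.map g with hL
  set Rm : Matrix (I × I) (I × I) W := D.R.map (algebraMap ℂ W) with hRm
  set Zm : Matrix (I × I) I W := D.Z.map (algebraMap ℂ W) with hZm
  set Tm : I × I → W := fun a => algebraMap ℂ W (D.T a ()) with hTm
  set N : Matrix (I × I) I W := Matrix.of fun a k => L a.1 k * P a.2 with hN
  set Y : I × I → W := fun a => y a.2 * y a.1 with hY
  have e : Rm - 1 = (D.R - 1).map (algebraMap ℂ W) := by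
    rw [Matrix.map_sub _ (by simp), Matrix.map_one _ (by simp) (by simp)]
  have hc : (Rm - 1) * (L ⊗ₖ L) = (L ⊗ₖ L) * (Rm - 1) := by
    have h := congrArg (fun X => X.map g) (show D.R.map (algebraMap ℂ A) * (D.Λ ⊗ₖ D.Λ) =
      (D.Λ ⊗ₖ D.Λ) * D.R.map (algebraMap ℂ A) from D.R_mem_Mor)
    have e1 : (D.R.map (algebraMap ℂ A)).map g = Rm := by
      ext a b
      simp only [Matrix.map_apply, AlgHom.commutes, hRm]
    have e2 : (D.Λ ⊗ₖ D.Λ).map g = L ⊗ₖ L := by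
      ext a b
      simp [L]
    simp only [Matrix.map_mul, e1, e2] at h
    rw [sub_mul, mul_sub, h, one_mul, mul_one]
  have hRR : (Rm - 1) * Rm = - (Rm - 1) := by
    rw [sub_mul, hRm, ← Matrix.map_mul, D.R_sq, Matrix.map_one _ (map_zero _) (map_one _), one_mul,
      neg_sub]
  have hPv : (Rm - 1).mulVec ((fun a => P a.1 * P a.2) - Zm.mulVec P + Tm) = l := by
    rw [← quadExpr_eq]
    exact funext hl
  have hyv : (Rm - 1).mulVec (Y - Zm.mulVec y + Tm) = r := by
    rw [e, ← funext hr]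
    funext b
    simp only [Matrix.mulVec, dotProduct, Matrix.map_apply, Pi.add_apply, Pi.sub_apply, Y, Tm, Zm,
      ← Algebra.smul_def]
  have hlr' : (L ⊗ₖ L).mulVec r = l := by
    ext ⟨k, l'⟩
    rw [← hlr]
    simp [Matrix.mulVec, dotProduct, Fintype.sum_prod_type, L]
  have hq : D.combination g P y = P - L.mulVec y := by
    ext s
    simp [combination, L, Matrix.mulVec, dotProduct]
  -- Entries of Λ are moved to the left by the commutation rules `hP` and `hy`; the second one
  -- exchanges the two factors y, whence the reversed product Y.
  have hqq : (fun a : I × I => (P - L.mulVec y) a.1 * (P - L.mulVec y) a.2) =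
      (fun a => P a.1 * P a.2) - (Rm * N + Zm * L).mulVec y - N.mulVec y
        + (L ⊗ₖ L).mulVec (Rm.mulVec Y + Zm.mulVec y) := by
    have h1 : ∀ i j t, (Rm * N + Zm * L) (i, j) t = P i * L j t := by
      intro i j t
      simp only [L, Matrix.map_apply, hP, D.actL_Λ, map_sum, map_smul, Finset.sum_mul]
      simp only [Matrix.add_apply, Matrix.mul_apply, Fintype.sum_prod_type, Rm, Zm, N,
        Matrix.map_apply, Matrix.of_apply, ← Algebra.smul_def, smul_mul_assoc, L]
      rw [Finset.sum_comm]
      rfl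
    have h2 : ∀ t j, ∑ r, y t * (L j r * y r) =
        ∑ s, L j s * (Rm.mulVec Y + Zm.mulVec y) (t, s) := by
      intro t j
      simp only [L, ← mul_assoc, Matrix.map_apply, hy, D.actR_Λ, map_sum, map_smul,
        Finset.sum_mul, add_mul, Finset.sum_add_distrib]
      simp only [Matrix.mulVec, dotProduct, Fintype.sum_prod_type, Rm, Zm, Y, Matrix.map_apply,
        Pi.add_apply, mul_add, Finset.mul_sum, Finset.sum_add_distrib, ← Algebra.smul_def,
        mul_smul_comm, smul_mul_assoc, ← mul_assoc]
      congr 1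
      · rw [sum_comm_three]
        refine Finset.sum_congr rfl fun z _ => ?_
        rw [Finset.sum_comm]
        rfl
      · rw [Finset.sum_comm]
        rfl
    ext ⟨i, j⟩
    have h3 : ((L ⊗ₖ L).mulVec (Rm.mulVec Y + Zm.mulVec y)) (i, j) =
        ∑ t, L i t * ∑ r, y t * (L j r * y r) := by
      simp only [h2, Finset.mul_sum]
      simp only [Matrix.mulVec, dotProduct, Fintype.sum_prod_type, Matrix.kronecker_apply,
        mul_assoc]
    rw [Pi.add_apply, h3]
    simp only [Pi.sub_apply, Matrix.mulVec, dotProduct, h1, N, Matrix.of_apply]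
    simp only [mul_sub, sub_mul, Finset.mul_sum, Finset.sum_mul, mul_assoc, hPy,
      Finset.sum_sub_distrib]
    rw [Finset.sum_comm]
    abel
  have key : (Rm - 1).mulVec ((fun a => (P - L.mulVec y) a.1 * (P - L.mulVec y) a.2)
      - Zm.mulVec (P - L.mulVec y) + (Tm - (L ⊗ₖ L).mulVec Tm)) = 0 := by
    rw [hqq]
    have hyv' := congrArg (L ⊗ₖ L).mulVec hyv
    rw [hlr', ← hPv] at hyv'
    have h3 : (Rm - 1) * Rm * N = - ((Rm - 1) * N) := by rw [hRR, Matrix.neg_mul]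
    generalize hcc : Rm - 1 = c at *
    generalize L ⊗ₖ L = G at *
    simp only [Matrix.mulVec_add, Matrix.mulVec_sub, Matrix.mulVec_mulVec,
      Matrix.add_mulVec, ← Matrix.mul_assoc, h3, hc, Matrix.neg_mulVec] at hyv' ⊢
    rw [Matrix.mul_assoc G c Rm, hRR, Matrix.mul_neg, Matrix.neg_mulVec]
    rw [eq_comm, ← sub_eq_zero] at hyv'
    rw [← hyv']
    abel
  rw [hq]
  have h := congrFun key (k, l')
  rw [e] at h
  simp only [Matrix.mulVec, dotProduct, Fintype.sum_prod_type, Matrix.map_apply, Pi.add_apply,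
    Pi.sub_apply, ← Algebra.smul_def, Matrix.kronecker_apply, Pi.zero_apply] at h ⊢
  rw [← h]
  refine Finset.sum_congr rfl fun i _ => Finset.sum_congr rfl fun j _ => ?_
  congr 1
  congr 1
  · congr 1
    simp [Zm, ← Algebra.smul_def]
  · simp [Tm, L, Algebra.algebraMap_eq_smul_one, map_sub, map_sum]

end Combination

end InhomogeneousDatum

end QuantumGroup

end

noncomputable section

namespace QuantumGroup

/-! ### A representation of B, and functionals on B. -/

namespace Coefficients

variable {A I : Type*} [Ring A] [Bialgebra ℂ A] [Fintype I] [DecidableEq I]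
  (D : Coefficients A I)

/-- Functionals on `C` with given values at `1` and at the generators. -/
theorem exists_dual_linear (h : IsConsistent D.R D.Z D.T) (c : ℂ) (φ : I → ℂ) :
    ∃ f : Module.Dual ℂ D.C, f 1 = c ∧ ∀ i, f (D.x i) = φ i := by
  obtain ⟨f, hf⟩ := D.exists_dual_evalRow h fun w => (w.head?.map φ).getD c
  refine ⟨f, ?_, fun i => ?_⟩
  -- In degrees 0 and 1 there are no adjacent transpositions (`Fin (n - 1)` is empty), so every row
  -- is symmetric and its values are prescribed exactly.
  · have h1 := hf 0 (fun _ => 1) (vecMul_symmetrizer fun k => k.elim0)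
    simpa [evalRow_apply, monomial] using h1
  · have h1 := hf 1 (Pi.single (fun _ => i) 1) (vecMul_symmetrizer fun k => k.elim0)
    simpa [evalRow_apply, monomial, Pi.single_apply] using h1

end Coefficients

/-- Three algebras embed as commuting subalgebras in their tensor product, and functionals on them
extend. -/
theorem exists_tensor.{u, v, w} {U : Type u} {E : Type v} {E' : Type w} [Ring U] [Algebra ℂ U] [Ring E] [Algebra ℂ E] [Ring E']
    [Algebra ℂ E'] (υ : Module.Dual ℂ U) (ξ : Module.Dual ℂ E) (μ : Module.Dual ℂ E') :
    ∃ (W : Type (max u v w)) (_ : Ring W) (_ : Algebra ℂ W) (e : U →ₐ[ℂ] W) (i : E →ₐ[ℂ] W)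
      (j : E' →ₐ[ℂ] W) (l : Module.Dual ℂ W),
      (∀ c u, Commute (i c) (e u)) ∧ (∀ c u, Commute (j c) (e u)) ∧
      (∀ c c', Commute (i c) (j c')) ∧
      (∀ u c c', l (e u * (i c * j c')) = υ u * (ξ c * μ c')) ∧
      ∀ u (z : ℂ), (∀ v, υ (u * v) = z * υ v) → ∀ w, l (e u * w) = z * l w := by
  let l₂ : Module.Dual ℂ (E ⊗[ℂ] E') := LinearMap.mul' ℂ ℂ ∘ₗ TensorProduct.map ξ μ
  let l : Module.Dual ℂ (U ⊗[ℂ] (E ⊗[ℂ] E')) := LinearMap.mul' ℂ ℂ ∘ₗ TensorProduct.map υ l₂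
  refine ⟨U ⊗[ℂ] (E ⊗[ℂ] E'), inferInstance, inferInstance, Algebra.TensorProduct.includeLeft,
    Algebra.TensorProduct.includeRight.comp Algebra.TensorProduct.includeLeft,
    Algebra.TensorProduct.includeRight.comp Algebra.TensorProduct.includeRight, l,
    fun c u => ?_, fun c u => ?_, fun c c' => ?_, fun u c c' => ?_, fun u z h w => ?_⟩
  · simp [commute_iff_eq]
  · simp [commute_iff_eq]
  · simp [commute_iff_eq]
  · simp [l, l₂]
  · induction w using TensorProduct.induction_on with
    | zero => simp
    | add x y hx hy => rw [mul_add, map_add, map_add, hx, hy, mul_add]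
    | tmul v c => simp [l, h, mul_assoc]

namespace InhomogeneousDatum

variable {A I : Type*} [Ring A] [Bialgebra ℂ A] [Fintype I] [DecidableEq I]
  (D : InhomogeneousDatum A I)

theorem twisted_mul {W : Type*} [Ring W] [Algebra ℂ W] (g : A →ₐ[ℂ] W)
    (act : Module.Dual ℂ A →ₗ[ℂ] Module.End ℂ A) (actW : Module.Dual ℂ A →ₗ[ℂ] W) (X : I → W)
    (hf : ∀ s t a, actW (D.f s t) * g a = ∑ m, g (act (D.f s m) a) * actW (D.f m t))
    (hη : ∀ s a, actW (D.η s) * g a =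
      g (act (D.η s) a) + ∑ t, g (act (D.f s t) a) * actW (D.η t))
    (hX : ∀ s a, X s * g a = g a * X s) (s : I) (a : A) :
    D.twisted actW X s * g a =
      ∑ t, g (act (D.f s t) a) * D.twisted actW X t + g (act (D.η s) a) := by
  simp only [twisted, add_mul, mul_add, Finset.sum_mul, Finset.mul_sum, Finset.sum_add_distrib, hη,
    mul_assoc, hX]
  simp only [← mul_assoc, hf, Finset.sum_mul]
  rw [Finset.sum_comm]
  abel

/-- The extra index `none` carries the term η_s(a)ε(b), so that the coproduct rule of η has the
single-sum shape required by `actL_mul` and `actR_mul`. -/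
theorem η_mul_option (s : I) (a b : A) : D.η s (a * b) =
    ∑ i : Option I, (i.elim (D.η s) (D.f s) : Module.Dual ℂ A) a *
      (i.elim Coalgebra.counit D.η : Module.Dual ℂ A) b := by
  rw [D.η_mul, Fintype.sum_option]
  rfl

section Representation

variable {W : Type*} [Ring W] [Algebra ℂ W] (e : Module.End ℂ A →ₐ[ℂ] W)

/-- The multiplication operators of `A`, in an algebra over `End A`. -/
def repG : A →ₐ[ℂ] W := e.comp (Algebra.lmul ℂ A)

/-- The operators `a ↦ a * ρ`, in an algebra over `End A`. -/
def repL : Module.Dual ℂ A →ₗ[ℂ] W := e.toLinearMap ∘ₗ actLHom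

/-- The operators `a ↦ ρ * a`, in an algebra over `End A`. -/
def repR : Module.Dual ℂ A →ₗ[ℂ] W := e.toLinearMap ∘ₗ actRHom

variable {e} {X Y : I → W} (hX : ∀ i u, Commute (X i) (e u)) (hY : ∀ i u, Commute (Y i) (e u))

include hX in
theorem twisted_repL_mul (s : I) (a : A) : D.twisted (repL e) X s * repG e a =
    ∑ t, repG e (actL (D.f s t) a) * D.twisted (repL e) X t + repG e (actL (D.η s) a) := by
  refine D.twisted_mul (repG e) actLHom (repL e) X (fun s t a => ?_) (fun s a => ?_)
    (fun s a => hX _ _) s a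
  · simp only [repL, repG, LinearMap.comp_apply, AlgHom.comp_apply,
      AlgHom.toLinearMap_apply, ← map_mul, ← map_sum]
    congr 1
    ext b
    simpa [actLHom] using actL_mul (D.f_mul s t) a b
  · simp only [repL, repG, LinearMap.comp_apply, AlgHom.comp_apply,
      AlgHom.toLinearMap_apply, ← map_mul, ← map_sum, ← map_add]
    congr 1
    ext b
    have h := actL_mul (D.η_mul_option s) a b
    simp only [Fintype.sum_option, Option.elim_none, Option.elim_some, actL_counit] at h
    simpa [actLHom] using h

include hY in
theorem twisted_repR_mul (s : I) (a : A) : D.twisted (repR e) Y s * repG e a =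
    ∑ t, repG e (actR (D.f s t) a) * D.twisted (repR e) Y t + repG e (actR (D.η s) a) := by
  refine D.twisted_mul (repG e) actRHom (repR e) Y (fun s t a => ?_) (fun s a => ?_)
    (fun s a => hY _ _) s a
  · simp only [repR, repG, LinearMap.comp_apply, AlgHom.comp_apply,
      AlgHom.toLinearMap_apply, ← map_mul, ← map_sum]
    congr 1
    ext b
    simpa [actRHom] using actR_mul (D.f_mul s t) a b
  · simp only [repR, repG, LinearMap.comp_apply, AlgHom.comp_apply,
      AlgHom.toLinearMap_apply, ← map_mul, ← map_sum, ← map_add]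
    congr 1
    ext b
    have h := actR_mul (D.η_mul_option s) a b
    simp only [Fintype.sum_option, Option.elim_none, Option.elim_some, actR_counit] at h
    simpa [actRHom] using h

include hX in
theorem quadExpr_twisted_repL (hXq : ∀ b, D.quadExpr X b = 0) (b : I × I) :
    D.quadExpr (D.twisted (repL e) X) b = repL e (D.τ' b.1 b.2) := by
  refine D.quadExpr_twisted (repL e) X ?_ (fun ρ ρ' => ?_) (fun i ρ => hX _ _) hXq b
  · have h : actLHom (A := A) Coalgebra.counit = 1 := by ext a; exact actL_counit a
    simp [repL, h]
  · have h : actLHom ρ * actLHom ρ' = actLHom (convol ρ' ρ) := by ext a; exact actL_actL ρ ρ' a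
    simp only [repL, LinearMap.comp_apply, AlgHom.toLinearMap_apply, ← map_mul, h]

include hY in
-- The right action is multiplicative, so `quadExpr_twisted` applies to it in the opposite algebra;
-- this reverses the quadratic products, as `combination_quad` expects.
theorem quad_twisted_repR (hYq : ∀ b, D.quadExpr (fun i => MulOpposite.op (Y i)) b = 0)
    (b : I × I) : ∑ a : I × I, (D.R - 1) b a •
    (D.twisted (repR e) Y a.2 * D.twisted (repR e) Y a.1
      - ∑ m, D.Z a m • D.twisted (repR e) Y m + algebraMap ℂ W (D.T a ())) =
      repR e (D.τ' b.1 b.2) := by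
  set act : Module.Dual ℂ A →ₗ[ℂ] Wᵐᵒᵖ :=
    (MulOpposite.opLinearEquiv ℂ (M := W)).toLinearMap ∘ₗ repR e with hact
  have h := D.quadExpr_twisted act (fun i => MulOpposite.op (Y i)) ?_ (fun ρ ρ' => ?_)
    (fun i ρ => ?_) hYq b
  · have h1 : D.twisted act (fun i => MulOpposite.op (Y i)) =
        fun i => MulOpposite.op (D.twisted (repR e) Y i) := by
      funext i
      simp only [twisted, act, LinearMap.comp_apply, LinearEquiv.coe_coe,
        MulOpposite.coe_opLinearEquiv, ← MulOpposite.op_mul, MulOpposite.op_add,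
        Finset.op_sum]
      congr 1
      exact Finset.sum_congr rfl fun t _ => congrArg MulOpposite.op (hY _ _)
    rw [h1] at h
    have h2 := congrArg (MulOpposite.opLinearEquiv ℂ (M := W)).symm h
    simpa [quadExpr, act] using h2
  · have h : actRHom (A := A) Coalgebra.counit = 1 := by ext a; exact actR_counit a
    simp [act, repR, h]
  · have h : actRHom ρ' * actRHom ρ = actRHom (convol ρ' ρ) := by ext a; exact actR_actR ρ' ρ a
    simp only [act, repR, LinearMap.comp_apply, AlgHom.toLinearMap_apply, ← h, map_mul,
      LinearEquiv.coe_coe, MulOpposite.coe_opLinearEquiv, MulOpposite.op_mul]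
  · exact congrArg MulOpposite.op (hY _ _).symm

include hX hY in
theorem twisted_repL_repR (hXY : ∀ i j, Commute (X i) (Y j)) (s t : I) :
    D.twisted (repL e) X s * D.twisted (repR e) Y t =
      D.twisted (repR e) Y t * D.twisted (repL e) X s := by
  have hA : ∀ ρ ρ', Commute (repL e ρ) (repR e ρ') := by
    intro ρ ρ'
    have h : Commute (actLHom ρ) (actRHom ρ') := by
      ext a
      exact actL_actR ρ ρ' a
    exact h.map e
  have hL : ∀ i ρ, Commute (X i) (repR e ρ) := fun i ρ => hX _ _
  have hR : ∀ i ρ, Commute (repL e ρ) (Y i) := fun i ρ => (hY _ _).symm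
  change Commute _ _
  refine .add_left (.sum_left _ _ _ fun i _ => .mul_left ?_ ?_) ?_ <;>
  refine .add_right (.sum_right _ _ _ fun j _ => .mul_right ?_ ?_) ?_ <;>
  first
    | exact hA _ _
    | exact hL _ _
    | exact hR _ _
    | exact hXY _ _

/-- The hypothesis on τ, read as an identity of operators on A: the defects of the right and left
parts match. -/
theorem repR_τ' (k l : I) : ∑ i, ∑ j, repG e (D.Λ k i * D.Λ l j) *
    repR e (D.τ' i j) = repL e (D.τ' k l) := by
  simp only [repL, repR, repG, LinearMap.comp_apply, AlgHom.comp_apply,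
      AlgHom.toLinearMap_apply, ← map_mul, ← map_sum]
  congr 1
  ext b
  simpa [actRHom, actLHom, mul_assoc] using D.Λ_mul_τ k l b

variable (hXY : ∀ i j, Commute (X i) (Y j)) (hXq : ∀ b, D.quadExpr X b = 0)
  (hYq : ∀ b, D.quadExpr (fun i => MulOpposite.op (Y i)) b = 0)

/-- The homomorphism from `B` to an algebra over `End A` given by a solution `X` of the relations of
`C` and a solution `Y` of the opposite relations, which commute with `End A` and with each other. -/
def rep : D.B →ₐ[ℂ] W :=
  D.liftB (repG e) (D.combination (repG e) (D.twisted (repL e) X) (D.twisted (repR e) Y))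
    (D.combination_mul (D.twisted_repL_mul hX) (D.twisted_repR_mul hY))
    (D.combination_quad (D.twisted_repL_mul hX) (D.twisted_repR_mul hY)
      (D.twisted_repL_repR hX hY hXY) (D.quadExpr_twisted_repL hX hXq)
      (r := fun b => repR e (D.τ' b.1 b.2)) (D.quad_twisted_repR hY hYq) D.repR_τ')

theorem rep_ι (a : A) : D.rep hX hY hXY hXq hYq (D.ι a) = repG e a := D.liftB_ι _ _ _ _ a

theorem rep_p (i : I) : D.rep hX hY hXY hXq hYq (D.p i) =
    D.combination (repG e) (D.twisted (repL e) X) (D.twisted (repR e) Y) i := D.liftB_p _ _ _ _ i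

end Representation

/-- There are functionals on `B`, linear over `A` from the left, which vanish on `A` and have given
values at the `p_i`. -/
theorem exists_dual_B (h : IsConsistent D.R D.Z D.T) (φ : I → ℂ) : ∃ χ : Module.Dual ℂ D.B,
    (∀ a b, χ (D.ι a * b) = Coalgebra.counit (R := ℂ) a * χ b) ∧ χ 1 = 0 ∧
      ∀ i, χ (D.p i) = φ i := by
  -- On C the functional ξ vanishes at 1 and sees the generators, while μ is 1 at the unit of C^op;
  -- together with u ↦ ε(u(1)) on End A they keep, in the image of p_s, only the term f_{st} x_t.
  -- There f_{st}(1) = δ_{st} leaves φ_s.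
  obtain ⟨ξ, hξ1, hξ⟩ := D.exists_dual_linear h 0 φ
  obtain ⟨μ, hμ1, -⟩ := D.exists_dual_linear h 1 0
  obtain ⟨W, _, _, e, i, j, l, hi, hj, hij, hl, hlA⟩ := exists_tensor
    ((Coalgebra.counit (R := ℂ) (A := A)) ∘ₗ LinearMap.applyₗ (1 : A)) ξ
    (μ ∘ₗ (MulOpposite.opLinearEquiv ℂ (M := D.C)).symm.toLinearMap)
  have hl1 : ∀ u, l (e u) = 0 := fun u => by simpa [hξ1] using hl u 1 1
  have hli : ∀ u c, l (e u * i c) = Coalgebra.counit (R := ℂ) (u 1) * ξ c := fun u c => by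
    simpa [hμ1] using hl u c 1
  have hlj : ∀ u c, l (e u * j c) = 0 := fun u c => by simpa [hξ1] using hl u 1 c
  -- Multiplication by a, evaluated at 1 and followed by ε, contributes the factor ε(a). This is the
  -- source of the left linearity of χ.
  have hlg : ∀ a w, l (repG e a * w) = Coalgebra.counit (R := ℂ) a * l w :=
    fun a w => hlA _ _ (fun v => by simp) w
  have hXq : ∀ b, D.quadExpr (fun s => i (D.x s)) b = 0 := by
    intro b
    have h := congrArg i (D.quadC_eq b)
    simp only [map_sum, map_smul, map_add, map_sub, map_mul, map_zero, AlgHom.commutes] at h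
    exact h
  have hYq : ∀ b, D.quadExpr (fun s => MulOpposite.op (j (MulOpposite.op (D.x s)))) b = 0 := by
    intro b
    let j' : D.C →ₐ[ℂ] Wᵐᵒᵖ := (AlgHom.op j).comp (AlgEquiv.opOp ℂ D.C).toAlgHom
    have h := congrArg j' (D.quadC_eq b)
    simp only [map_sum, map_smul, map_add, map_sub, map_mul, map_zero, AlgHom.commutes] at h
    exact h
  let β := D.rep (fun s u => hi _ u) (fun s u => hj _ u) (fun s t => hij _ _) hXq hYq
  have hβι : ∀ a, β (D.ι a) = repG e a := D.rep_ι _ _ _ hXq hYq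
  refine ⟨l ∘ₗ β.toLinearMap, fun a b => ?_, ?_, fun s => ?_⟩
  · rw [LinearMap.comp_apply, AlgHom.toLinearMap_apply, map_mul, hβι]
    exact hlg a _
  · rw [LinearMap.comp_apply, AlgHom.toLinearMap_apply, map_one, ← map_one e, hl1]
  · have h1 : ∀ ρ c, l (repL e ρ * i c) = ρ 1 * ξ c := fun ρ c => by
      rw [← counit_actL ρ 1]
      exact hli _ _
    have h2 : ∀ ρ, l (repL e ρ) = 0 := fun ρ => hl1 _
    have h3 : ∀ ρ, l (repR e ρ) = 0 := fun ρ => hl1 _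
    have h4 : ∀ ρ c, l (repR e ρ * j c) = 0 := fun ρ c => hlj _ _
    rw [LinearMap.comp_apply, AlgHom.toLinearMap_apply, rep_p]
    simp [combination, twisted, h1, h2, h3, h4, hlg, D.f_one, hξ]

end InhomogeneousDatum

end QuantumGroup

end

/-! ### Partial derivatives on C and minimality of the coaction. -/

noncomputable section

namespace QuantumGroup

theorem IsSymm.vecMul_symmetrizer {I : Type*} [Fintype I] [DecidableEq I]
    {R : Matrix (I × I) (I × I) ℂ} {φ : List I → ℂ} (h : IsSymm R φ) (n : ℕ) :
    Matrix.vecMul (fun a => φ (List.ofFn a)) (symmetrizer R n) =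
      fun a : Fin n → I => φ (List.ofFn a) := by
  refine QuantumGroup.vecMul_symmetrizer fun k => funext fun b => ?_
  obtain ⟨u, v, hn, p, hk, rfl⟩ := exists_insertTwo k b
  simp only [Matrix.vecMul, dotProduct]
  rw [sum_mul_braidAt R u v hn k hk]
  simp only [ofFn_insertTwo]
  exact h u v p

namespace InhomogeneousDatum

variable {A I : Type*} [Ring A] [Bialgebra ℂ A] [Fintype I] [DecidableEq I]
  (D : InhomogeneousDatum A I)

/-- The operator `(χ ⊗ id) Ψ` on `C`, for a functional `χ` on `B`. -/
def derive (χ : Module.Dual ℂ D.B) : D.C →ₗ[ℂ] D.C :=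
  (TensorProduct.lid ℂ D.C).toLinearMap ∘ₗ χ.rTensor D.C ∘ₗ D.coact.toLinearMap

/-- The functional `b' ↦ χ(b b')`. -/
def mulBy (χ : Module.Dual ℂ D.B) (b : D.B) : Module.Dual ℂ D.B := χ ∘ₗ LinearMap.mulLeft ℂ b

theorem mulBy_apply (χ : Module.Dual ℂ D.B) (b b' : D.B) : D.mulBy χ b b' = χ (b * b') := rfl

theorem derive_one (χ : Module.Dual ℂ D.B) : D.derive χ 1 = χ 1 • (1 : D.C) := by
  simp [derive, Algebra.TensorProduct.one_def]

theorem derive_x_mul (χ : Module.Dual ℂ D.B) (i : I) (c : D.C) : D.derive χ (D.x i * c) =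
    ∑ j, D.x j * D.derive (D.mulBy χ (D.ι (D.Λ i j))) c + D.derive (D.mulBy χ (D.p i)) c := by
  simp only [derive, LinearMap.comp_apply, AlgHom.toLinearMap_apply, map_mul, coact_x]
  induction D.coact c using TensorProduct.induction_on with
  | zero => simp
  | add x y hx hy =>
    simp only [mul_add, map_add, hx, hy, Finset.sum_add_distrib]
    abel
  | tmul b y => simp [add_mul, Finset.sum_mul, mulBy_apply]

/-- The matrix elements of the tensor powers of `Λ`. -/
def wordΛ : List I → List I → A
  | [], [] => 1
  | i :: v, j :: w => D.Λ i j * wordΛ v w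
  | _, _ => 0

/-- In top degree Ψ only sees the summands Λ ⊗ x of Ψ(x_i). The claim is made for all χ because
peeling off a letter replaces χ by χ(b ·). -/
theorem derive_monomial_sub_mem (w : List I) (χ : Module.Dual ℂ D.B) :
    D.derive χ (D.monomial w) -
      pair w.length (fun v => χ (D.ι (D.wordΛ w v))) D.monomial ∈ D.filtLT w.length := by
  induction w generalizing χ with
  | nil =>
    simp [Coefficients.monomial_nil, derive_one, pair_zero, wordΛ]
  | cons i w ih =>
    have hmem : ∀ χ, D.derive χ (D.monomial w) ∈ D.filtLT (w.length + 1) := by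
      intro χ
      have h1 : pair w.length (fun v => χ (D.ι (D.wordΛ w v))) D.monomial ∈
          D.filtLT (w.length + 1) :=
        Submodule.sum_mem _ fun a _ => Submodule.smul_mem _ _ (D.monomial_mem (by simp))
      have h := Submodule.add_mem _ (D.filtLT_mono (Nat.le_succ _) (ih χ)) h1
      rwa [sub_add_cancel] at h
    rw [Coefficients.monomial_cons, derive_x_mul, List.length_cons, pair_succ, add_sub_right_comm,
      ← Finset.sum_sub_distrib]
    refine Submodule.add_mem _ (Submodule.sum_mem _ fun j _ => ?_) (hmem _)
    have h := D.x_mul_mem j (ih (D.mulBy χ (D.ι (D.Λ i j))))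
    rw [mul_sub, ← LinearMap.mulLeft_apply (R := ℂ) _ (pair _ _ _), map_pair] at h
    simpa only [wordΛ, map_mul, mulBy_apply, LinearMap.mulLeft_apply,
      Coefficients.monomial_cons] using h

/-- Applied to a product of entries of Λ, f_{is} is a product of entries of R that carries the first
index through all the others to the last place; a symmetric α does not notice this. -/
theorem sum_pair_f_wordΛ {α : List I → ℂ} (hα : IsSymm D.R α) (s : I) (v : List I) :
    ∑ i, pair v.length (fun w => α (i :: w)) (fun w => D.f i s (D.wordΛ w v)) = α (v ++ [s]) := by
  induction v generalizing α with
  | nil => simp [pair_zero, wordΛ, D.f_one]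
  | cons j v ih =>
    rw [List.cons_append, ← ih (hα.cons j)]
    simp only [List.length_cons, pair_succ, wordΛ, D.f_mul, pair_sum]
    have h1 : ∀ m, pair v.length (fun w => α (j :: m :: w)) (fun w => D.f m s (D.wordΛ w v)) =
        ∑ i, ∑ k, D.f i m (D.Λ k j) *
          pair v.length (fun w => α (i :: k :: w)) (fun w => D.f m s (D.wordΛ w v)) := by
      intro m
      have h2 : ∀ w, α (j :: m :: w) = ∑ i, ∑ k, D.f i m (D.Λ k j) * α (i :: k :: w) := by
        intro w
        have h3 := hα [] w (j, m)
        rw [Fintype.sum_prod_type] at h3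
        simpa [R_apply, mul_comm] using h3.symm
      simp only [h2, pair_sum_left, pair_mul_left, smul_eq_mul]
    simp only [h1, ← smul_eq_mul, pair_smul]
    conv_rhs => rw [sum_comm_three]
    rw [Finset.sum_comm]

section Derivation

variable {s : I} {χ : Module.Dual ℂ D.B}
  (hχ : ∀ a b, χ (D.ι a * b) = Coalgebra.counit (R := ℂ) a * χ b) (hχ1 : χ 1 = 0)
  (hχp : ∀ i, χ (D.p i) = if i = s then 1 else 0)

include hχ hχ1 in
theorem dual_ι (a : A) : χ (D.ι a) = 0 := by
  rw [← mul_one (D.ι a), hχ, hχ1, mul_zero]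

include hχ hχ1 hχp in
-- In p_i a = (a * f_{it})p_t + (element of A), χ kills the last term and picks t = s, and ε(a *
-- f_{is}) = f_{is}(a).
theorem dual_p_mul_ι (i : I) (a : A) : χ (D.p i * D.ι a) = D.f i s a := by
  rw [D.p_mul_ι, map_add, map_sum, D.dual_ι hχ hχ1, add_zero]
  simp [hχ, hχp, counit_actL]

include hχ in
theorem derive_x_mul_of_dual (i : I) (c : D.C) :
    D.derive χ (D.x i * c) = D.x i * D.derive χ c + D.derive (D.mulBy χ (D.p i)) c := by
  have h : ∀ j, D.mulBy χ (D.ι (D.Λ i j)) = (if i = j then (1 : ℂ) else 0) • χ := by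
    intro j
    ext b
    rw [mulBy_apply, hχ, D.counit_Λ]
    rfl
  have h' : ∀ j, D.derive (D.mulBy χ (D.ι (D.Λ i j))) c =
      (if i = j then (1 : ℂ) else 0) • D.derive χ c := by
    intro j
    rw [h]
    split_ifs <;> simp [derive]
  rw [derive_x_mul]
  simp [h']

include hχ hχ1 in
theorem derive_mem {n : ℕ} {y : D.C} (hy : y ∈ D.filtLT (n + 1)) : D.derive χ y ∈ D.filtLT n := by
  have hmon : ∀ w : List I, D.derive χ (D.monomial w) ∈ D.filtLT w.length := by
    intro w
    have h := D.derive_monomial_sub_mem w χ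
    simpa only [D.dual_ι hχ hχ1, pair, zero_smul, Finset.sum_const_zero, sub_zero] using h
  induction hy using Submodule.span_induction with
  | mem y hy =>
    obtain ⟨w, hw, rfl⟩ := hy
    exact D.filtLT_mono (by omega) (hmon w)
  | zero => simp
  | add x y _ _ hx hy => rw [map_add]; exact Submodule.add_mem _ hx hy
  | smul c x _ hx => rw [map_smul]; exact Submodule.smul_mem _ _ hx

include hχ hχ1 hχp in
-- An analogue of the Leibniz rule. The summand p_i ⊗ I at the first letter gives the contraction
-- once, by `sum_pair_f_wordΛ`; the summand Λ_{ij} ⊗ x_j leaves the first letter in place, and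
-- recursion on the remaining letters gives it n more times.
theorem pair_derive_sub_mem (n : ℕ) {α : List I → ℂ} (hα : IsSymm D.R α) :
    pair (n + 1) α (fun w => D.derive χ (D.monomial w)) -
      ((n : ℂ) + 1) • pair n (fun w => α (w ++ [s])) D.monomial ∈ D.filtLT n := by
  have hp : ∑ i, pair n (fun w => α (i :: w))
      (fun w => D.derive (D.mulBy χ (D.p i)) (D.monomial w)) -
        pair n (fun w => α (w ++ [s])) D.monomial ∈ D.filtLT n := by
    have h1 : pair n (fun w => α (w ++ [s])) D.monomial = ∑ i, pair n (fun w => α (i :: w))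
        fun w => pair n (fun v => D.f i s (D.wordΛ w v)) D.monomial := by
      rw [pair_congr (fun v hv => ((by rw [← hv]; exact (D.sum_pair_f_wordΛ hα s v).symm) :
        α (v ++ [s]) = ∑ i, pair n (fun w => α (i :: w)) (fun w => D.f i s (D.wordΛ w v))))
        fun _ _ => rfl, pair_sum_left]
      refine Finset.sum_congr rfl fun i _ => ?_
      simp only [pair, Finset.sum_smul, Finset.smul_sum, smul_smul, smul_eq_mul]
      rw [Finset.sum_comm]
    rw [h1, ← Finset.sum_sub_distrib]
    refine Submodule.sum_mem _ fun i _ => ?_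
    rw [pair, pair, ← Finset.sum_sub_distrib]
    refine Submodule.sum_mem _ fun a _ => ?_
    rw [← smul_sub]
    refine Submodule.smul_mem _ _ ?_
    have h2 := D.derive_monomial_sub_mem (List.ofFn a) (D.mulBy χ (D.p i))
    simpa only [List.length_ofFn, mulBy_apply, D.dual_p_mul_ι hχ hχ1 hχp] using h2
  have hsplit : pair (n + 1) α (fun w => D.derive χ (D.monomial w)) =
      ∑ i, D.x i * pair n (fun w => α (i :: w)) (fun w => D.derive χ (D.monomial w)) +
      ∑ i, pair n (fun w => α (i :: w))
        (fun w => D.derive (D.mulBy χ (D.p i)) (D.monomial w)) := by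
    rw [pair_succ, ← Finset.sum_add_distrib]
    refine Finset.sum_congr rfl fun i _ => ?_
    rw [← LinearMap.mulLeft_apply (R := ℂ), map_pair, ← pair_add]
    refine pair_congr (fun _ _ => rfl) fun w _ => ?_
    rw [Coefficients.monomial_cons, D.derive_x_mul_of_dual hχ]
    rfl
  have hx : ∑ i, D.x i * pair n (fun w => α (i :: w)) (fun w => D.derive χ (D.monomial w)) -
      (n : ℂ) • pair n (fun w => α (w ++ [s])) D.monomial ∈ D.filtLT n := by
    cases n with
    | zero =>
      simp [pair_zero, Coefficients.monomial_nil, derive_one, hχ1]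
    | succ n =>
      rw [pair_succ, Finset.smul_sum, ← Finset.sum_sub_distrib]
      refine Submodule.sum_mem _ fun i _ => ?_
      have h := D.x_mul_mem i (pair_derive_sub_mem n (hα.cons i))
      rw [mul_sub, mul_smul_comm, ← LinearMap.mulLeft_apply (R := ℂ) _ (pair n _ _),
        map_pair] at h
      simpa only [LinearMap.mulLeft_apply, Coefficients.monomial_cons, List.cons_append,
        Nat.cast_succ] using h
  have h := Submodule.add_mem _ hx hp
  rw [hsplit, add_smul, one_smul]
  convert h using 1
  abel

end Derivation

/-- Let α be the symmetric leading term. Its contractions at the last index are symmetric and, as n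
+ 1 ≠ 0 in ℂ, evaluate to lower degree; so they vanish by `eq_zero_of_evalRow_mem`, and α with them.
-/
theorem mem_filtLT_of_derive_eq_zero (h : IsConsistent D.R D.Z D.T)
    {χ : I → Module.Dual ℂ D.B}
    (hχ : ∀ s a b, χ s (D.ι a * b) = Coalgebra.counit (R := ℂ) a * χ s b) (hχ1 : ∀ s, χ s 1 = 0)
    (hχp : ∀ s i, χ s (D.p i) = if i = s then 1 else 0) (n : ℕ) {y : D.C}
    (hy : y ∈ D.filtLT (n + 2)) (hD : ∀ s, D.derive (χ s) y = 0) : y ∈ D.filtLT (n + 1) := by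
  obtain ⟨α, hα, hyα⟩ := D.exists_evalRow_sub_mem h (n + 1) hy
  have hsymm : IsSymm D.R (wordExt α) := isSymm_wordExt fun k => h.vecMul_braidAt hα k
  have hzero : ∀ s (a : Fin n → I), wordExt α (List.ofFn a ++ [s]) = 0 := by
    intro s
    refine congrFun (D.eq_zero_of_evalRow_mem h ((hsymm.concat s).vecMul_symmetrizer n) ?_)
    have h1 := D.derive_mem (hχ s) (hχ1 s) hyα
    rw [map_sub, hD, zero_sub, Coefficients.evalRow_eq_pair, map_pair, Submodule.neg_mem_iff] at h1
    have h2 := Submodule.sub_mem _ h1 (D.pair_derive_sub_mem (hχ s) (hχ1 s) (hχp s) n hsymm)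
    rw [sub_sub_cancel] at h2
    have h3 := (Submodule.smul_mem_iff _ (Nat.cast_add_one_ne_zero n)).1 h2
    exact h3
  have hα0 : α = 0 := by
    funext b
    rw [← wordExt_ofFn α b, List.ofFn_succ', List.concat_eq_append]
    exact hzero _ _
  rwa [hα0, map_zero, sub_zero] at hyα

theorem le_span_one (h : IsConsistent D.R D.Z D.T) (W : Submodule ℂ D.C)
    (hW : ∀ y ∈ W, D.coact y ∈ LinearMap.range (TensorProduct.map D.ι.toLinearMap W.subtype)) :
    W ≤ Submodule.span ℂ {1} := by
  choose χ hχ hχ1 hχp using fun s => D.exists_dual_B h fun i => if i = s then 1 else 0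
  have hD : ∀ y ∈ W, ∀ s, D.derive (χ s) y = 0 := by
    intro y hy s
    obtain ⟨z, hz⟩ := hW y hy
    -- The first legs of Ψ(y) lie in the image of A, which χ_s annihilates.
    have h0 : χ s ∘ₗ D.ι.toLinearMap = 0 := by
      ext a
      exact D.dual_ι (hχ s) (hχ1 s) a
    simp only [derive, LinearMap.comp_apply, AlgHom.toLinearMap_apply, ← hz]
    rw [← LinearMap.comp_apply (f := LinearMap.rTensor D.C (χ s)), LinearMap.rTensor_comp_map, h0,
      TensorProduct.map_zero_left, LinearMap.zero_apply, map_zero]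
  have key : ∀ n, ∀ y ∈ W, y ∈ D.filtLT (n + 1) → y ∈ D.filtLT 1 := by
    intro n
    induction n with
    | zero => exact fun y _ hy => hy
    | succ n ih =>
      exact fun y hyW hy => ih y hyW (D.mem_filtLT_of_derive_eq_zero h hχ hχ1 hχp n hy (hD y hyW))
  intro y hy
  obtain ⟨n, hn⟩ := D.exists_mem_filtLT y
  have h1 := key n y hy (D.filtLT_mono (Nat.le_succ n) hn)
  refine Submodule.span_mono ?_ h1
  rintro _ ⟨w, hw, rfl⟩
  obtain rfl : w = [] := List.length_eq_zero_iff.1 (by omega)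
  exact D.monomial_nil

end InhomogeneousDatum

end QuantumGroup

end

theorem proposition5p3 {A I : Type*} [Ring A] [HopfAlgebra ℂ A] [Fintype I] [DecidableEq I]
    (D : QuantumGroup.InhomogeneousDatum A I)
    (hMor : QuantumGroup.Mor (1 : Matrix Unit Unit A) (D.Λ ⊗ₖ (D.Λ ⊗ₖ D.Λ)) = ⊥) :
    -- existence and uniqueness of `Ψ`, which is a coaction and satisfies the minimality condition
    (∃ Ψ : D.C →ₐ[ℂ] D.B ⊗[ℂ] D.C,
      (∀ i, Ψ (D.x i) = ∑ j, D.ι (D.Λ i j) ⊗ₜ[ℂ] D.x j + D.p i ⊗ₜ[ℂ] (1 : D.C)) ∧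
      (∀ Ψ' : D.C →ₐ[ℂ] D.B ⊗[ℂ] D.C,
        (∀ i, Ψ' (D.x i) = ∑ j, D.ι (D.Λ i j) ⊗ₜ[ℂ] D.x j + D.p i ⊗ₜ[ℂ] (1 : D.C)) → Ψ' = Ψ) ∧
      (∀ y, TensorProduct.lid ℂ D.C
        ((Coalgebra.counit (R := ℂ) (A := D.B)).rTensor D.C (Ψ y)) = y) ∧
      (∀ y, TensorProduct.assoc ℂ D.B D.B D.C
          ((Coalgebra.comul (R := ℂ) (A := D.B)).rTensor D.C (Ψ y)) =
        Ψ.toLinearMap.lTensor D.B (Ψ y)) ∧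
      (∀ W : Submodule ℂ D.C,
        (∀ y ∈ W, Ψ y ∈ LinearMap.range (TensorProduct.map D.ι.toLinearMap W.subtype)) →
          W ≤ Submodule.span ℂ {1})) ∧
    -- the dual bases `α ⊔ β` exist, and the `α^{in}(x ⊗ ⋯ ⊗ x)` form a basis of `C^N`
    (∀ n, ∃ e : Module.Basis (Fin (QuantumGroup.symmetrizer D.R n).rank ⊕
        Fin (1 - QuantumGroup.symmetrizer D.R n).rank) ℂ ((Fin n → I) → ℂ),
      QuantumGroup.IsAdapted e) ∧
    (∀ e : ∀ n, Module.Basis (Fin (QuantumGroup.symmetrizer D.R n).rank ⊕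
        Fin (1 - QuantumGroup.symmetrizer D.R n).rank) ℂ ((Fin n → I) → ℂ),
      (∀ n, QuantumGroup.IsAdapted (e n)) →
      ∀ N : ℕ,
        LinearIndependent ℂ
          (fun i : (Σ n : Fin (N + 1), Fin (QuantumGroup.symmetrizer D.R n).rank) =>
            QuantumGroup.evalTensor D.x ((e i.1).coord (Sum.inl i.2))) ∧
        Submodule.span ℂ (Set.range
          (fun i : (Σ n : Fin (N + 1), Fin (QuantumGroup.symmetrizer D.R n).rank) =>
            QuantumGroup.evalTensor D.x ((e i.1).coord (Sum.inl i.2)))) = D.filtC N) ∧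
    (∀ N : ℕ, Module.finrank ℂ (D.filtC N) =
      ∑ n ∈ Finset.range (N + 1), (QuantumGroup.symmetrizer D.R n).rank) := by
  have h := D.isConsistent hMor
  refine ⟨⟨D.coact, D.coact_x, fun Ψ' hΨ' => ?_, D.counit_coact, D.coact_coassoc,
    D.le_span_one h⟩, fun n => ?_, fun e he N => ?_, D.finrank_filtC h⟩
  · exact D.algHomC_ext fun i => (hΨ' i).trans (D.coact_x i).symm
  · exact QuantumGroup.exists_isAdapted (h.symmetrizer_mul_self n)
  · exact ⟨D.linearIndependent_evalTensor h he N, D.span_evalTensor h he N⟩
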